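/- Let $n$ be a non-negative integer, $I=\{\pm1,\dots,\pm n\}$, and let $p(i)=1$ if $i<0$, $p(i)=0$ if $i>0$ ($i\in I$). Let $\mathbb{C}_q=\mathbb{C}(q)$ be the field of rational functions in $q$, and let $\mathbb{C}_q(n|n)$ be the superspace over $\mathbb{C}_q$ with basis $e_i$, $i\in I$, where $e_i$ has parity $p(i)$. Let $E_{ij}$ be the elementary matrices, of parity $p(i)+p(j)$, and put $\mathsf{E}_{ij}=E_{ij}-(-1)^{p(i)(p(j)+1)}E_{-j,-i}$. Let $$S=1+\sum_{i=1}^n\big((q-1)E_{ii}+(q^{-1}-1)E_{-i,-i}\big)\otimes(E_{ii}+E_{-i,-i})+\frac{q-q^{-1}}{2}\sum_{i=-n}^{-1}\mathsf{E}_{i,-i}\otimes E_{-i,i}+(q-q^{-1})\sum_{1\le|j|<|i|\le n}(-1)^{p(j)}\,\mathsf{E}_{ij}\otimes E_{ji}$$ in $\mathrm{End}_{\mathbb{C}_q}(\mathbb{C}_q(n|n))^{\otimes 2}$. The quantized enveloping superalgebra $\mathfrak{U}_q\mathfrak{p}_n$ is the $\mathbb{Z}_2$-graded unital associative $\mathbb{C}_q$-algebra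 generated by elements $t_{ij}$ and $t_{ii}^{-1}$ (the inverse of $t_{ii}$), $i,j\in I$, where $t_{ij}$ has degree $p(i)+p(j)$, with the relations $t_{ii}=t_{-i,-i}$; $t_{-i,i}=0$ for $i>0$; $t_{ij}=0$ for $|i|>|j|$; and $$T_{12}T_{13}S_{23}=S_{23}T_{13}T_{12},\qquad T=\sum_{|i|\le|j|}t_{ij}\otimes E_{ij},$$ an equality in the tensor product of superalgebras $\mathfrak{U}_q\mathfrak{p}_n\otimes\mathrm{End}_{\mathbb{C}_q}(\mathbb{C}_q(n|n))^{\otimes2}$, in which $(a\otimes b)(c\otimes d)=(-1)^{|b||c|}ac\otimes bd$ for homogeneous elements. Here $T_{12}=\sum t_{ij}\otimes E_{ij}\otimes1$, $T_{13}=\sum t_{ij}\otimes1\otimes E_{ij}$ and $S_{23}=1\otimes S$. Consider the generators $t_{ij}$ labelled by the pairs $(i,j)\in I\times I$ with $|i|<|j|$, or with $|i|=|j|$ and $i>0$ (the remaining symbols $t_{ij}$ are either zero or equal to one of these). Order them totally by declaring $t_{ij}\prec t_{kl}$ if * $|i|>|k|$, or * $|i|=|k|$ and $|j|>|l|$, or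 * $i=k$ and $j=-l>0$, or * $i=-k>0$ and $|j|=|l|$. Such a generator is called diagonal if $i=j$, and odd if $p(i)+p(j)=1$. A reduced monomial is a word $A_1^{k_1}\cdots A_r^{k_r}$, $r\ge0$, in these generators (the empty word being $1$) such that $A_1\prec\cdots\prec A_r$ and, for each $m$: $k_m\in\mathbb{Z}\setminus\{0\}$ if $A_m$ is diagonal, $k_m\in\mathbb{Z}_{>0}$ if $A_m$ is not diagonal, and $k_m=1$ if $A_m$ is odd. **Theorem.** The reduced monomials form a basis of $\mathfrak{U}_q\mathfrak{p}_n$ over $\mathbb{C}_q$: distinct reduced monomials (as words) represent distinct elements, and these elements are a basis of the $\mathbb{C}_q$-vector space $\mathfrak{U}_q\mathfrak{p}_n$. -/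

import Mathlib

noncomputable section

namespace QuantumP

/-- The index set `{±1, …, ±n}`. -/
abbrev Idx (n : ℕ) : Type := {i : ℤ // i ∈ (Finset.Icc (-(n : ℤ)) (n : ℤ)).erase 0}

instance idxNeg (n : ℕ) : Neg (Idx n) where
  neg i := ⟨-i.1, by
    have h := i.2
    simp only [Finset.mem_erase, Finset.mem_Icc, ne_eq] at h ⊢
    omega⟩

/-- The parity of an index: `1` for negative indices, `0` for positive ones. -/
def par {n : ℕ} (i : Idx n) : ℕ := if i.1 < 0 then 1 else 0

/-- The field `ℂ(q)` of rational functions. -/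
abbrev Cq : Type := RatFunc ℂ

/-- The variable `q`. -/
abbrev q : Cq := RatFunc.X

/-- The elementary matrix `E_{ij}`. -/
def E {n : ℕ} (i j : Idx n) : Matrix (Idx n) (Idx n) Cq := Matrix.single i j 1

/-- The matrix `E_{ij} - (-1)^{p(i)(p(j)+1)} E_{-j,-i}` of the periplectic Lie superalgebra. -/
def pE {n : ℕ} (i j : Idx n) : Matrix (Idx n) (Idx n) Cq :=
  E i j - (-1 : Cq) ^ (par i * (par j + 1)) • E (-j) (-i)

/-- `Arr n A` is `A ⊗ End(ℂ_q(n|n)) ⊗ End(ℂ_q(n|n))`: the family `X` stands for the element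
`∑ X i j k l ⊗ E_{ij} ⊗ E_{kl}`. -/
abbrev Arr (n : ℕ) (A : Type) : Type := Idx n → Idx n → Idx n → Idx n → A

/-- The tensor product `X ⊗ Y` of two matrices. -/
def tens {n : ℕ} (X Y : Matrix (Idx n) (Idx n) Cq) : Arr n Cq :=
  fun i j k l => X i j * Y k l

/-- The element `S` of `End(ℂ_q(n|n)) ⊗ End(ℂ_q(n|n))`. -/
def S (n : ℕ) : Arr n Cq :=
  tens 1 1
    + ∑ i : Idx n with 0 < i.1,
        tens ((q - 1) • E i i + (q⁻¹ - 1) • E (-i) (-i)) (E i i + E (-i) (-i))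
    + ((q - q⁻¹) / 2) • ∑ i : Idx n with i.1 < 0, tens (pE i (-i)) (E (-i) i)
    + (q - q⁻¹) • ∑ i : Idx n, ∑ j : Idx n with |j.1| < |i.1|,
        (-1 : Cq) ^ par j • tens (pE i j) (E j i)

/-- The generating symbols `t_{ij}` and `t_{ii}⁻¹`. -/
inductive Gen (n : ℕ) : Type
  | t (i j : Idx n) : Gen n
  | tinv (i : Idx n) : Gen n

/-- The free algebra on the generating symbols. It is `ℤ/2`-graded, `t_{ij}` having degree
`p(i) + p(j)` and `t_{ii}⁻¹` having degree `0`. -/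
abbrev Free (n : ℕ) : Type := FreeAlgebra Cq (Gen n)

/-- The parity automorphism of the free algebra: `x ↦ (-1)^{|x|} x` on homogeneous `x`. -/
def parityAut (n : ℕ) : Free n →ₐ[Cq] Free n :=
  FreeAlgebra.lift Cq fun g => match g with
    | Gen.t i j => (-1 : Cq) ^ (par i + par j) • FreeAlgebra.ι Cq (Gen.t i j)
    | Gen.tinv i => FreeAlgebra.ι Cq (Gen.tinv i)

/-- The product of the tensor product of superalgebras `A ⊗ End ⊗ End`, for `A` the free algebra.
On homogeneous elements
`(x ⊗ E_{ij} ⊗ E_{kl}) (y ⊗ E_{ab} ⊗ E_{cd})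
  = (-1)^{(|E_{ij}| + |E_{kl}|)|y| + |E_{kl}||E_{ab}|} x y ⊗ E_{ij} E_{ab} ⊗ E_{kl} E_{cd}`. -/
def superMul {n : ℕ} (X Y : Arr n (Free n)) : Arr n (Free n) := fun i b k d =>
  ∑ j : Idx n, ∑ l : Idx n,
    (-1 : Cq) ^ ((par k + par l) * (par j + par b)) •
      (X i j k l * (parityAut n ^ (par i + par j + par k + par l)) (Y j b l d))

/-- The entries of `T = ∑_{|i| ≤ |j|} t_{ij} ⊗ E_{ij}`. -/
def T {n : ℕ} (i j : Idx n) : Free n :=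
  if |i.1| ≤ |j.1| then FreeAlgebra.ι Cq (Gen.t i j) else 0

/-- `T₁₂ = ∑ t_{ij} ⊗ E_{ij} ⊗ 1`. -/
def T12 (n : ℕ) : Arr n (Free n) := fun i j k l => if k = l then T i j else 0

/-- `T₁₃ = ∑ t_{ij} ⊗ 1 ⊗ E_{ij}`. -/
def T13 (n : ℕ) : Arr n (Free n) := fun i j k l => if i = j then T k l else 0

/-- `S₂₃ = 1 ⊗ S`. -/
def S23 (n : ℕ) : Arr n (Free n) := fun i j k l => algebraMap Cq (Free n) (S n i j k l)

/-- The defining relations of the quantized enveloping superalgebra. -/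
inductive Rel (n : ℕ) : Free n → Free n → Prop
  | diag (i : Idx n) :
      Rel n (FreeAlgebra.ι Cq (Gen.t i i)) (FreeAlgebra.ι Cq (Gen.t (-i) (-i)))
  | anti (i : Idx n) (hi : 0 < i.1) : Rel n (FreeAlgebra.ι Cq (Gen.t (-i) i)) 0
  | tri (i j : Idx n) (hij : |j.1| < |i.1|) : Rel n (FreeAlgebra.ι Cq (Gen.t i j)) 0
  | mul_inv (i : Idx n) :
      Rel n (FreeAlgebra.ι Cq (Gen.t i i) * FreeAlgebra.ι Cq (Gen.tinv i)) 1
  | inv_mul (i : Idx n) :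
      Rel n (FreeAlgebra.ι Cq (Gen.tinv i) * FreeAlgebra.ι Cq (Gen.t i i)) 1
  | rtt (i j k l : Idx n) :
      Rel n (superMul (superMul (T12 n) (T13 n)) (S23 n) i j k l)
        (superMul (S23 n) (superMul (T13 n) (T12 n)) i j k l)

/-- The quantized enveloping superalgebra `U_q p_n`, as a `ℂ(q)`-algebra. -/
abbrev Uqp (n : ℕ) : Type := RingQuot (Rel n)

/-- The generator `t_{ij}` of `U_q p_n`. -/
def t {n : ℕ} (i j : Idx n) : Uqp n :=
  RingQuot.mkAlgHom Cq (Rel n) (FreeAlgebra.ι Cq (Gen.t i j))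

/-- The generator `t_{ii}⁻¹` of `U_q p_n`. -/
def tinv {n : ℕ} (i : Idx n) : Uqp n :=
  RingQuot.mkAlgHom Cq (Rel n) (FreeAlgebra.ι Cq (Gen.tinv i))

/-- The generator `t_{ii}` as a unit of `U_q p_n`, with inverse `t_{ii}⁻¹`. -/
def tdiag {n : ℕ} (i : Idx n) : (Uqp n)ˣ where
  val := t i i
  inv := tinv i
  val_inv := by
    have h := RingQuot.mkAlgHom_rel Cq (Rel.mul_inv i)
    rwa [map_mul, map_one] at h
  inv_val := by
    have h := RingQuot.mkAlgHom_rel Cq (Rel.inv_mul i)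
    rwa [map_mul, map_one] at h

/-- The pairs `(i, j)` with `|i| ≤ |j|` labelling the generators `t_{ij}`, each generator once:
if `|i| = |j|` only `i > 0` is kept, because `t_{-i,-i} = t_{ii}` and `t_{-i,i} = 0`. -/
abbrev PBWGen (n : ℕ) : Type :=
  {g : Idx n × Idx n // |g.1.1| < |g.2.1| ∨ (|g.1.1| = |g.2.1| ∧ 0 < g.1.1)}

/-- The generator `t_{ij}` is diagonal if `i = j`. -/
def PBWGen.IsDiag {n : ℕ} (g : PBWGen n) : Prop := g.1.1 = g.1.2

/-- The generator `t_{ij}` is odd if `p(i) + p(j)` is odd. -/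
def PBWGen.IsOdd {n : ℕ} (g : PBWGen n) : Prop := Odd (par g.1.1 + par g.1.2)

/-- The total order `t_{ij} ≺ t_{kl}` on the generators. -/
def PBWGen.Prec {n : ℕ} (g h : PBWGen n) : Prop :=
  |g.1.1.1| > |h.1.1.1|
  ∨ (|g.1.1.1| = |h.1.1.1| ∧ |g.1.2.1| > |h.1.2.1|)
  ∨ (g.1.1.1 = h.1.1.1 ∧ g.1.2.1 = -h.1.2.1 ∧ 0 < g.1.2.1)
  ∨ (g.1.1.1 = -h.1.1.1 ∧ 0 < g.1.1.1 ∧ |g.1.2.1| = |h.1.2.1|)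

open Classical in
/-- The power `t_{ij}^k`: an integer power of a unit if `i = j`; for `i ≠ j` only `k ≥ 0` is
meaningful. -/
def PBWGen.pow {n : ℕ} (g : PBWGen n) (k : ℤ) : Uqp n :=
  if g.IsDiag then ((tdiag g.1.1 ^ k : (Uqp n)ˣ) : Uqp n) else t g.1.1 g.1.2 ^ k.toNat

/-- A reduced monomial `A₁^{k₁} ⋯ A_r^{k_r}` as a formal word `[(A₁, k₁), …, (A_r, k_r)]`. The
empty word is allowed. -/
structure ReducedMonomial (n : ℕ) where
  /-- The list of the generators of the word with their exponents. -/
  word : List (PBWGen n × ℤ)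
  sorted : word.Pairwise fun a b => a.1.Prec b.1
  ne_zero : ∀ a ∈ word, a.2 ≠ 0
  pos : ∀ a ∈ word, ¬ a.1.IsDiag → 0 < a.2
  odd : ∀ a ∈ word, a.1.IsOdd → a.2 = 1

/-- The element of `U_q p_n` represented by a reduced monomial. -/
def ReducedMonomial.eval {n : ℕ} (m : ReducedMonomial n) : Uqp n :=
  (m.word.map fun a => a.1.pow a.2).prod

end QuantumP

end

/-! The proof works near q = 1: `val` is the valuation of ℂ(q) at q = 1, written multiplicatively,
so that `val c < 1` means that c vanishes there. Since S ≡ 1 modulo q - 1, the algebra is compared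
with a supercommutative one.

Spanning. The defining relation reorders two generators up to a sign, with error q - 1 times
products of exactly two generators (`t_mul_t`). Suppose a functional kills the reduced words of
length d but not all words of that length. Scale it so that its largest absolute value on these
finitely many words is 1. Sorting a word then changes the value, modulo the maximal ideal, only by a
sign, and a repeated odd letter forces 2x ≡ 0, hence x ≡ 0. So the value is never a unit, a
contradiction of Nakayama type (`eq_zero_of_reduced`).

Independence. S satisfies the super Yang–Baxter equation (`S_yangBaxter`), so the coproduct, with
one tensor factor acting on the vector representation, is an algebra map `comul` into matrices over
End(U_q p_n). The rescaled generators y = (t - δ)/(q - 1) are primitive modulo q - 1 for it. A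
suitable combination of matrix coefficients therefore acts on words in the y like the partial
derivative with respect to one chosen generator (`sum_detect_sOne`, `contract_letters`). Iterating
it builds a functional that is a unit on a given reduced word, and small on shorter words and on the
other reduced words of the same length (`exists_functional`). Reduced words in the y are thus
independent, and a dimension count passes to words in the t (`linearIndependent_tword`).

The Yang–Baxter equation is proved in braid form. The braiding satisfies a quadratic Hecke relation,
so the kernel of the braid defect is stable under both braidings. It then suffices to check sorted
basis vectors and to reach the others by neighbouring swaps (`braidDefect_of_sorted`,
`braidDefect_e3`).

Negative exponents. Each t_{ii} commutes with every generator up to a nonzero scalar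
(`quasiCommutes_t`), so multiplying by diagonal generators clears denominators and reduces the
theorem to ordinary words. -/

noncomputable section
namespace QuantumP

/-! ### Signed indices, their parity and numbering. -/

section Indices

variable {n : ℕ}

instance idxInvolutiveNeg (n : ℕ) : InvolutiveNeg (Idx n) where
  neg_neg i := Subtype.ext (neg_neg i.1)

@[simp] lemma neg_val (i : Idx n) : (-i).1 = -i.1 := rfl

lemma val_ne_zero (i : Idx n) : i.1 ≠ 0 := (Finset.mem_erase.mp i.2).1

lemma ne_neg_self (i : Idx n) : i ≠ -i := fun h => by
  have h1 := congrArg Subtype.val h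
  have h2 := val_ne_zero i
  rw [neg_val] at h1
  omega

lemma neg_ne_self (i : Idx n) : -i ≠ i := (ne_neg_self i).symm

lemma par_of_pos {i : Idx n} (h : 0 < i.1) : par i = 0 := if_neg h.le.not_gt

lemma par_of_neg {i : Idx n} (h : i.1 < 0) : par i = 1 := if_pos h

lemma pos_or_neg (i : Idx n) : 0 < i.1 ∨ i.1 < 0 := by
  have := val_ne_zero i
  omega

lemma abs_eq_abs_iff {i j : Idx n} : |i.1| = |j.1| ↔ i = j ∨ i = -j := by
  rw [abs_eq_abs]
  simp only [Subtype.ext_iff, neg_val]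

lemma par_eq_zero_or_one (i : Idx n) : par i = 0 ∨ par i = 1 := by
  unfold par
  split_ifs <;> simp

lemma par_neg (i : Idx n) : par (-i) = 1 - par i := by
  rcases pos_or_neg i with h | h
  · rw [par_of_pos h, par_of_neg (by simpa using h)]
  · rw [par_of_neg h, par_of_pos (by simpa using h)]

lemma par_neg_zmod (i : Idx n) : (par (-i) : ZMod 2) = 1 + par i := by
  rw [par_neg]
  rcases par_eq_zero_or_one i with h | h <;> rw [h] <;> decide

/-- An injective numbering of the indices: `1 < -1 < 2 < -2 < ⋯`. -/
def key (i : Idx n) : ℤ := 2 * |i.1| + par i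

lemma key_cases (i : Idx n) :
    0 < i.1 ∧ |i.1| = i.1 ∧ par i = 0 ∧ key i = 2 * i.1 ∨
      i.1 < 0 ∧ |i.1| = -i.1 ∧ par i = 1 ∧ key i = 2 * -i.1 + 1 := by
  rcases pos_or_neg i with h | h
  · left
    simp [key, par_of_pos h, abs_of_pos h, h]
  · right
    simp [key, par_of_neg h, abs_of_neg h, h]

lemma key_injective : Function.Injective (key (n := n)) := fun i j h => by
  apply Subtype.ext
  have h1 := key_cases i
  have h2 := key_cases j
  omega

lemma key_lt_of_abs_lt {i j : Idx n} (h : |i.1| < |j.1|) : key i < key j := by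
  have h1 := key_cases i
  have h2 := key_cases j
  omega

end Indices

/-- The coefficient `q - q⁻¹`. -/
def z : Cq := q - q⁻¹

lemma q_ne_zero : q ≠ 0 := RatFunc.X_ne_zero

/-- The coefficient of `E_{ii} ⊗ E_{kk}` in `S`. -/
def diagCoeff {n : ℕ} (i k : Idx n) : Cq :=
  if |i.1| = |k.1| then (if 0 < i.1 then q else q⁻¹) else 1

lemma E_apply {n : ℕ} (i j a b : Idx n) :
    E i j a b = if i = a then (if j = b then 1 else 0) else 0 := by
  rw [E, Matrix.single_apply]
  split_ifs <;> simp_all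

/-! ### The matrix entries of S. -/

section SEntries

variable {n : ℕ}

lemma sum_diag_apply (a b c d : Idx n) :
    (∑ i : Idx n with 0 < i.1,
        tens ((q - 1) • E i i + (q⁻¹ - 1) • E (-i) (-i)) (E i i + E (-i) (-i))) a b c d =
      if a = b ∧ c = d then diagCoeff a c - 1 else 0 := by
  simp only [Finset.sum_apply, tens, Matrix.add_apply, Matrix.smul_apply, E_apply,
    neg_eq_iff_eq_neg, smul_eq_mul]
  by_cases h1 : a = b
  swap
  · rw [if_neg (fun h => h1 h.1)]
    refine Finset.sum_eq_zero fun i _ => ?_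
    have h0 := neg_ne_self a
    have h2 : ∀ i : Idx n, i = a → i ≠ b := fun i h h' => h1 (h ▸ h')
    have h3 : ∀ i : Idx n, i = -a → i ≠ -b := fun i h h' => h1 (neg_injective (h ▸ h'))
    rcases eq_or_ne i a with h | h <;> rcases eq_or_ne i (-a) with h' | h' <;> simp_all
  by_cases h4 : c = d
  swap
  · rw [if_neg (fun h => h4 h.2)]
    refine Finset.sum_eq_zero fun i _ => ?_
    have h0 := neg_ne_self c
    have h2 : ∀ i : Idx n, i = c → i ≠ d := fun i h h' => h4 (h ▸ h')
    have h3 : ∀ i : Idx n, i = -c → i ≠ -d := fun i h h' => h4 (neg_injective (h ▸ h'))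
    rcases eq_or_ne i c with h | h <;> rcases eq_or_ne i (-c) with h' | h' <;> simp_all
  subst h1 h4
  rw [if_pos ⟨rfl, rfl⟩, Finset.sum_filter]
  have key : ∀ i : Idx n, (if 0 < i.1 then
      ((q - 1) * (if i = a then if i = a then (1 : Cq) else 0 else 0) +
        (q⁻¹ - 1) * if i = -a then if i = -a then 1 else 0 else 0) *
      ((if i = c then if i = c then 1 else 0 else 0) +
        if i = -c then if i = -c then 1 else 0 else 0) else 0) =
      (if i = a then if 0 < a.1 then if |a.1| = |c.1| then q - 1 else 0 else 0 else 0) +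
      (if i = -a then if a.1 < 0 then if |a.1| = |c.1| then q⁻¹ - 1 else 0 else 0 else 0) := by
    intro i
    have hc := ne_neg_self c
    have ha := ne_neg_self a
    have ha' := ne_neg_self i
    rcases eq_or_ne i a with h | h
    · subst h
      simp only [abs_eq_abs_iff]
      rcases eq_or_ne i c with h' | h'
      · subst h'
        simp [ha]
      · simp only [h', ha, if_true, if_false, false_or, mul_zero, add_zero, zero_add]
        split_ifs <;> simp
    · rcases eq_or_ne i (-a) with h' | h'
      · obtain rfl : a = -i := by rw [h', neg_neg]
        simp only [abs_eq_abs_iff]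
        rcases eq_or_ne i c with h' | h'
        · subst h'
          simp [h]
        · rcases eq_or_ne i (-c) with h'' | h''
          · subst h''
            simp [hc.symm, hc]
          · have : -i ≠ c := fun hh => h'' (by rw [← hh, neg_neg])
            simp [h, h', h'', this]
      · simp [h, h']
  rw [Finset.sum_congr rfl fun i _ => key i, Finset.sum_add_distrib, Finset.sum_ite_eq',
    Finset.sum_ite_eq', if_pos (Finset.mem_univ _), if_pos (Finset.mem_univ _), diagCoeff]
  rcases pos_or_neg a with h | h
  · rw [if_pos h, if_neg h.le.not_gt, if_pos h]
    split_ifs <;> simp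
  · rw [if_neg h.le.not_gt, if_pos h, if_neg h.le.not_gt]
    split_ifs <;> simp

/-- For i < 0 both terms of `pE i (-i)` are E_{i,-i}, and the sign makes them add up. The resulting
2 cancels the denominator in S. -/
lemma sum_opposite_apply (a b c d : Idx n) :
    (∑ i : Idx n with i.1 < 0, tens (pE i (-i)) (E (-i) i)) a b c d =
      if c = b ∧ d = a ∧ d.1 < 0 ∧ c = -d then 2 else 0 := by
  simp only [Finset.sum_apply, tens, E_apply]
  rw [Finset.sum_filter]
  have key : ∀ i : Idx n, (if i.1 < 0 then
      pE i (-i) a b * (if -i = c then if i = d then 1 else 0 else 0) else 0) =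
      if i = d then if d.1 < 0 ∧ c = -d then pE d (-d) a b else 0 else 0 := by
    intro i
    rcases eq_or_ne i d with h | h
    · subst h
      simp only [if_true, eq_comm (a := c)]
      split_ifs <;> simp_all
    · simp [h]
  rw [Finset.sum_congr rfl fun i _ => key i, Finset.sum_ite_eq', if_pos (Finset.mem_univ _)]
  by_cases h : d.1 < 0 ∧ c = -d
  · obtain ⟨h1, rfl⟩ := h
    rw [if_pos ⟨h1, rfl⟩]
    have h2 : par (-d) = 0 := par_of_pos (by simpa using h1)
    simp only [pE, Matrix.sub_apply, Matrix.smul_apply, E_apply, par_of_neg h1, h2, neg_neg]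
    by_cases h3 : -d = b ∧ d = a
    · obtain ⟨rfl, rfl⟩ := h3
      simp only [if_true, h1, and_self]
      norm_num
    · have h5 : ¬ (-d = b ∧ d = a ∧ d.1 < 0 ∧ True) := fun h => h3 ⟨h.1, h.2.1⟩
      rw [if_neg h5]
      by_cases h4 : -d = b <;> by_cases h5 : d = a <;> simp_all
  · rw [if_neg h, if_neg (fun hh => h hh.2.2)]

lemma sum_swap_apply (a b c d : Idx n) :
    (∑ i : Idx n, ∑ j : Idx n with |j.1| < |i.1|,
        (-1 : Cq) ^ par j • tens (pE i j) (E j i)) a b c d =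
      if |c.1| < |d.1| then (-1 : Cq) ^ par c * pE d c a b else 0 := by
  simp only [Finset.sum_apply, tens, E_apply, Pi.smul_apply, smul_eq_mul]
  have key : ∀ i j : Idx n, (if |j.1| < |i.1| then
      (-1 : Cq) ^ par j * (pE i j a b * (if j = c then if i = d then 1 else 0 else 0)) else 0) =
      if i = d then (if j = c then (if |c.1| < |d.1| then (-1 : Cq) ^ par c * pE d c a b else 0)
        else 0) else 0 := by
    intro i j
    rcases eq_or_ne i d with rfl | h
    · rcases eq_or_ne j c with rfl | h'
      · simp
      · simp [h']
    · simp [h]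
  simp only [Finset.sum_filter, key]
  simp

/-- The entries of `S`: a diagonal part, a permutation part and a contraction part. -/
lemma S_apply (a b c d : Idx n) :
    S n a b c d =
      (if a = b ∧ c = d then diagCoeff a c else 0) +
      (if c = b ∧ d = a ∧ key c < key d then z * (-1) ^ par c else 0) +
      (if a = -c ∧ b = -d ∧ |c.1| < |d.1| then
        -(z * (-1) ^ (par c + par d * (par c + 1))) else 0) := by
  have hz : q - q⁻¹ = z := rfl
  simp only [S, Pi.add_apply, Pi.smul_apply, sum_diag_apply, sum_opposite_apply, sum_swap_apply, hz]
  simp only [tens, Matrix.one_apply, pE, Matrix.sub_apply, Matrix.smul_apply, E_apply, smul_eq_mul]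
  have h1 : ((if a = b then 1 else 0) * (if c = d then 1 else 0) : Cq) =
      if a = b ∧ c = d then 1 else 0 := by
    split_ifs <;> simp_all
  rw [h1]
  have h2 : (if a = b ∧ c = d then (1 : Cq) else 0) +
      (if a = b ∧ c = d then diagCoeff a c - 1 else 0) =
      if a = b ∧ c = d then diagCoeff a c else 0 := by
    split_ifs <;> simp
  rw [h2, add_assoc, add_assoc]
  congr 1
  -- The numbering puts k immediately before -k for k > 0. Hence this one condition covers both the
  -- opposite terms and the swap terms of S.
  have h3 : key c < key d ↔ (d.1 < 0 ∧ c = -d) ∨ |c.1| < |d.1| := by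
    have h1 := key_cases c
    have h2 := key_cases d
    rw [Subtype.ext_iff, neg_val]
    omega
  have hA : ((if d = a then if c = b then 1 else 0 else 0 : Cq)) =
      if c = b ∧ d = a then 1 else 0 := by
    by_cases h1 : d = a <;> by_cases h2 : c = b <;> simp [h1, h2]
  have hB : ((if -c = a then if -d = b then 1 else 0 else 0 : Cq)) =
      if a = -c ∧ b = -d then 1 else 0 := by
    by_cases h1 : -c = a <;> by_cases h2 : -d = b <;> simp [h1, h2, @eq_comm _ a, @eq_comm _ b]
  rw [hA, hB]
  by_cases h4 : d.1 < 0 ∧ c = -d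
  · have h5 : ¬ |c.1| < |d.1| := by
      rw [h4.2]
      simp
    have hp : (-1 : Cq) ^ par c = 1 := by
      rw [par_of_pos (by rw [h4.2]; simpa using h4.1), pow_zero]
    have h6 : key c < key d := h3.mpr (Or.inl h4)
    by_cases hA : c = b ∧ d = a
    · have h7 : c = b ∧ d = a ∧ d.1 < 0 ∧ c = -d := ⟨hA.1, hA.2, h4⟩
      have h8 : c = b ∧ d = a ∧ key c < key d := ⟨hA.1, hA.2, h6⟩
      simp only [if_pos h7, if_pos h8, h5, and_false, if_false, hp]
      ring
    · have h7 : ¬ (c = b ∧ d = a ∧ d.1 < 0 ∧ c = -d) := fun h => hA ⟨h.1, h.2.1⟩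
      have h8 : ¬ (c = b ∧ d = a ∧ key c < key d) := fun h => hA ⟨h.1, h.2.1⟩
      simp only [if_neg h7, if_neg h8, h5, and_false, if_false]
      ring
  · rw [if_neg (fun h => h4 h.2.2)]
    by_cases h5 : |c.1| < |d.1|
    · have h6 : key c < key d := h3.mpr (Or.inr h5)
      simp only [h5, h6, and_true, if_true, pow_add]
      by_cases h7 : c = b ∧ d = a <;> by_cases h8 : a = -c ∧ b = -d
      · simp only [if_pos h7, if_pos h8]
        ring
      · simp only [if_pos h7, if_neg h8]
        ring
      · simp only [if_neg h7, if_pos h8]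
        ring
      · simp only [if_neg h7, if_neg h8]
        ring
    · have h6 : ¬ key c < key d := fun h => (h3.mp h).elim h4 h5
      simp only [h5, h6, and_false, if_false, mul_zero, add_zero]

end SEntries

end QuantumP
end

noncomputable section
namespace QuantumP

instance natAlgebraCq : Algebra ℕ Cq := Semiring.toNatAlgebra

instance intAlgebraCq : Algebra ℤ Cq := Ring.toIntAlgebra _

/-! ### The braid form of S and its Hecke relation. -/

section Braid

variable {n : ℕ}

/-- The coefficients of the braid form `S ∘ P` of `S`, where `P` is the super flip. -/
def braid (x y a b : Idx n) : Cq := (-1) ^ (par y * par b) * S n x b y a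

/-- The coefficient of `v_b ⊗ v_a` in the image of `v_a ⊗ v_b` under the braiding. -/
def flipCoeff (a b : Idx n) : Cq := (-1) ^ (par a * par b) * diagCoeff b a

/-- The basis vector `v_a ⊗ v_b`. -/
def e2 (a b : Idx n) : Idx n → Idx n → Cq := fun x y => if x = a ∧ y = b then 1 else 0

/-- The vector `∑_{|k| < m} v_{-k} ⊗ v_k`. -/
def omega (n : ℕ) (m : ℤ) : Idx n → Idx n → Cq := ∑ k : Idx n with |k.1| < m, e2 (-k) k

/-- The braiding on `V ⊗ V`. -/
def braidMap (n : ℕ) : (Idx n → Idx n → Cq) →ₗ[Cq] (Idx n → Idx n → Cq) where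
  toFun f := fun x y => ∑ u, ∑ v, braid x y u v * f u v
  map_add' f g := by
    funext x y
    simp [mul_add, Finset.sum_add_distrib]
  map_smul' c f := by
    funext x y
    simp only [Pi.smul_apply, smul_eq_mul, RingHom.id_apply, Finset.mul_sum]
    exact Finset.sum_congr rfl fun _ _ => Finset.sum_congr rfl fun _ _ => by ring

lemma braidMap_e2_apply (a b x y : Idx n) : braidMap n (e2 a b) x y = braid x y a b := by
  simp only [braidMap, e2, LinearMap.coe_mk, AddHom.coe_mk, ite_and, mul_ite, mul_one, mul_zero]
  rw [Finset.sum_eq_single a (by simp +contextual) (by simp)]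
  simp

lemma omega_apply (m : ℤ) (x y : Idx n) :
    omega n m x y = if x = -y ∧ |y.1| < m then 1 else 0 := by
  simp only [omega, Finset.sum_apply, e2, Finset.sum_filter]
  rw [Finset.sum_eq_single y]
  · by_cases h : x = -y <;> by_cases h' : |y.1| < m <;> simp [h, h']
  · intro b _ hb
    simp [hb.symm]
  · simp

/-- The three parts of `S_apply` become a flip, a multiple of the identity on descents, and a
contraction which only sees v_a ⊗ v_{-a}. -/
lemma braidMap_e2 (a b : Idx n) :
    braidMap n (e2 a b) = flipCoeff a b • e2 b a +
      (if key b < key a then z else 0) • e2 a b +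
      (if b = -a then -(z * (-1) ^ par a) else 0) • omega n |a.1| := by
  funext x y
  rw [braidMap_e2_apply, braid, S_apply]
  simp only [Pi.add_apply, Pi.smul_apply, smul_eq_mul, e2, omega_apply, mul_add, flipCoeff]
  congr 1
  · congr 1
    · by_cases h : x = b ∧ y = a
      · obtain ⟨rfl, rfl⟩ := h
        simp
      · simp [h]
    · by_cases h : x = a ∧ y = b
      · obtain ⟨rfl, rfl⟩ := h
        simp only [and_self, true_and, if_true, mul_one]
        split_ifs
        · rcases par_eq_zero_or_one y with h | h <;> rw [h] <;> simp
        · simp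
      · rw [if_neg h, if_neg (fun hh => h ⟨hh.2.1.symm, hh.1⟩), mul_zero, mul_zero]
  · by_cases h : b = -a
    · subst h
      by_cases h' : x = -y ∧ |y.1| < |a.1|
      · simp only [h'.1, h'.2, and_self, if_true, mul_one, par_neg]
        rcases par_eq_zero_or_one y with h | h <;> rcases par_eq_zero_or_one a with h' | h' <;>
          rw [h, h'] <;> simp <;> ring
      · rw [if_neg h', if_neg (fun hh => h' ⟨hh.1, hh.2.2⟩), mul_zero, mul_zero]
    · simp [h]

lemma flipCoeff_of_abs_ne {a b : Idx n} (h : |a.1| ≠ |b.1|) :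
    flipCoeff a b = (-1) ^ (par a * par b) := by
  rw [flipCoeff, diagCoeff, if_neg h.symm, mul_one]

lemma flipCoeff_self_of_pos {a : Idx n} (h : 0 < a.1) : flipCoeff a a = q := by
  simp [flipCoeff, diagCoeff, h, par_of_pos h]

lemma flipCoeff_self_of_neg {a : Idx n} (h : a.1 < 0) : flipCoeff a a = -q⁻¹ := by
  simp [flipCoeff, diagCoeff, h.le.not_gt, par_of_neg h]

lemma flipCoeff_neg_of_pos {a : Idx n} (h : 0 < a.1) : flipCoeff a (-a) = q⁻¹ := by
  simp [flipCoeff, diagCoeff, h.le.not_gt, par_of_pos h]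

lemma flipCoeff_neg_of_neg {a : Idx n} (h : a.1 < 0) : flipCoeff a (-a) = q := by
  simp [flipCoeff, diagCoeff, h, par_neg, par_of_neg h]

lemma flipCoeff_mul_flipCoeff {a b : Idx n} (h : |a.1| ≠ |b.1|) :
    flipCoeff a b * flipCoeff b a = 1 := by
  rw [flipCoeff_of_abs_ne h, flipCoeff_of_abs_ne h.symm, mul_comm (par b), ← mul_pow]
  simp

lemma abs_ne_of_ne {a b : Idx n} (h : a ≠ b) (h' : b ≠ -a) : |a.1| ≠ |b.1| := fun hh => by
  rcases abs_eq_abs_iff.mp hh with h1 | h1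
  · exact h h1
  · exact h' (by rw [h1, neg_neg])

lemma braidMap_e2_of_le {a b : Idx n} (h : key a ≤ key b) (h' : b ≠ -a) :
    braidMap n (e2 a b) = flipCoeff a b • e2 b a := by
  rw [braidMap_e2, if_neg h.not_gt, if_neg h', zero_smul, zero_smul, add_zero, add_zero]

lemma braidMap_e2_of_gt {a b : Idx n} (h : key b < key a) (h' : b ≠ -a) :
    braidMap n (e2 a b) = flipCoeff a b • e2 b a + z • e2 a b := by
  rw [braidMap_e2, if_pos h, if_neg h', zero_smul, add_zero]

lemma braidMap_e2_neg_of_pos {a : Idx n} (h : 0 < a.1) :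
    braidMap n (e2 a (-a)) = q⁻¹ • e2 (-a) a - z • omega n |a.1| := by
  have h1 := key_cases a
  have h2 := key_cases (-a)
  rw [neg_val] at h2
  rw [braidMap_e2, if_neg (by omega), if_pos rfl, par_of_pos h, flipCoeff_neg_of_pos h, zero_smul,
    add_zero, pow_zero, mul_one, neg_smul, sub_eq_add_neg]

lemma braidMap_e2_neg_of_neg {a : Idx n} (h : a.1 < 0) :
    braidMap n (e2 a (-a)) = q • e2 (-a) a + z • e2 a (-a) + z • omega n |a.1| := by
  have h1 := key_cases a
  have h2 := key_cases (-a)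
  rw [neg_val] at h2
  rw [braidMap_e2, if_pos (by omega), if_pos rfl, par_of_neg h, flipCoeff_neg_of_neg h, pow_one,
    mul_neg, mul_one, neg_neg]

lemma sum_neg_index {M : Type*} [AddCommMonoid M] (m : ℤ) (f : Idx n → M) :
    ∑ k : Idx n with |k.1| < m, f (-k) = ∑ k : Idx n with |k.1| < m, f k := by
  rw [Finset.sum_filter, Finset.sum_filter, ← Equiv.sum_comp (Equiv.neg (Idx n))]
  simp

/-- The terms of ω_m are paired as k and -k: the two lower ω-terms cancel, and q⁻¹ + z = q gives the
eigenvalue. -/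
lemma braidMap_omega (m : ℤ) : braidMap n (omega n m) = q • omega n m := by
  have h2 : (2 : Cq) ≠ 0 := two_ne_zero
  have key : ∀ k : Idx n, braidMap n (e2 (-k) k) + braidMap n (e2 (- -k) (-k)) =
      q • (e2 (-k) k + e2 (- -k) (-k)) := by
    have : ∀ k : Idx n, 0 < k.1 → braidMap n (e2 (-k) k) + braidMap n (e2 (- -k) (-k)) =
      q • (e2 (-k) k + e2 (- -k) (-k)) := by
      intro k hk
      have h1 := braidMap_e2_neg_of_pos hk
      have h2 := braidMap_e2_neg_of_neg (a := -k) (by simpa using hk)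
      rw [neg_neg] at h2 ⊢
      rw [h1, h2, neg_val, abs_neg, z]
      module
    intro k
    rcases pos_or_neg k with hk | hk
    · exact this k hk
    · have := this (-k) (by simpa using hk)
      rw [neg_neg] at this ⊢
      rw [add_comm, this, add_comm]
  -- Summing the pair identity over all k counts every pair twice, so the claim is proved after
  -- doubling.
  have h3 : (2 : Cq) • braidMap n (omega n m) = (2 : Cq) • (q • omega n m) := by
    have h4 : (2 : Cq) • braidMap n (omega n m) = ∑ k : Idx n with |k.1| < m,
        (braidMap n (e2 (-k) k) + braidMap n (e2 (- -k) (-k))) := by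
      rw [Finset.sum_add_distrib, sum_neg_index m fun k => braidMap n (e2 (-k) k), two_smul, omega,
        map_sum]
    have h5 : (2 : Cq) • omega n m = ∑ k : Idx n with |k.1| < m, (e2 (-k) k + e2 (- -k) (-k)) := by
      rw [Finset.sum_add_distrib, sum_neg_index m fun k => e2 (-k) k, two_smul, omega]
    rw [h4, Finset.sum_congr rfl fun k _ => key k, ← Finset.smul_sum, ← h5, smul_comm]
  exact smul_right_injective _ h2 h3

lemma eq_sum_e2 (f : Idx n → Idx n → Cq) : f = ∑ a, ∑ b, f a b • e2 a b := by
  funext x y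
  simp only [Finset.sum_apply, Pi.smul_apply, e2, smul_eq_mul, ite_and, mul_ite, mul_one, mul_zero]
  simp

/-- The braiding satisfies the Hecke relation. -/
lemma braidMap_braidMap (f : Idx n → Idx n → Cq) :
    braidMap n (braidMap n f) = z • braidMap n f + f := by
  have hq := q_ne_zero
  have key : ∀ a b : Idx n, braidMap n (braidMap n (e2 a b)) = z • braidMap n (e2 a b) + e2 a b := by
    intro a b
    rcases eq_or_ne b (-a) with rfl | h
    · rcases pos_or_neg a with ha | ha
      · have h1 := braidMap_e2_neg_of_pos ha
        have h2 := braidMap_e2_neg_of_neg (a := -a) (by simpa using ha)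
        rw [neg_neg, neg_val, abs_neg] at h2
        rw [h1, map_sub, map_smul, map_smul, h2, braidMap_omega, z]
        match_scalars <;> field_simp <;> ring
      · have h1 := braidMap_e2_neg_of_neg ha
        have h2 := braidMap_e2_neg_of_pos (a := -a) (by simpa using ha)
        rw [neg_neg, neg_val, abs_neg] at h2
        rw [h1, map_add, map_add, map_smul, map_smul, map_smul, h2, h1, braidMap_omega, z]
        match_scalars <;> field_simp <;> ring
    · rcases eq_or_ne a b with rfl | h'
      · rw [braidMap_e2_of_le le_rfl h, map_smul, braidMap_e2_of_le le_rfl h]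
        rcases pos_or_neg a with ha | ha
        · rw [flipCoeff_self_of_pos ha, z]
          match_scalars
          field_simp
          ring
        · rw [flipCoeff_self_of_neg ha, z]
          match_scalars
          field_simp
          ring
      · have h1 := flipCoeff_mul_flipCoeff (abs_ne_of_ne h' h)
        have h2 : a ≠ -b := fun hh => h (by rw [hh, neg_neg])
        rcases lt_or_gt_of_ne (fun hh => h' (key_injective hh)) with h3 | h3
        · rw [braidMap_e2_of_le h3.le h, map_smul, braidMap_e2_of_gt h3 h2, smul_add, smul_smul, h1]
          module
        · rw [braidMap_e2_of_gt h3 h, map_add, map_smul, map_smul, braidMap_e2_of_gt h3 h,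
            braidMap_e2_of_le h3.le h2, smul_smul, h1]
          module
  rw [eq_sum_e2 f]
  simp only [map_sum, map_smul, key, smul_add, Finset.smul_sum, Finset.sum_add_distrib]
  simp only [smul_comm z]

end Braid

end QuantumP
end

noncomputable section
namespace QuantumP

/-! ### The braid relation on sorted vectors of V ⊗ V ⊗ V. -/

section BraidRelation

variable {n : ℕ}

/-- The space `V ⊗ V ⊗ V`, in coordinates. -/
def V3 (n : ℕ) : Type := Idx n → Idx n → Idx n → Cq

instance (n : ℕ) : AddCommGroup (V3 n) := inferInstanceAs (AddCommGroup (Idx n → Idx n → Idx n → Cq))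

instance (n : ℕ) : Module Cq (V3 n) := inferInstanceAs (Module Cq (Idx n → Idx n → Idx n → Cq))

/-- The braiding on the first two factors of `V ⊗ V ⊗ V`. -/
def braid₁ (n : ℕ) : V3 n →ₗ[Cq] V3 n where
  toFun f := fun x y w => braidMap n (fun u v => f u v w) x y
  map_add' f g := by
    funext x y w
    exact congrFun (congrFun (map_add (braidMap n) (fun u v => f u v w) fun u v => g u v w) x) y
  map_smul' c f := by
    funext x y w
    exact congrFun (congrFun (map_smul (braidMap n) c (fun u v => f u v w)) x) y

/-- The braiding on the last two factors of `V ⊗ V ⊗ V`. -/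
def braid₂ (n : ℕ) : V3 n →ₗ[Cq] V3 n where
  toFun f := fun x => braidMap n (f x)
  map_add' f g := by
    funext x
    exact map_add (braidMap n) (f x) (g x)
  map_smul' c f := by
    funext x
    exact map_smul (braidMap n) c (f x)

/-- The map `g ↦ g ⊗ v_c`. -/
def tensRight (c : Idx n) : (Idx n → Idx n → Cq) →ₗ[Cq] V3 n where
  toFun g := fun x y w => if w = c then g x y else 0
  map_add' f g := by
    funext x y w
    change (if w = c then f x y + g x y else 0) =
      (if w = c then f x y else 0) + if w = c then g x y else 0
    split_ifs <;> simp
  map_smul' r f := by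
    funext x y w
    change (if w = c then r * f x y else 0) = r * if w = c then f x y else 0
    split_ifs <;> simp

/-- The map `g ↦ v_a ⊗ g`. -/
def tensLeft (a : Idx n) : (Idx n → Idx n → Cq) →ₗ[Cq] V3 n where
  toFun g := fun x y w => if x = a then g y w else 0
  map_add' f g := by
    funext x y w
    change (if x = a then f y w + g y w else 0) =
      (if x = a then f y w else 0) + if x = a then g y w else 0
    split_ifs <;> simp
  map_smul' r f := by
    funext x y w
    change (if x = a then r * f y w else 0) = r * if x = a then f y w else 0
    split_ifs <;> simp

/-- The basis vector `v_a ⊗ v_b ⊗ v_c`. -/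
def e3 (a b c : Idx n) : V3 n := tensRight c (e2 a b)

lemma tensLeft_e2 (a b c : Idx n) : tensLeft a (e2 b c) = e3 a b c := by
  funext x y w
  change (if x = a then if y = b ∧ w = c then (1 : Cq) else 0 else 0) =
    if w = c then if x = a ∧ y = b then 1 else 0 else 0
  by_cases h1 : x = a <;> by_cases h2 : y = b <;> by_cases h3 : w = c <;> simp [h1, h2, h3]

lemma braid₁_tensRight (c : Idx n) (g : Idx n → Idx n → Cq) :
    braid₁ n (tensRight c g) = tensRight c (braidMap n g) := by
  funext x y w
  change braidMap n (fun u v => if w = c then g u v else 0) x y =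
    if w = c then braidMap n g x y else 0
  by_cases h : w = c
  · simp only [h, if_true]
  · simp only [h, if_false]
    exact congrFun (congrFun (map_zero (braidMap n)) x) y

lemma braid₂_tensLeft (a : Idx n) (g : Idx n → Idx n → Cq) :
    braid₂ n (tensLeft a g) = tensLeft a (braidMap n g) := by
  funext x
  change braidMap n (fun y w => if x = a then g y w else 0) =
    fun y w => if x = a then braidMap n g y w else 0
  by_cases h : x = a
  · simp only [h, if_true]
  · simp only [h, if_false]
    exact map_zero (braidMap n)

lemma braid₁_braid₁ (f : V3 n) :
    braid₁ n (braid₁ n f) = z • braid₁ n f + f := by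
  funext x y w
  exact congrFun (congrFun (braidMap_braidMap fun u v => f u v w) x) y

lemma braid₂_braid₂ (f : V3 n) :
    braid₂ n (braid₂ n f) = z • braid₂ n f + f := by
  funext x
  exact braidMap_braidMap (f x)

lemma braid₁_of_le {a b : Idx n} (c : Idx n) (h : key a ≤ key b) (h' : b ≠ -a) :
    braid₁ n (e3 a b c) = flipCoeff a b • e3 b a c := by
  rw [e3, braid₁_tensRight, braidMap_e2_of_le h h', map_smul]
  rfl

lemma braid₁_of_gt {a b : Idx n} (c : Idx n) (h : key b < key a) (h' : b ≠ -a) :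
    braid₁ n (e3 a b c) = flipCoeff a b • e3 b a c + z • e3 a b c := by
  rw [e3, braid₁_tensRight, braidMap_e2_of_gt h h', map_add, map_smul, map_smul]
  rfl

lemma braid₂_of_le (a : Idx n) {b c : Idx n} (h : key b ≤ key c) (h' : c ≠ -b) :
    braid₂ n (e3 a b c) = flipCoeff b c • e3 a c b := by
  rw [← tensLeft_e2, braid₂_tensLeft, braidMap_e2_of_le h h', map_smul, tensLeft_e2]

lemma braid₂_of_gt (a : Idx n) {b c : Idx n} (h : key c < key b) (h' : c ≠ -b) :
    braid₂ n (e3 a b c) = flipCoeff b c • e3 a c b + z • e3 a b c := by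
  rw [← tensLeft_e2, braid₂_tensLeft, braidMap_e2_of_gt h h', map_add, map_smul, map_smul,
    tensLeft_e2, tensLeft_e2]

lemma braid₁_neg_of_pos {a : Idx n} (c : Idx n) (h : 0 < a.1) :
    braid₁ n (e3 a (-a) c) = q⁻¹ • e3 (-a) a c - z • tensRight c (omega n |a.1|) := by
  rw [e3, braid₁_tensRight, braidMap_e2_neg_of_pos h, map_sub, map_smul, map_smul]
  rfl

lemma braid₁_neg_of_neg {a : Idx n} (c : Idx n) (h : a.1 < 0) :
    braid₁ n (e3 a (-a) c) =
      q • e3 (-a) a c + z • e3 a (-a) c + z • tensRight c (omega n |a.1|) := by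
  rw [e3, braid₁_tensRight, braidMap_e2_neg_of_neg h, map_add, map_add, map_smul, map_smul,
    map_smul]
  rfl

lemma braid₂_neg_of_pos (c : Idx n) {a : Idx n} (h : 0 < a.1) :
    braid₂ n (e3 c a (-a)) = q⁻¹ • e3 c (-a) a - z • tensLeft c (omega n |a.1|) := by
  rw [← tensLeft_e2, braid₂_tensLeft, braidMap_e2_neg_of_pos h, map_sub, map_smul, map_smul,
    tensLeft_e2]

lemma braid₂_neg_of_neg (c : Idx n) {a : Idx n} (h : a.1 < 0) :
    braid₂ n (e3 c a (-a)) =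
      q • e3 c (-a) a + z • e3 c a (-a) + z • tensLeft c (omega n |a.1|) := by
  rw [← tensLeft_e2, braid₂_tensLeft, braidMap_e2_neg_of_neg h, map_add, map_add, map_smul,
    map_smul, map_smul, tensLeft_e2, tensLeft_e2]

lemma tensRight_omega (c : Idx n) (m : ℤ) :
    tensRight c (omega n m) = ∑ k : Idx n with |k.1| < m, e3 (-k) k c := by
  rw [omega, map_sum]
  rfl

lemma tensLeft_omega (c : Idx n) (m : ℤ) :
    tensLeft c (omega n m) = ∑ k : Idx n with |k.1| < m, e3 c (-k) k := by
  rw [omega, map_sum]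
  simp only [tensLeft_e2]

lemma braid₂_omega (c : Idx n) (m : ℤ) :
    braid₂ n (tensLeft c (omega n m)) = q • tensLeft c (omega n m) := by
  rw [braid₂_tensLeft, braidMap_omega, map_smul]

/-- The vector `∑_{|k| < m} (-1)^{p(k)p(c)} v_{-k} ⊗ v_c ⊗ v_k`. -/
def splitOmega (c : Idx n) (m : ℤ) : V3 n :=
  ∑ k : Idx n with |k.1| < m, (-1 : Cq) ^ (par k * par c) • e3 (-k) c k

lemma ne_neg_of_abs_lt {a b : Idx n} (h : |a.1| < |b.1|) : b ≠ -a := by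
  rintro rfl
  simp at h

lemma ne_neg_of_abs_gt {a b : Idx n} (h : |a.1| < |b.1|) : a ≠ -b := by
  rintro rfl
  simp at h

/-- When m ≤ |c|, every index occurring in ω_m precedes c and is not opposite to it, so v_c passes
each of them by a pure signed flip. -/
lemma braid₂_omega_right {c : Idx n} {m : ℤ} (h : m ≤ |c.1|) :
    braid₂ n (tensRight c (omega n m)) = splitOmega c m := by
  rw [tensRight_omega, map_sum, splitOmega]
  refine Finset.sum_congr rfl fun k hk => ?_
  have hk : |k.1| < |c.1| := (Finset.mem_filter.mp hk).2.trans_le h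
  rw [braid₂_of_le _ (key_lt_of_abs_lt hk).le (ne_neg_of_abs_lt hk), flipCoeff_of_abs_ne hk.ne]

lemma sign_mul_sign_neg (k c : Idx n) :
    (-1 : Cq) ^ (par k * par c) * (-1) ^ (par (-k) * par c) = (-1) ^ par c := by
  rw [← pow_add, ← add_mul, par_neg]
  rcases par_eq_zero_or_one k with h | h <;> rw [h] <;> simp

lemma braid₁_splitOmega {c : Idx n} {m : ℤ} (h : m ≤ |c.1|) :
    braid₁ n (splitOmega c m) = (-1 : Cq) ^ par c • tensLeft c (omega n m) := by
  rw [tensLeft_omega, splitOmega, map_sum, Finset.smul_sum]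
  refine Finset.sum_congr rfl fun k hk => ?_
  have hk : |(-k).1| < |c.1| := by
    rw [neg_val, abs_neg]
    exact (Finset.mem_filter.mp hk).2.trans_le h
  rw [map_smul, braid₁_of_le _ (key_lt_of_abs_lt hk).le (ne_neg_of_abs_lt hk),
    flipCoeff_of_abs_ne hk.ne, smul_smul, sign_mul_sign_neg]

lemma braid₁_omega_left {c : Idx n} {m : ℤ} (h : m ≤ |c.1|) :
    braid₁ n (tensLeft c (omega n m)) =
      (-1 : Cq) ^ par c • splitOmega c m + z • tensLeft c (omega n m) := by
  rw [tensLeft_omega, splitOmega, map_sum, Finset.smul_sum, Finset.smul_sum,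
    ← Finset.sum_add_distrib]
  refine Finset.sum_congr rfl fun k hk => ?_
  have hk : |(-k).1| < |c.1| := by
    rw [neg_val, abs_neg]
    exact (Finset.mem_filter.mp hk).2.trans_le h
  rw [braid₁_of_gt _ (key_lt_of_abs_lt hk) (ne_neg_of_abs_gt hk), flipCoeff_of_abs_ne hk.ne',
    smul_smul, ← sign_mul_sign_neg k c, mul_comm (par c)]
  congr 2
  rw [mul_right_comm, ← mul_pow]
  simp

lemma braid₂_splitOmega {c : Idx n} {m : ℤ} (h : m ≤ |c.1|) :
    braid₂ n (splitOmega c m) = tensRight c (omega n m) + z • splitOmega c m := by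
  rw [tensRight_omega, splitOmega, map_sum, Finset.smul_sum, ← Finset.sum_add_distrib]
  refine Finset.sum_congr rfl fun k hk => ?_
  have hk : |k.1| < |c.1| := (Finset.mem_filter.mp hk).2.trans_le h
  rw [map_smul, braid₂_of_gt _ (key_lt_of_abs_lt hk) (ne_neg_of_abs_gt hk),
    flipCoeff_of_abs_ne hk.ne', smul_add, smul_smul, mul_comm (par c), ← mul_pow, smul_comm z]
  simp

lemma sum_filter_abs_lt {M : Type*} [AddCommMonoid M] (a : Idx n) {m : ℤ} (h : |a.1| < m)
    (f : Idx n → M) :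
    ∑ k : Idx n with |k.1| < m, f k =
      (∑ k : Idx n with |k.1| < |a.1|, f k) + (f a + f (-a)) +
        ∑ k : Idx n with |a.1| < |k.1| ∧ |k.1| < m, f k := by
  have h1 : (Finset.univ.filter fun k : Idx n => |k.1| < m) =
      (Finset.univ.filter fun k : Idx n => |k.1| < |a.1|) ∪ {a, -a} ∪
        (Finset.univ.filter fun k : Idx n => |a.1| < |k.1| ∧ |k.1| < m) := by
    ext k
    simp only [Finset.mem_filter, Finset.mem_univ, true_and, Finset.mem_union, Finset.mem_insert,
      Finset.mem_singleton, ← abs_eq_abs_iff]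
    omega
  rw [h1, Finset.sum_union, Finset.sum_union, Finset.sum_pair (ne_neg_self a)]
  · rw [Finset.disjoint_left]
    simp only [Finset.mem_filter, Finset.mem_univ, true_and, Finset.mem_insert,
      Finset.mem_singleton, ← abs_eq_abs_iff]
    intro k
    omega
  · rw [Finset.disjoint_left]
    simp only [Finset.mem_filter, Finset.mem_univ, true_and, Finset.mem_union, Finset.mem_insert,
      Finset.mem_singleton, ← abs_eq_abs_iff]
    intro k
    omega

/-- The vector `ω_m` can be moved through `v_a`. -/
lemma braid₂_braid₁_omega {a : Idx n} {m : ℤ} (h : |a.1| < m) :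
    braid₂ n (braid₁ n (tensLeft a (omega n m))) =
      (-1 : Cq) ^ par a • tensRight a (omega n m) := by
  have hq := q_ne_zero
  have h1 : braid₂ n (braid₁ n (∑ k : Idx n with |a.1| < |k.1| ∧ |k.1| < m, e3 a (-k) k)) =
      (-1 : Cq) ^ par a • ∑ k : Idx n with |a.1| < |k.1| ∧ |k.1| < m, e3 (-k) k a := by
    rw [map_sum, map_sum, Finset.smul_sum]
    refine Finset.sum_congr rfl fun k hk => ?_
    have hk : |a.1| < |k.1| := (Finset.mem_filter.mp hk).2.1
    have hk' : |a.1| < |(-k).1| := by rwa [neg_val, abs_neg]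
    rw [braid₁_of_le _ (key_lt_of_abs_lt hk').le (ne_neg_of_abs_lt hk'), map_smul,
      braid₂_of_le _ (key_lt_of_abs_lt hk).le (ne_neg_of_abs_lt hk),
      flipCoeff_of_abs_ne hk.ne, flipCoeff_of_abs_ne hk'.ne, smul_smul, mul_comm (par a),
      mul_comm (par a), mul_comm, sign_mul_sign_neg]
  -- The sum ω_m is cut at |a|. The outer indices only flip past v_a, by `h1`; the terms k = ±a and
  -- the inner sum ω_{|a|} interact and are computed together.
  have h2 := sum_filter_abs_lt a h fun k => e3 a (-k) k
  have h3 := sum_filter_abs_lt a h fun k => e3 (-k) k a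
  rw [← tensLeft_omega, ← tensLeft_omega, neg_neg] at h2
  rw [← tensRight_omega, ← tensRight_omega, neg_neg] at h3
  rw [h2, h3, map_add, map_add, h1, smul_add]
  refine congrArg₂ (· + ·) ?_ rfl
  rcases pos_or_neg a with ha | ha
  · have h4 := braid₁_neg_of_pos a ha
    have h7 := braid₂_of_le (-a) (b := a) (c := a) le_rfl (ne_neg_self a)
    have h8 := braid₁_of_le (a := a) (b := a) (-a) le_rfl (ne_neg_self a)
    rw [flipCoeff_self_of_pos ha] at h7 h8
    simp only [map_add, map_sub, map_smul, h4, h7, h8, braid₁_omega_left le_rfl,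
      braid₂_omega_right le_rfl, braid₂_splitOmega le_rfl, braid₂_omega, braid₂_neg_of_pos a ha,
      par_of_pos ha, pow_zero, one_smul, z]
    match_scalars <;> field_simp <;> ring
  · have h4 := braid₁_neg_of_neg a ha
    have h7 := braid₂_of_le (-a) (b := a) (c := a) le_rfl (ne_neg_self a)
    have h8 := braid₁_of_le (a := a) (b := a) (-a) le_rfl (ne_neg_self a)
    have h9 := braid₂_neg_of_pos a (a := -a) (by simpa using ha)
    rw [neg_neg, neg_val, abs_neg] at h9
    rw [flipCoeff_self_of_neg ha] at h7 h8
    simp only [map_add, map_smul, h4, h7, h8, h9, braid₁_omega_left le_rfl,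
      braid₂_omega_right le_rfl, braid₂_splitOmega le_rfl, braid₂_omega, braid₂_neg_of_neg a ha,
      par_of_neg ha, pow_one, z]
    match_scalars <;> field_simp <;> ring

/-- The defect of the braid relation. -/
def braidDefect (n : ℕ) : V3 n →ₗ[Cq] V3 n :=
  braid₁ n ∘ₗ braid₂ n ∘ₗ braid₁ n - braid₂ n ∘ₗ braid₁ n ∘ₗ braid₂ n

lemma braidDefect_apply (f : V3 n) :
    braidDefect n f = braid₁ n (braid₂ n (braid₁ n f)) - braid₂ n (braid₁ n (braid₂ n f)) := rfl

/-- Write D for the defect and B₁, B₂ for the braidings. The Hecke relation gives D B₁ = (z - B₂) D,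
so ker D is stable under B₁. -/
lemma braidDefect_braid₁ {f : V3 n} (h : braidDefect n f = 0) :
    braidDefect n (braid₁ n f) = 0 := by
  have h1 : braidDefect n (braid₁ n f) = z • braidDefect n f - braid₂ n (braidDefect n f) := by
    simp only [braidDefect_apply, braid₁_braid₁, braid₂_braid₂, map_add, map_sub, map_smul]
    module
  rw [h1, h, map_zero, smul_zero, sub_zero]

lemma braidDefect_braid₂ {f : V3 n} (h : braidDefect n f = 0) :
    braidDefect n (braid₂ n f) = 0 := by
  have h1 : braidDefect n (braid₂ n f) = z • braidDefect n f - braid₁ n (braidDefect n f) := by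
    simp only [braidDefect_apply, braid₁_braid₁, braid₂_braid₂, map_add, map_sub, map_smul]
    module
  rw [h1, h, map_zero, smul_zero, sub_zero]

/-- On a sorted triple the braidings are flips except where two opposite indices meet. Without such
a meeting both sides are the same multiple of v_c ⊗ v_b ⊗ v_a; with one, the ω-terms are moved by
the preceding formulas. -/
lemma braidDefect_of_sorted {a b c : Idx n} (hab : key a ≤ key b) (hbc : key b ≤ key c) :
    braidDefect n (e3 a b c) = 0 := by
  have hq := q_ne_zero
  have ka := key_cases a
  have kb := key_cases b
  have kc := key_cases c
  rw [braidDefect_apply, sub_eq_zero]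
  rcases eq_or_ne b (-a) with rfl | h1
  · have ha : 0 < a.1 := by
      rw [neg_val] at kb
      omega
    have hna : (-a).1 < 0 := by simpa using ha
    rcases eq_or_ne c (-a) with rfl | h2
    · have h3 := braid₂_neg_of_neg (-a) hna
      have h4 := braid₂_of_le a (b := -a) (c := -a) le_rfl (ne_neg_self _)
      have h5 := braid₁_of_le (a := -a) (b := -a) a le_rfl (ne_neg_self _)
      have h6 : |a.1| = |(-a).1| := by simp
      rw [neg_neg] at h3
      rw [flipCoeff_self_of_neg hna] at h4 h5
      have h7 := braid₂_neg_of_pos (-a) ha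
      simp only [map_sub, map_smul, braid₁_neg_of_pos (-a) ha, h4, h5, h6, h7,
        braid₁_omega_left le_rfl, braid₂_omega_right le_rfl, braid₁_splitOmega le_rfl,
        par_of_neg hna, pow_one, z]
      match_scalars <;> field_simp <;> ring
    · have h3 : |a.1| < |c.1| := by
        rw [Ne, Subtype.ext_iff, neg_val] at h2
        rw [neg_val] at kb
        omega
      have h3' : |(-a).1| < |c.1| := by rwa [neg_val, abs_neg]
      have h4 := sign_mul_sign_neg a c
      have h5 := fun x => braid₂_of_le x (key_lt_of_abs_lt h3).le (ne_neg_of_abs_lt h3)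
      have h6 := fun x => braid₁_of_le x (key_lt_of_abs_lt h3).le (ne_neg_of_abs_lt h3)
      have h7 := fun x => braid₂_of_le x (key_lt_of_abs_lt h3').le (ne_neg_of_abs_lt h3')
      have h8 := fun x => braid₁_of_le x (key_lt_of_abs_lt h3').le (ne_neg_of_abs_lt h3')
      have h9 : (-1 : Cq) ^ (par (-a) * par c) * (-1) ^ (par a * par c) = (-1) ^ par c := by
        rw [mul_comm, h4]
      rw [flipCoeff_of_abs_ne h3.ne] at h5 h6
      rw [flipCoeff_of_abs_ne h3'.ne] at h7 h8
      simp only [map_sub, map_smul, braid₁_neg_of_pos c ha, braid₂_neg_of_pos c ha,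
        h5, h6, h7, h8, braid₂_omega_right h3.le, braid₁_splitOmega h3.le]
      rw [smul_smul, smul_smul, smul_smul, smul_smul, mul_assoc, h4, h9]
      module
  · rcases eq_or_ne c (-b) with rfl | h2
    · have hb : 0 < b.1 := by
        rw [neg_val] at kc
        omega
      have hnb : (-b).1 < 0 := by simpa using hb
      rcases eq_or_ne a b with rfl | h3
      · have h4 := fun x => braid₂_of_le x (b := a) (c := a) le_rfl (ne_neg_self _)
        have h5 := fun x => braid₁_of_le (a := a) (b := a) x le_rfl (ne_neg_self _)
        rw [flipCoeff_self_of_pos hb] at h4 h5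
        simp only [map_add, map_sub, map_smul, h4, h5, braid₁_neg_of_pos a hb,
          braid₂_neg_of_pos a hb, braid₁_omega_left le_rfl, braid₂_omega_right le_rfl,
          braid₂_splitOmega le_rfl, braid₂_omega, par_of_pos hb, pow_zero, one_smul, z]
        match_scalars <;> field_simp <;> ring
      · have h4 : |a.1| < |b.1| := by
          rw [Ne, Subtype.ext_iff] at h3
          omega
        have h4' : |a.1| < |(-b).1| := by rwa [neg_val, abs_neg]
        have h5 := fun x => braid₂_of_le x (key_lt_of_abs_lt h4).le (ne_neg_of_abs_lt h4)
        have h6 := fun x => braid₁_of_le x (key_lt_of_abs_lt h4).le (ne_neg_of_abs_lt h4)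
        have h7 := fun x => braid₂_of_le x (key_lt_of_abs_lt h4').le (ne_neg_of_abs_lt h4')
        have h8 := fun x => braid₁_of_le x (key_lt_of_abs_lt h4').le (ne_neg_of_abs_lt h4')
        have h9 := sign_mul_sign_neg b a
        rw [flipCoeff_of_abs_ne h4.ne, mul_comm (par a)] at h5 h6
        rw [flipCoeff_of_abs_ne h4'.ne, mul_comm (par a)] at h7 h8
        simp only [map_sub, map_smul, braid₂_neg_of_pos a hb, h5, h6, h7, h8,
          braid₁_neg_of_pos a hb, braid₂_braid₁_omega h4]
        rw [← h9]
        module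
    · rcases eq_or_ne c (-a) with rfl | h3
      -- The indices ±a are adjacent in the numbering, so b cannot lie strictly between a and -a.
      · exfalso
        rw [Ne, neg_inj, Subtype.ext_iff] at h2
        rw [Ne, Subtype.ext_iff, neg_val] at h1
        rw [neg_val] at kc
        omega
      · rw [braid₁_of_le c hab h1, map_smul, braid₂_of_le b (hab.trans hbc) h3, map_smul, map_smul,
          braid₁_of_le a hbc h2, braid₂_of_le a hbc h2, map_smul,
          braid₁_of_le b (hab.trans hbc) h3, map_smul, map_smul, braid₂_of_le c hab h1]
        module

end BraidRelation

end QuantumP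
end

noncomputable section
namespace QuantumP

/-! ### From sorted vectors to the super Yang–Baxter equation. -/

section SuperYangBaxter

variable {n : ℕ}

lemma flipCoeff_ne_zero (a b : Idx n) : flipCoeff a b ≠ 0 := by
  have hq := q_ne_zero
  refine mul_ne_zero (pow_ne_zero _ (neg_ne_zero.mpr one_ne_zero)) ?_
  rw [diagCoeff]
  split_ifs <;> simp [hq]

/-- The ω-terms created by braiding v_a ⊗ v_{-a} have a smaller total number, which is what the
induction for the braid relation descends on. -/
lemma key_add_key_neg_lt {a k : Idx n} (h : |k.1| < |a.1|) :
    key (-k) + key k < key a + key (-a) := by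
  have h1 := key_lt_of_abs_lt h
  have h2 : key (-k) < key (-a) := key_lt_of_abs_lt (by simpa using h)
  omega

lemma pos_of_key_le_key_neg {a : Idx n} (h : key a ≤ key (-a)) : 0 < a.1 := by
  have h1 := key_cases a
  have h2 := key_cases (-a)
  rw [neg_val] at h2
  omega

/-- For a before b, the first braiding sends v_a ⊗ v_b ⊗ v_c to a nonzero multiple of the swapped
vector plus ω-terms of smaller total number. The image has zero defect because the kernel is stable,
and the ω-terms have zero defect by induction. -/
lemma braidDefect_swap₁ {a b c : Idx n}
    (ih : ∀ x y w : Idx n, key x + key y + key w < key a + key b + key c →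
      braidDefect n (e3 x y w) = 0)
    (h : braidDefect n (e3 a b c) = 0) (hab : key a ≤ key b) : braidDefect n (e3 b a c) = 0 := by
  have hq := q_ne_zero
  have h1 := braidDefect_braid₁ h
  rcases eq_or_ne b (-a) with rfl | hb
  · have h2 : braidDefect n (tensRight c (omega n |a.1|)) = 0 := by
      rw [tensRight_omega, map_sum]
      refine Finset.sum_eq_zero fun k hk => ih _ _ _ ?_
      have := key_add_key_neg_lt (Finset.mem_filter.mp hk).2
      omega
    rw [braid₁_neg_of_pos c (pos_of_key_le_key_neg hab), map_sub, map_smul, map_smul, h2,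
      smul_zero, sub_zero] at h1
    exact (smul_eq_zero.mp h1).resolve_left (inv_ne_zero hq)
  · rw [braid₁_of_le c hab hb, map_smul] at h1
    exact (smul_eq_zero.mp h1).resolve_left (flipCoeff_ne_zero a b)

lemma braidDefect_swap₂ {a b c : Idx n}
    (ih : ∀ x y w : Idx n, key x + key y + key w < key a + key b + key c →
      braidDefect n (e3 x y w) = 0)
    (h : braidDefect n (e3 a b c) = 0) (hbc : key b ≤ key c) : braidDefect n (e3 a c b) = 0 := by
  have hq := q_ne_zero
  have h1 := braidDefect_braid₂ h
  rcases eq_or_ne c (-b) with rfl | hb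
  · have h2 : braidDefect n (tensLeft a (omega n |b.1|)) = 0 := by
      rw [tensLeft_omega, map_sum]
      refine Finset.sum_eq_zero fun k hk => ih _ _ _ ?_
      have := key_add_key_neg_lt (Finset.mem_filter.mp hk).2
      omega
    rw [braid₂_neg_of_pos a (pos_of_key_le_key_neg hbc), map_sub, map_smul, map_smul, h2,
      smul_zero, sub_zero] at h1
    exact (smul_eq_zero.mp h1).resolve_left (inv_ne_zero hq)
  · rw [braid₂_of_le a hbc hb, map_smul] at h1
    exact (smul_eq_zero.mp h1).resolve_left (flipCoeff_ne_zero b c)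

lemma key_nonneg (a : Idx n) : 0 ≤ key a := by
  have := key_cases a
  omega

/-- Induction on the total number of the triple; all orderings of a sorted triple are reached by
neighbouring swaps, which preserve that total. -/
lemma braidDefect_e3 (a b c : Idx n) : braidDefect n (e3 a b c) = 0 := by
  suffices h : ∀ (N : ℕ) (a b c : Idx n), key a + key b + key c < N →
      braidDefect n (e3 a b c) = 0 by
    have h1 := key_nonneg a
    have h2 := key_nonneg b
    have h3 := key_nonneg c
    exact h (key a + key b + key c + 1).toNat a b c (by omega)
  intro N
  induction N with
  | zero =>
    intro a b c h
    have h1 := key_nonneg a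
    have h2 := key_nonneg b
    have h3 := key_nonneg c
    omega
  | succ N ih =>
    have main : ∀ a b c : Idx n, key a + key b + key c < (N + 1 : ℕ) → key a ≤ key b →
        key b ≤ key c → braidDefect n (e3 a b c) = 0 ∧ braidDefect n (e3 b a c) = 0 ∧
        braidDefect n (e3 a c b) = 0 ∧ braidDefect n (e3 b c a) = 0 ∧
        braidDefect n (e3 c a b) = 0 ∧ braidDefect n (e3 c b a) = 0 := by
      intro a b c hN hab hbc
      have ih' : ∀ x y w : Idx n, key x + key y + key w < key a + key b + key c →
          braidDefect n (e3 x y w) = 0 := fun x y w h => ih x y w (by omega)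
      have h1 := braidDefect_of_sorted hab hbc
      have h2 := braidDefect_swap₁ ih' h1 hab
      have h3 := braidDefect_swap₂ ih' h1 hbc
      have h4 := braidDefect_swap₂ (fun x y w h => ih' x y w (by omega)) h2 (hab.trans hbc)
      have h5 := braidDefect_swap₁ (fun x y w h => ih' x y w (by omega)) h3 (hab.trans hbc)
      have h6 := braidDefect_swap₁ (fun x y w h => ih' x y w (by omega)) h4 hbc
      exact ⟨h1, h2, h3, h4, h5, h6⟩
    intro a b c hN
    rcases le_total (key a) (key b) with h1 | h1 <;> rcases le_total (key b) (key c) with h2 | h2 <;>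
      rcases le_total (key a) (key c) with h3 | h3
    · exact (main a b c (by omega) h1 h2).1
    · exact (main a b c (by omega) h1 h2).1
    · exact (main a c b (by omega) h3 h2).2.2.1
    · exact (main c a b (by omega) h3 h1).2.2.2.1
    · exact (main b a c (by omega) h1 h3).2.1
    · exact (main b c a (by omega) h2 h3).2.2.2.2.1
    · exact (main c b a (by omega) h2 h1).2.2.2.2.2
    · exact (main c b a (by omega) h2 h1).2.2.2.2.2

lemma braid₁_apply (f : V3 n) (x y w : Idx n) :
    braid₁ n f x y w = ∑ u, ∑ v, braid x y u v * f u v w := rfl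

lemma braid₂_apply (f : V3 n) (x y w : Idx n) :
    braid₂ n f x y w = ∑ u, ∑ v, braid y w u v * f x u v := rfl

/-- The braid relation, in coordinates. -/
lemma braid_relation (x y w a b c : Idx n) :
    ∑ v, ∑ u, ∑ l, braid x y u v * braid v w l c * braid u l a b =
      ∑ u, ∑ v, ∑ l, braid y w u v * braid x u a l * braid l v b c := by
  have h := sub_eq_zero.mp ((braidDefect_apply (e3 a b c)).symm.trans (braidDefect_e3 a b c))
  have h1 : ∀ x y w : Idx n, braid₁ n (e3 a b c) x y w = if w = c then braid x y a b else 0 := by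
    intro x y w
    rw [e3, braid₁_tensRight]
    change (if w = c then braidMap n (e2 a b) x y else 0) = _
    rw [braidMap_e2_apply]
  have h2 : ∀ x y w : Idx n, braid₂ n (e3 a b c) x y w = if x = a then braid y w b c else 0 := by
    intro x y w
    rw [← tensLeft_e2, braid₂_tensLeft]
    change (if x = a then braidMap n (e2 b c) y w else 0) = _
    rw [braidMap_e2_apply]
  have h3 := congrFun (congrFun (congrFun h x) y) w
  rw [braid₁_apply, braid₂_apply] at h3
  simp only [braid₂_apply (n := n) (braid₁ n _), braid₁_apply (n := n) (braid₂ n _), h1, h2] at h3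
  simp only [mul_ite, mul_zero, Finset.sum_ite_eq', Finset.mem_univ, if_true, Finset.sum_ite_irrel,
    Finset.sum_const_zero, Finset.mul_sum, ← mul_assoc] at h3
  rw [Finset.sum_comm, h3]

/-- S is an even element. This congruence is what makes the sign comparisons below work modulo 2. -/
lemma S_even {a b c d : Idx n} (h : S n a b c d ≠ 0) :
    (par a + par b + par c + par d : ZMod 2) = 0 := by
  rw [S_apply] at h
  have h2 : ∀ x : ZMod 2, x + x = 0 := by decide
  by_cases h3 : a = b ∧ c = d
  · rw [h3.1, h3.2, add_assoc, h2, h2, zero_add]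
  by_cases h4 : c = b ∧ d = a ∧ key c < key d
  · rw [h4.1, h4.2.1]
    linear_combination h2 (par a) + h2 (par b)
  by_cases h5 : a = -c ∧ b = -d ∧ |c.1| < |d.1|
  · rw [h5.1, h5.2.1, par_neg_zmod, par_neg_zmod]
    linear_combination h2 1 + h2 (par c) + h2 (par d)
  · rw [if_neg h3, if_neg h4, if_neg h5] at h
    simp at h

lemma neg_one_pow_congr {a b : ℕ} (h : (a : ZMod 2) = b) : (-1 : Cq) ^ a = (-1) ^ b := by
  rw [ZMod.natCast_eq_natCast_iff] at h
  rw [neg_one_pow_eq_pow_mod_two, h, ← neg_one_pow_eq_pow_mod_two]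

/-- The sign relating the two forms depends only on the outer indices, not on the summation indices
j, l, u. The right-hand terms produce the same sign, so it factors out of both sums. -/
lemma S_yangBaxter_left_term (i b k d x y j l u : Idx n) :
    (-1 : Cq) ^ ((par k + par l) * (par i + par b)) * S n j b l d * (S n x u i j * S n u y k l) =
      (-1 : Cq) ^ (par b * par k + par y * par i + par k * par y) *
        (braid x i j u * braid u k l y * braid j l d b) := by
  simp only [braid]
  by_cases hS' : S n u y k l = 0
  · simp [hS']
  have h4 : (-1 : Cq) ^ ((par k + par l) * (par i + par b)) =
      (-1 : Cq) ^ (par b * par k + par y * par i + par k * par y) *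
        ((-1) ^ (par i * par u) * (-1) ^ (par k * par y) * (-1) ^ (par l * par b)) := by
    rw [← pow_add, ← pow_add, ← pow_add]
    apply neg_one_pow_congr
    push_cast
    linear_combination (par i : ZMod 2) * S_even hS' -
      (par i * (par y + par u) + par k * par y) * CharTwo.two_eq_zero (R := ZMod 2)
  rw [h4]
  ring

lemma S_yangBaxter_right_term (i b k d x y j l u : Idx n) :
    (-1 : Cq) ^ ((par k + par l) * (par j + par b)) * S n i j k l * (S n x u l d * S n u y j b) =
      (-1 : Cq) ^ (par b * par k + par y * par i + par k * par y) *
        (braid i k l j * braid x l d u * braid u j b y) := by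
  simp only [braid]
  by_cases hS : S n i j k l = 0
  · simp [hS]
  by_cases hS' : S n u y j b = 0
  · simp [hS']
  have h4 : (-1 : Cq) ^ ((par k + par l) * (par j + par b)) =
      (-1 : Cq) ^ (par b * par k + par y * par i + par k * par y) *
        ((-1) ^ (par k * par j) * (-1) ^ (par l * par u) * (-1) ^ (par j * par y)) := by
    rw [← pow_add, ← pow_add, ← pow_add]
    apply neg_one_pow_congr
    push_cast
    linear_combination (par l : ZMod 2) * S_even hS' - par y * S_even hS -
      (par l * par u) * CharTwo.two_eq_zero (R := ZMod 2)
  rw [h4]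
  ring

/-- The super Yang–Baxter equation for `S`, in coordinates. -/
lemma S_yangBaxter (i b k d x y : Idx n) :
    ∑ j, ∑ l, (-1 : Cq) ^ ((par k + par l) * (par i + par b)) * S n j b l d *
        (∑ u, S n x u i j * S n u y k l) =
      ∑ j, ∑ l, (-1 : Cq) ^ ((par k + par l) * (par j + par b)) * S n i j k l *
        (∑ u, S n x u l d * S n u y j b) := by
  have h := braid_relation x i k d b y
  simp only [Finset.mul_sum, S_yangBaxter_left_term, S_yangBaxter_right_term]
  simp only [← Finset.mul_sum]
  refine congrArg (HMul.hMul _) ?_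
  rw [Finset.sum_comm (f := fun j l => ∑ u, braid i k l j * braid x l d u * braid u j b y), ← h,
    Finset.sum_comm (f := fun v u => ∑ l, braid x i u v * braid v k l y * braid u l d b)]
  exact Finset.sum_congr rfl fun _ _ => Finset.sum_comm

end SuperYangBaxter

end QuantumP
end

noncomputable section
namespace QuantumP

/-! ### The defining relations in coordinates and the parity automorphism. -/

section Relations

variable {n : ℕ}

lemma parityAut_T (i j : Idx n) : parityAut n (T i j) = (-1 : Cq) ^ (par i + par j) • T i j := by
  rw [T]
  split_ifs
  · rw [parityAut, FreeAlgebra.lift_ι_apply]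
  · rw [map_zero, smul_zero]

lemma parityAut_pow_T (m : ℕ) (i j : Idx n) :
    (parityAut n ^ m) (T i j) = (-1 : Cq) ^ ((par i + par j) * m) • T i j := by
  induction m with
  | zero => simp
  | succ m ih =>
    rw [pow_succ', AlgHom.mul_apply, ih, map_smul, parityAut_T, smul_smul, ← pow_add, mul_add,
      mul_one]

lemma superMul_T12_T13 (i b k d : Idx n) :
    superMul (T12 n) (T13 n) i b k d =
      (-1 : Cq) ^ ((par i + par b) * (par k + par d)) • (T i b * T k d) := by
  rw [superMul, Finset.sum_eq_single b, Finset.sum_eq_single k]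
  · rw [T12, T13, if_pos rfl, if_pos rfl, parityAut_pow_T, mul_smul_comm, smul_smul, ← pow_add]
    congr 1
    apply neg_one_pow_congr
    push_cast
    linear_combination (2 * (par k : ZMod 2) * par b + (par k + par d) * par k) *
      CharTwo.two_eq_zero (R := ZMod 2)
  · intro l _ hl
    rw [T12, if_neg hl.symm, zero_mul, smul_zero]
  · simp
  · intro j _ hj
    refine Finset.sum_eq_zero fun l _ => ?_
    rw [T13, if_neg hj, map_zero, mul_zero, smul_zero]
  · simp

lemma superMul_T13_T12 (i b k d : Idx n) :
    superMul (T13 n) (T12 n) i b k d = T k d * T i b := by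
  rw [superMul, Finset.sum_eq_single i, Finset.sum_eq_single d]
  · rw [T12, T13, if_pos rfl, if_pos rfl, parityAut_pow_T, mul_smul_comm, smul_smul, ← pow_add]
    rw [neg_one_pow_congr (b := 0), pow_zero, one_smul]
    push_cast
    linear_combination ((par k + par d) * (par i + par b) + (par i + par b) * par i : ZMod 2) *
      CharTwo.two_eq_zero (R := ZMod 2)
  · intro l _ hl
    rw [T12, if_neg hl, map_zero, mul_zero, smul_zero]
  · simp
  · intro j _ hj
    refine Finset.sum_eq_zero fun l _ => ?_
    rw [T13, if_neg hj.symm, zero_mul, smul_zero]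
  · simp

lemma superMul_left (i b k d : Idx n) :
    superMul (superMul (T12 n) (T13 n)) (S23 n) i b k d =
      ∑ j, ∑ l, ((-1 : Cq) ^ ((par k + par l) * (par i + par b)) * S n j b l d) •
        (T i j * T k l) := by
  rw [superMul]
  refine Finset.sum_congr rfl fun j _ => Finset.sum_congr rfl fun l _ => ?_
  rw [superMul_T12_T13, S23, AlgHom.commutes, ← Algebra.commutes, ← Algebra.smul_def, smul_smul,
    smul_smul, mul_right_comm, ← pow_add]
  congr 2
  apply neg_one_pow_congr
  push_cast
  linear_combination (par k + par l : ZMod 2) * par j * CharTwo.two_eq_zero (R := ZMod 2)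

lemma superMul_right (i b k d : Idx n) :
    superMul (S23 n) (superMul (T13 n) (T12 n)) i b k d =
      ∑ j, ∑ l, ((-1 : Cq) ^ ((par k + par l) * (par j + par b)) * S n i j k l) •
        (T l d * T j b) := by
  rw [superMul]
  refine Finset.sum_congr rfl fun j _ => Finset.sum_congr rfl fun l _ => ?_
  rw [superMul_T13_T12, S23, ← Algebra.smul_def, smul_smul]
  by_cases hS : S n i j k l = 0
  · rw [hS, mul_zero, zero_smul, zero_smul]
  · rw [map_mul, parityAut_pow_T, parityAut_pow_T]
    have h : ∀ x : ℕ, (-1 : Cq) ^ (x * (par i + par j + par k + par l)) = 1 := by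
      intro x
      rw [neg_one_pow_congr (b := 0), pow_zero]
      push_cast
      rw [S_even hS, mul_zero]
    rw [h, h, one_smul, one_smul]

/-- A family of elements satisfying the defining relations of `U_q p_n`. -/
structure IsRTT {B : Type*} [Ring B] [Algebra Cq B] (τ : Idx n → Idx n → B) (τinv : Idx n → B) :
    Prop where
  diag : ∀ i, τ i i = τ (-i) (-i)
  anti : ∀ i, 0 < i.1 → τ (-i) i = 0
  tri : ∀ i j : Idx n, |j.1| < |i.1| → τ i j = 0
  mul_inv : ∀ i, τ i i * τinv i = 1
  inv_mul : ∀ i, τinv i * τ i i = 1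
  rtt : ∀ i b k d,
    ∑ j, ∑ l, ((-1 : Cq) ^ ((par k + par l) * (par i + par b)) * S n j b l d) • (τ i j * τ k l) =
      ∑ j, ∑ l, ((-1 : Cq) ^ ((par k + par l) * (par j + par b)) * S n i j k l) • (τ l d * τ j b)

lemma isRTT_t : IsRTT (t (n := n)) tinv where
  diag i := RingQuot.mkAlgHom_rel Cq (Rel.diag i)
  anti i hi := (RingQuot.mkAlgHom_rel Cq (Rel.anti i hi)).trans (map_zero _)
  tri i j hij := (RingQuot.mkAlgHom_rel Cq (Rel.tri i j hij)).trans (map_zero _)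
  mul_inv i := (tdiag i).mul_inv
  inv_mul i := (tdiag i).inv_mul
  rtt i b k d := by
    have h := RingQuot.mkAlgHom_rel Cq (Rel.rtt i b k d)
    have hT : ∀ i j : Idx n, RingQuot.mkAlgHom Cq (Rel n) (T i j) = t i j := by
      intro i j
      rw [T]
      split_ifs with hij
      · rfl
      · rw [map_zero]
        exact ((RingQuot.mkAlgHom_rel Cq (Rel.tri i j (not_le.mp hij))).trans (map_zero _)).symm
    rw [superMul_left, superMul_right] at h
    simpa only [map_sum, map_smul, map_mul, hT] using h

/-- The homomorphism from `U_q p_n` defined by a family satisfying the defining relations. -/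
def IsRTT.lift {B : Type} [Ring B] [Algebra Cq B] {τ : Idx n → Idx n → B} {τinv : Idx n → B}
    (h : IsRTT τ τinv) : Uqp n →ₐ[Cq] B :=
  RingQuot.liftAlgHom Cq ⟨FreeAlgebra.lift Cq fun g => match g with
    | Gen.t i j => τ i j
    | Gen.tinv i => τinv i, by
      intro x y hxy
      have hT : ∀ i j : Idx n, FreeAlgebra.lift Cq (fun g : Gen n => match g with
          | Gen.t i j => τ i j
          | Gen.tinv i => τinv i) (T i j) = τ i j := by
        intro i j
        rw [T]
        split_ifs with hij
        · rw [FreeAlgebra.lift_ι_apply]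
        · rw [map_zero, h.tri i j (not_le.mp hij)]
      cases hxy with
      | diag i =>
        rw [FreeAlgebra.lift_ι_apply, FreeAlgebra.lift_ι_apply]
        exact h.diag i
      | anti i hi =>
        rw [FreeAlgebra.lift_ι_apply, map_zero]
        exact h.anti i hi
      | tri i j hij =>
        rw [FreeAlgebra.lift_ι_apply, map_zero]
        exact h.tri i j hij
      | mul_inv i =>
        rw [map_mul, FreeAlgebra.lift_ι_apply, FreeAlgebra.lift_ι_apply, map_one]
        exact h.mul_inv i
      | inv_mul i =>
        rw [map_mul, FreeAlgebra.lift_ι_apply, FreeAlgebra.lift_ι_apply, map_one]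
        exact h.inv_mul i
      | rtt i b k d =>
        rw [superMul_left, superMul_right]
        simpa only [map_sum, map_smul, map_mul, hT] using h.rtt i b k d⟩

lemma IsRTT.lift_t {B : Type} [Ring B] [Algebra Cq B] {τ : Idx n → Idx n → B} {τinv : Idx n → B}
    (h : IsRTT τ τinv) (i j : Idx n) : h.lift (t i j) = τ i j := by
  rw [IsRTT.lift, t, RingQuot.liftAlgHom_mkAlgHom_apply, FreeAlgebra.lift_ι_apply]

lemma IsRTT.lift_tinv {B : Type} [Ring B] [Algebra Cq B] {τ : Idx n → Idx n → B}
    {τinv : Idx n → B} (h : IsRTT τ τinv) (i : Idx n) : h.lift (tinv i) = τinv i := by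
  rw [IsRTT.lift, tinv, RingQuot.liftAlgHom_mkAlgHom_apply, FreeAlgebra.lift_ι_apply]

lemma Uqp_hom_ext {B : Type} [Ring B] [Algebra Cq B] {f g : Uqp n →ₐ[Cq] B}
    (h : ∀ i j, f (t i j) = g (t i j)) (h' : ∀ i, f (tinv i) = g (tinv i)) : f = g := by
  apply RingQuot.ringQuot_ext'
  apply FreeAlgebra.hom_ext
  funext x
  cases x with
  | t i j => exact h i j
  | tinv i => exact h' i

/-- Since S is even, all terms of the relation labelled i, b, k, d have parity p(i) + p(b) + p(k) +
p(d), so the relation is merely multiplied by a sign. -/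
lemma isRTT_parity : IsRTT (fun i j : Idx n => (-1 : Cq) ^ (par i + par j) • t i j) tinv where
  diag i := by
    rw [isRTT_t.diag i, ← two_mul, ← two_mul, pow_mul, pow_mul]
    simp
  anti i hi := by rw [isRTT_t.anti i hi, smul_zero]
  tri i j hij := by rw [isRTT_t.tri i j hij, smul_zero]
  mul_inv i := by
    rw [← two_mul, pow_mul]
    simpa using isRTT_t.mul_inv i
  inv_mul i := by
    rw [← two_mul, pow_mul]
    simpa using isRTT_t.inv_mul i
  rtt i b k d := by
    have h := congrArg (fun x => (-1 : Cq) ^ (par i + par b + par k + par d) • x)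
      (isRTT_t.rtt i b k d)
    simp only [Finset.smul_sum] at h
    have h1 : ∀ {a c e f : Idx n}, S n a c e f ≠ 0 → ∀ u v w y : ℕ,
        (u + v + w + y : ZMod 2) = par a + par c + par e + par f → ∀ m : ℕ,
        (-1 : Cq) ^ (par i + par b + par k + par d) * ((-1) ^ m * S n a c e f) =
          (-1) ^ m * S n a c e f * (-1) ^ (par i + par b + par k + par d + (u + v + w + y)) := by
      intro a c e f hS u v w y huv m
      rw [neg_one_pow_congr (a := par i + par b + par k + par d + (u + v + w + y))
        (b := par i + par b + par k + par d)]
      · ring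
      · push_cast
        rw [huv, S_even hS, add_zero]
    refine Eq.trans (Finset.sum_congr rfl fun j _ => Finset.sum_congr rfl fun l _ => ?_)
      (h.trans (Finset.sum_congr rfl fun j _ => Finset.sum_congr rfl fun l _ => ?_))
    · rw [smul_mul_smul_comm, ← pow_add, smul_smul, smul_smul]
      by_cases hS : S n j b l d = 0
      · simp [hS]
      rw [h1 hS (par j) (par b) (par l) (par d) rfl]
      congr 2
      apply neg_one_pow_congr
      push_cast
      linear_combination -(par b + par d : ZMod 2) * CharTwo.two_eq_zero (R := ZMod 2)
    · rw [smul_mul_smul_comm, ← pow_add, smul_smul, smul_smul]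
      by_cases hS : S n i j k l = 0
      · simp [hS]
      rw [h1 hS (par i) (par j) (par k) (par l) rfl]
      congr 2
      apply neg_one_pow_congr
      push_cast
      linear_combination (par i + par k : ZMod 2) * CharTwo.two_eq_zero (R := ZMod 2)

/-- The parity automorphism of `U_q p_n`. -/
def sigma (n : ℕ) : Uqp n →ₐ[Cq] Uqp n := isRTT_parity.lift

lemma sigma_t (i j : Idx n) : sigma n (t i j) = (-1 : Cq) ^ (par i + par j) • t i j :=
  isRTT_parity.lift_t i j

lemma sigma_tinv (i : Idx n) : sigma n (tinv i) = tinv i := isRTT_parity.lift_tinv i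

lemma sigma_sigma (x : Uqp n) : sigma n (sigma n x) = x := by
  have h : (sigma n).comp (sigma n) = AlgHom.id Cq _ := by
    apply Uqp_hom_ext
    · intro i j
      rw [AlgHom.comp_apply, sigma_t, map_smul, sigma_t, smul_smul, ← mul_pow]
      simp
    · intro i
      rw [AlgHom.comp_apply, sigma_tinv, sigma_tinv]
      rfl
  exact congrArg (fun f => f x) h

end Relations

end QuantumP
end

noncomputable section
namespace QuantumP

/-! ### The coproduct with one factor in the vector representation. -/

section Comultiplication

variable {n : ℕ}

lemma S_eq_zero_of_abs_gt (c b : Idx n) {i j : Idx n} (h : |j.1| < |i.1|) : S n c b i j = 0 := by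
  have h1 := key_lt_of_abs_lt h
  have h2 : i ≠ j := by
    rintro rfl
    exact h.false
  rw [S_apply, if_neg (fun hh => h2 hh.2), if_neg (fun hh => h1.not_gt hh.2.2),
    if_neg (fun hh => h.not_gt hh.2.2), add_zero, add_zero]

lemma S_eq_zero_of_opposite (c b : Idx n) {i : Idx n} (h : 0 < i.1) : S n c b (-i) i = 0 := by
  have h1 : ¬ key (-i) < key i := by
    have h1 := key_cases i
    have h2 := key_cases (-i)
    rw [neg_val] at h2
    omega
  rw [S_apply, if_neg (fun hh => neg_ne_self i hh.2), if_neg (fun hh => h1 hh.2.2),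
    if_neg (fun hh => by simp at hh), add_zero, add_zero]

lemma S_diag (c b i : Idx n) : S n c b i i = if c = b then diagCoeff c i else 0 := by
  rw [S_apply]
  simp

lemma diagCoeff_neg (c i : Idx n) : diagCoeff c (-i) = diagCoeff c i := by
  rw [diagCoeff, diagCoeff, neg_val, abs_neg]

lemma diagCoeff_ne_zero (c i : Idx n) : diagCoeff c i ≠ 0 := by
  have hq := q_ne_zero
  rw [diagCoeff]
  split_ifs <;> simp [hq]

lemma sum_comm_two {ι M : Type*} [Fintype ι] [AddCommMonoid M] (f : ι → ι → ι → ι → M) :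
    ∑ j, ∑ l, ∑ a, ∑ a', f j l a a' = ∑ a, ∑ a', ∑ j, ∑ l, f j l a a' := by
  have h := Finset.sum_comm (s := (Finset.univ : Finset (ι × ι)))
    (t := (Finset.univ : Finset (ι × ι))) (f := fun p r => f p.1 p.2 r.1 r.2)
  simpa only [Fintype.sum_prod_type] using h

lemma sum_sum_mul_sum {ι A : Type*} [Fintype ι] [Ring A] [Algebra Cq A] (f h : ι → ι → Cq)
    (g k : ι → A) :
    ∑ u, (∑ a, f u a • g a) * (∑ a', h u a' • k a') =
      ∑ a, ∑ a', (∑ u, f u a * h u a') • (g a * k a') := by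
  simp only [Finset.sum_mul_sum, smul_mul_smul_comm, Finset.sum_smul]
  rw [Finset.sum_comm]
  exact Finset.sum_congr rfl fun _ _ => Finset.sum_comm

lemma sum_smul_sum_mul_sum {ι A : Type*} [Fintype ι] [Ring A] [Algebra Cq A] (c : ι → ι → Cq)
    (f h : ι → ι → Cq) (g k : ι → ι → A) :
    ∑ j, ∑ l, c j l • ∑ u, (∑ a, f u a • g a j) * (∑ a', h u a' • k a' l) =
      ∑ a, ∑ a', (∑ u, f u a * h u a') • ∑ j, ∑ l, c j l • (g a j * k a' l) := by
  have h1 : ∀ j l, c j l • ∑ u, (∑ a, f u a • g a j) * (∑ a', h u a' • k a' l) =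
      ∑ a, ∑ a', (∑ u, f u a * h u a') • c j l • (g a j * k a' l) := by
    intro j l
    rw [sum_sum_mul_sum f h (fun a => g a j) fun a => k a l]
    simp only [Finset.smul_sum, smul_comm (c j l)]
  simp only [h1]
  rw [sum_comm_two]
  simp only [Finset.smul_sum]

lemma involution_pow_congr {B : Type*} [Monoid B] {s : B} (hs : s * s = 1) {a b : ℕ} (h : (a : ZMod 2) = b) : s ^ a = s ^ b := by
  have h1 : ∀ m, s ^ m = s ^ (m % 2) := by
    intro m
    conv_lhs => rw [← Nat.div_add_mod m 2, pow_add, pow_mul, pow_two, hs, one_pow, one_mul]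
  rw [ZMod.natCast_eq_natCast_iff] at h
  rw [h1 a, h1 b, h]

section

variable {B : Type*} [Ring B] [Algebra Cq B] {τ : Idx n → Idx n → B} {τinv : Idx n → B} {s : B}

lemma pow_mul_of_skew {x : B} {m : ℕ} (h : s * x = (-1 : Cq) ^ m • (x * s)) (k : ℕ) :
    s ^ k * x = (-1 : Cq) ^ (k * m) • (x * s ^ k) := by
  induction k with
  | zero => simp
  | succ k ih =>
    rw [pow_succ', mul_assoc, ih, mul_smul_comm, ← mul_assoc, h, smul_mul_assoc, smul_smul,
      mul_assoc, ← pow_succ', ← pow_add]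
    congr 2
    ring

/-- The matrix with entries in `B` representing the coproduct of `t_{ij}`, where the right tensor
factor acts on the vector representation. -/
def comulMatrix (τ : Idx n → Idx n → B) (s : B) (i j : Idx n) : Matrix (Idx n) (Idx n) B :=
  Matrix.of fun c b => ∑ a, S n c b i a • (τ a j * s ^ (par a + par i))

lemma comulMatrix_apply (i j c b : Idx n) :
    comulMatrix τ s i j c b = ∑ a, S n c b i a • (τ a j * s ^ (par a + par i)) := rfl

/-- Triangularity of S kills the summands with |a| < |i|, that of τ those with |a| > |i|, and a = -i
vanishes for one of the two. The result is diagonal with invertible coefficients, which supplies the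
inverse of the image of t_{ii}. -/
lemma comulMatrix_diag (h : IsRTT τ τinv) (hs : s * s = 1) (i : Idx n) :
    comulMatrix τ s i i = Matrix.diagonal fun c => diagCoeff c i • τ i i := by
  ext c b
  rw [comulMatrix_apply, Finset.sum_eq_single i]
  · rw [S_diag, involution_pow_congr hs (b := 0), pow_zero, mul_one, Matrix.diagonal_apply, ite_smul,
      zero_smul]
    push_cast
    exact CharTwo.add_self_eq_zero _
  · intro a _ ha
    rcases lt_trichotomy |a.1| |i.1| with h1 | h1 | h1
    · rw [S_eq_zero_of_abs_gt c b h1, zero_smul]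
    · obtain rfl : a = -i := (abs_eq_abs_iff.mp h1).resolve_left ha
      rcases pos_or_neg i with h2 | h2
      · rw [h.anti i h2, zero_mul, smul_zero]
      · have h3 := S_eq_zero_of_opposite c b (i := -i) (by simpa using h2)
        rw [neg_neg] at h3
        rw [h3, zero_smul]
    · rw [h.tri a i h1, zero_mul, smul_zero]
  · simp

/-- The element s implements the Koszul sign of the super tensor product inside an ordinary matrix
algebra. Moving its powers to the right leaves the relation for τ, up to scalars. -/
lemma comul_rtt_left_inner (h : IsRTT τ τinv)
    (hst : ∀ i j, s * τ i j = (-1 : Cq) ^ (par i + par j) • (τ i j * s)) (i b k d a a' : Idx n) :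
    ∑ j, ∑ l, ((-1 : Cq) ^ ((par k + par l) * (par i + par b)) * S n j b l d) •
        ((τ a j * s ^ (par a + par i)) * (τ a' l * s ^ (par a' + par k))) =
      ∑ j, ∑ l, ((-1 : Cq) ^ ((par k + par a') * (par i + par b) +
          (par a' + par l) * (par j + par b)) * S n a j a' l) •
        (τ l d * τ j b * s ^ (par a + par a' + par i + par k)) := by
  have h1 := congrArg (fun x => (-1 : Cq) ^ ((par k + par a') * (par i + par b)) •
    (x * s ^ (par a + par a' + par i + par k))) (h.rtt a b a' d)
  simp only [Finset.sum_mul, Finset.smul_sum] at h1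
  refine Eq.trans (Finset.sum_congr rfl fun j _ => Finset.sum_congr rfl fun l _ => ?_)
      (h1.trans (Finset.sum_congr rfl fun j _ => Finset.sum_congr rfl fun l _ => ?_))
  · have h2 : (τ a j * s ^ (par a + par i)) * (τ a' l * s ^ (par a' + par k)) =
        (-1 : Cq) ^ ((par a + par i) * (par a' + par l)) •
          (τ a j * τ a' l * s ^ (par a + par a' + par i + par k)) := by
      rw [mul_assoc, ← mul_assoc (s ^ _), pow_mul_of_skew (hst a' l), smul_mul_assoc,
        mul_smul_comm, mul_assoc (τ a' l), ← pow_add, ← mul_assoc]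
      congr 3
      ring
    rw [h2, smul_mul_assoc, smul_smul, smul_smul, mul_right_comm, ← mul_assoc, ← pow_add, ← pow_add]
    congr 2
    apply neg_one_pow_congr
    push_cast
    linear_combination (par i * par l - par a' * par b : ZMod 2) *
      CharTwo.two_eq_zero (R := ZMod 2)
  · rw [smul_mul_assoc, smul_smul, ← mul_assoc, ← pow_add]

/-- Left-hand side of the RTT relation for `comulMatrix`. -/
lemma comul_rtt_left (h : IsRTT τ τinv) (hs : s * s = 1)
    (hst : ∀ i j, s * τ i j = (-1 : Cq) ^ (par i + par j) • (τ i j * s)) (i b k d x y : Idx n) :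
    ∑ j, ∑ l, ((-1 : Cq) ^ ((par k + par l) * (par i + par b)) * S n j b l d) •
        (comulMatrix τ s i j * comulMatrix τ s k l) x y =
      ∑ j, ∑ l, ((-1 : Cq) ^ ((par k + par l) * (par j + par b)) *
        ∑ a, ∑ a', (-1 : Cq) ^ ((par k + par a') * (par i + par j)) * S n a j a' l *
          ∑ u, S n x u i a * S n u y k a') •
        (τ l d * τ j b * s ^ (par j + par l + par i + par k)) := by
  simp only [Matrix.mul_apply, comulMatrix_apply]
  rw [sum_smul_sum_mul_sum (fun j l => (-1 : Cq) ^ ((par k + par l) * (par i + par b)) * S n j b l d)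
    (fun u a => S n x u i a) (fun u a => S n u y k a)
    (fun a j => τ a j * s ^ (par a + par i)) (fun a j => τ a j * s ^ (par a + par k))]
  simp only [comul_rtt_left_inner h hst]
  simp only [Finset.smul_sum]
  rw [sum_comm_two]
  refine Finset.sum_congr rfl fun j _ => Finset.sum_congr rfl fun l _ => ?_
  simp only [Finset.mul_sum, Finset.sum_smul]
  refine Finset.sum_congr rfl fun a _ => Finset.sum_congr rfl fun a' _ => ?_
  by_cases hS : S n a j a' l = 0
  · simp [hS]
  have h1 : s ^ (par a + par a' + par i + par k) = s ^ (par j + par l + par i + par k) := by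
    apply involution_pow_congr hs
    push_cast
    linear_combination S_even hS - (par j + par l : ZMod 2) * CharTwo.two_eq_zero (R := ZMod 2)
  have h2 : (-1 : Cq) ^ ((par k + par a') * (par i + par b) +
      (par a' + par l) * (par j + par b)) = (-1) ^ ((par k + par l) * (par j + par b)) *
      (-1) ^ ((par k + par a') * (par i + par j)) := by
    rw [← pow_add]
    apply neg_one_pow_congr
    push_cast
    linear_combination ((par k + par a') * par b - (par k + par a') * par j - par k * par b +
      par a' * par j : ZMod 2) * CharTwo.two_eq_zero (R := ZMod 2)
  rw [h1, h2, ← Finset.sum_smul, ← Finset.sum_smul, smul_smul]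
  refine congrArg (fun r : Cq => r • (τ l d * τ j b * s ^ (par j + par l + par i + par k))) ?_
  rw [Finset.sum_mul]
  refine Finset.sum_congr rfl fun u _ => ?_
  ring

/-- Right-hand side of the RTT relation for `comulMatrix`. -/
lemma comul_rtt_right (hs : s * s = 1)
    (hst : ∀ i j, s * τ i j = (-1 : Cq) ^ (par i + par j) • (τ i j * s)) (i b k d x y : Idx n) :
    ∑ a, ∑ a', ((-1 : Cq) ^ ((par k + par a') * (par a + par b)) * S n i a k a') •
        (comulMatrix τ s a' d * comulMatrix τ s a b) x y =
      ∑ j, ∑ l, ((-1 : Cq) ^ ((par k + par l) * (par j + par b)) *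
        ∑ a, ∑ a', (-1 : Cq) ^ ((par k + par a') * (par a + par j)) * S n i a k a' *
          ∑ u, S n x u a' l * S n u y a j) •
        (τ l d * τ j b * s ^ (par j + par l + par i + par k)) := by
  have h1 : ∀ a a' : Idx n, (comulMatrix τ s a' d * comulMatrix τ s a b) x y =
      ∑ j, ∑ l, (∑ u, S n x u a' l * S n u y a j) •
        ((τ l d * s ^ (par l + par a')) * (τ j b * s ^ (par j + par a))) := by
    intro a a'
    simp only [Matrix.mul_apply, comulMatrix_apply]
    rw [sum_sum_mul_sum (fun u l => S n x u a' l) (fun u j => S n u y a j)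
      (fun l => τ l d * s ^ (par l + par a')) (fun j => τ j b * s ^ (par j + par a)),
      Finset.sum_comm]
  simp only [h1, Finset.smul_sum]
  rw [sum_comm_two]
  refine Finset.sum_congr rfl fun j _ => Finset.sum_congr rfl fun l _ => ?_
  rw [Finset.mul_sum, Finset.sum_smul]
  refine Finset.sum_congr rfl fun a _ => ?_
  rw [Finset.mul_sum, Finset.sum_smul]
  refine Finset.sum_congr rfl fun a' _ => ?_
  by_cases hS : S n i a k a' = 0
  · simp [hS]
  have h2 : (τ l d * s ^ (par l + par a')) * (τ j b * s ^ (par j + par a)) =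
      (-1 : Cq) ^ ((par l + par a') * (par j + par b)) •
        (τ l d * τ j b * s ^ (par j + par l + par i + par k)) := by
    rw [mul_assoc, ← mul_assoc (s ^ _), pow_mul_of_skew (hst j b), smul_mul_assoc, mul_smul_comm,
      mul_assoc (τ j b), ← pow_add, ← mul_assoc]
    rw [involution_pow_congr hs (b := par j + par l + par i + par k)]
    push_cast
    linear_combination S_even hS - (par i + par k : ZMod 2) * CharTwo.two_eq_zero (R := ZMod 2)
  have h3 : (-1 : Cq) ^ ((par k + par a') * (par a + par b)) *
      (-1) ^ ((par l + par a') * (par j + par b)) = (-1) ^ ((par k + par l) * (par j + par b)) *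
      (-1) ^ ((par k + par a') * (par a + par j)) := by
    rw [← pow_add, ← pow_add]
    apply neg_one_pow_congr
    push_cast
    linear_combination (par a' * par b - par k * par j : ZMod 2) *
      CharTwo.two_eq_zero (R := ZMod 2)
  rw [h2, smul_smul, smul_smul]
  refine congrArg (· • _) ?_
  linear_combination S n i a k a' * (∑ u, S n x u a' l * S n u y a j) * h3

/-- The coproduct of the generators satisfies the defining relations. -/
theorem IsRTT.comul (h : IsRTT τ τinv) (hs : s * s = 1)
    (hst : ∀ i j, s * τ i j = (-1 : Cq) ^ (par i + par j) • (τ i j * s)) :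
    IsRTT (comulMatrix τ s) (fun i => Matrix.diagonal fun c => (diagCoeff c i)⁻¹ • τinv i) where
  diag i := by
    rw [comulMatrix_diag h hs, comulMatrix_diag h hs, ← h.diag i]
    simp only [diagCoeff_neg]
  anti i hi := by
    ext c b
    rw [comulMatrix_apply]
    refine Finset.sum_eq_zero fun a _ => ?_
    rcases lt_trichotomy |a.1| |(-i).1| with h1 | h1 | h1
    · rw [S_eq_zero_of_abs_gt c b h1, zero_smul]
    · rcases abs_eq_abs_iff.mp h1 with rfl | rfl
      · rw [h.anti i hi, zero_mul, smul_zero]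
      · rw [neg_neg, S_eq_zero_of_opposite c b hi, zero_smul]
    · rw [neg_val, abs_neg] at h1
      rw [h.tri a i h1, zero_mul, smul_zero]
  tri i j hij := by
    ext c b
    rw [comulMatrix_apply]
    refine Finset.sum_eq_zero fun a _ => ?_
    rcases lt_or_ge |a.1| |i.1| with h1 | h1
    · rw [S_eq_zero_of_abs_gt c b h1, zero_smul]
    · rw [h.tri a j (hij.trans_le h1), zero_mul, smul_zero]
  mul_inv i := by
    rw [comulMatrix_diag h hs, Matrix.diagonal_mul_diagonal, ← Matrix.diagonal_one]
    congr 1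
    funext c
    rw [smul_mul_smul_comm, mul_inv_cancel₀ (diagCoeff_ne_zero c i), h.mul_inv, one_smul]
  inv_mul i := by
    rw [comulMatrix_diag h hs, Matrix.diagonal_mul_diagonal, ← Matrix.diagonal_one]
    congr 1
    funext c
    rw [smul_mul_smul_comm, inv_mul_cancel₀ (diagCoeff_ne_zero c i), h.inv_mul, one_smul]
  rtt i b k d := by
    ext x y
    simp only [Matrix.sum_apply, Matrix.smul_apply]
    rw [comul_rtt_left h hs hst, comul_rtt_right hs hst]
    refine Finset.sum_congr rfl fun j _ => Finset.sum_congr rfl fun l _ => ?_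
    -- Both sides are now combinations of the same products of τ's and s; equality of their scalar
    -- coefficients is the Yang–Baxter equation.
    rw [S_yangBaxter]

end

/-- The coproduct of `U_q p_n`, with the second tensor factor acting on the vector
representation. -/
def comul (n : ℕ) : Uqp n →ₐ[Cq] Matrix (Idx n) (Idx n) (Module.End Cq (Uqp n)) :=
  IsRTT.lift (τ := comulMatrix (fun i j => Algebra.lmul Cq (Uqp n) (t i j)) (sigma n).toLinearMap)
    (τinv := fun i => Matrix.diagonal fun c =>
      (diagCoeff c i)⁻¹ • Algebra.lmul Cq (Uqp n) (tinv i)) <|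
  IsRTT.comul
    { diag := fun i => by rw [isRTT_t.diag i]
      anti := fun i hi => by rw [isRTT_t.anti i hi, map_zero]
      tri := fun i j hij => by rw [isRTT_t.tri i j hij, map_zero]
      mul_inv := fun i => by rw [← map_mul, isRTT_t.mul_inv i, map_one]
      inv_mul := fun i => by rw [← map_mul, isRTT_t.inv_mul i, map_one]
      rtt := fun i b k d => by
        simpa only [map_sum, map_smul, map_mul] using
          congrArg (Algebra.lmul Cq (Uqp n)) (isRTT_t.rtt i b k d) }
    (LinearMap.ext fun x => sigma_sigma x)
    (fun i j => LinearMap.ext fun x => by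
      simp only [Module.End.mul_apply, LinearMap.smul_apply, Algebra.coe_lmul_eq_mul,
        LinearMap.mul_apply', AlgHom.toLinearMap_apply, map_mul, sigma_t, smul_mul_assoc])

lemma comul_t (i j : Idx n) : comul n (t i j) =
    comulMatrix (fun i j => Algebra.lmul Cq (Uqp n) (t i j)) (sigma n).toLinearMap i j :=
  IsRTT.lift_t _ i j

end Comultiplication

end QuantumP
end

noncomputable section
namespace QuantumP

/-! ### The valuation at q = 1. -/

section Place

open Polynomial in
/-- The place `q = 1` of `ℂ(q)`. -/
def place : IsDedekindDomain.HeightOneSpectrum ℂ[X] where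
  asIdeal := Ideal.span {X - C 1}
  isPrime := (Ideal.span_singleton_prime (X_sub_C_ne_zero 1)).mpr (prime_X_sub_C 1)
  ne_bot := by simpa using X_sub_C_ne_zero (1 : ℂ)

/-- The valuation of `ℂ(q)` at `q = 1`. -/
def val : Valuation Cq (WithZero (Multiplicative ℤ)) := place.valuation Cq

open Polynomial in
lemma val_le_one (p : ℂ[X]) : val (algebraMap ℂ[X] Cq p) ≤ 1 := place.valuation_le_one p

open Polynomial in
lemma val_lt_one_iff (p : ℂ[X]) : val (algebraMap ℂ[X] Cq p) < 1 ↔ p.eval 1 = 0 := by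
  refine (place.valuation_lt_one_iff_mem p).trans ?_
  rw [place, Ideal.mem_span_singleton, dvd_iff_isRoot, IsRoot.def]

open Polynomial in
lemma val_eq_one {p : ℂ[X]} (h : p.eval 1 ≠ 0) : val (algebraMap ℂ[X] Cq p) = 1 :=
  (val_le_one p).antisymm (not_lt.mp fun h' => h ((val_lt_one_iff p).mp h'))

open Polynomial in
-- The residue field ℂ has characteristic zero, so the multiplicities of repeated letters are units.
lemma val_natCast {N : ℕ} (h : N ≠ 0) : val (N : Cq) = 1 := by
  rw [← map_natCast (algebraMap ℂ[X] Cq)]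
  exact val_eq_one (by simpa using h)

open Polynomial in
lemma val_q : val q = 1 := by
  rw [q, ← RatFunc.algebraMap_X]
  exact val_eq_one (by simp)

/-- The local parameter `q - 1`. -/
def hbar : Cq := q - 1

open Polynomial in
lemma hbar_eq : hbar = algebraMap ℂ[X] Cq (X - C 1) := by
  simp [hbar, q]

lemma hbar_ne_zero : hbar ≠ 0 := by
  rw [hbar_eq]
  exact (map_ne_zero_iff _ (RatFunc.algebraMap_injective ℂ)).mpr (Polynomial.X_sub_C_ne_zero 1)

lemma val_hbar_lt : val hbar < 1 := by
  rw [hbar_eq, val_lt_one_iff]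
  simp

open Polynomial in
-- The quotient is (q + 1)/q, with value 2 at q = 1.
lemma val_hbar_inv_mul_z : val (hbar⁻¹ * z) = 1 := by
  have h : hbar⁻¹ * z = q⁻¹ * algebraMap ℂ[X] Cq (X + C 1) := by
    have h1 := hbar_ne_zero
    have h2 := q_ne_zero
    have h3 : algebraMap ℂ[X] Cq (X + C 1) = q + 1 := by simp [q]
    rw [h3, z]
    field_simp
    rw [hbar]
    ring
  rw [h, map_mul, map_inv₀, val_q, inv_one, one_mul]
  refine val_eq_one ?_
  simp only [eval_add, eval_X, eval_C]
  norm_num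

lemma val_neg_one_pow (m : ℕ) : val ((-1) ^ m) = 1 := by
  rw [map_pow, Valuation.map_neg, map_one, one_pow]

lemma val_neg_one_pow_mul (m : ℕ) (x : Cq) : val ((-1) ^ m * x) = val x := by
  rw [map_mul, val_neg_one_pow, one_mul]

lemma val_add_le {x y : Cq} (hx : val x ≤ 1) (hy : val y ≤ 1) : val (x + y) ≤ 1 :=
  (val.map_add x y).trans (max_le hx hy)

lemma val_sum_lt {ι : Type*} (s : Finset ι) (f : ι → Cq) (h : ∀ i ∈ s, val (f i) < 1) :
    val (∑ i ∈ s, f i) < 1 := val.map_sum_lt one_ne_zero h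

lemma val_mul_le {x y : Cq} (hx : val x ≤ 1) (hy : val y ≤ 1) : val (x * y) ≤ 1 := by
  rw [map_mul]
  exact mul_le_one' hx hy

lemma val_mul_lt {x y : Cq} (hx : val x < 1) (hy : val y ≤ 1) : val (x * y) < 1 := by
  rw [map_mul]
  exact mul_lt_one_of_lt_of_le hx hy

lemma val_mul_lt' {x y : Cq} (hx : val x ≤ 1) (hy : val y < 1) : val (x * y) < 1 := by
  rw [mul_comm]
  exact val_mul_lt hy hx

end Place

/-! ### Rescaled generators, their lattice, and first-order expansion. -/

section FirstOrder

variable {n : ℕ}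

/-- The first order part of `S` at `q = 1`, with its higher order corrections. -/
def sOne (n : ℕ) (a b c d : Idx n) : Cq := hbar⁻¹ * (S n a b c d - if a = b ∧ c = d then 1 else 0)

lemma S_eq (a b c d : Idx n) :
    S n a b c d = (if a = b ∧ c = d then 1 else 0) + hbar * sOne n a b c d := by
  rw [sOne, mul_inv_cancel_left₀ hbar_ne_zero, add_sub_cancel]

lemma sOne_apply (a b c d : Idx n) :
    sOne n a b c d =
      (if a = b ∧ c = d then hbar⁻¹ * (diagCoeff a c - 1) else 0) +
      (if c = b ∧ d = a ∧ key c < key d then (-1) ^ par c * (hbar⁻¹ * z) else 0) +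
      (if a = -c ∧ b = -d ∧ |c.1| < |d.1| then
        (-1) ^ (par c + par d * (par c + 1) + 1) * (hbar⁻¹ * z) else 0) := by
  rw [sOne, S_apply, add_sub_right_comm, add_sub_right_comm, mul_add, mul_add]
  refine congrArg₂ _ (congrArg₂ _ ?_ ?_) ?_
  · split_ifs <;> simp
  · split_ifs <;> ring
  · split_ifs <;> ring

lemma val_hbar_inv_mul_diagCoeff (a c : Idx n) : val (hbar⁻¹ * (diagCoeff a c - 1)) ≤ 1 := by
  have h1 := hbar_ne_zero
  have h2 := q_ne_zero
  rw [diagCoeff]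
  split_ifs
  · rw [← hbar, inv_mul_cancel₀ h1, map_one]
  · have : hbar⁻¹ * (q⁻¹ - 1) = -q⁻¹ := by
      field_simp
      rw [hbar]
      ring
    rw [this, Valuation.map_neg, map_inv₀, val_q, inv_one]
  · simp

/-- The coefficients z, q - 1 and q⁻¹ - 1 all vanish at q = 1, so dividing by q - 1 stays integral.
-/
lemma val_sOne (a b c d : Idx n) : val (sOne n a b c d) ≤ 1 := by
  rw [sOne_apply]
  refine val_add_le (val_add_le ?_ ?_) ?_
  · split_ifs
    · exact val_hbar_inv_mul_diagCoeff a c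
    · simp
  · split_ifs
    · rw [val_neg_one_pow_mul, val_hbar_inv_mul_z]
    · simp
  · split_ifs
    · rw [val_neg_one_pow_mul, val_hbar_inv_mul_z]
    · simp

/-- The normalized generators `(t_{ij} - δ_{ij}) / (q - 1)`. -/
def y (g : Idx n × Idx n) : Uqp n := hbar⁻¹ • (t g.1 g.2 - if g.1 = g.2 then 1 else 0)

lemma t_eq (i j : Idx n) : t i j = (if i = j then 1 else 0) + hbar • y (i, j) := by
  rw [y, smul_inv_smul₀ hbar_ne_zero, add_sub_cancel]

/-- Monomials in the normalized generators. -/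
def yword (w : List (Idx n × Idx n)) : Uqp n := (w.map y).prod

lemma yword_nil : yword ([] : List (Idx n × Idx n)) = 1 := rfl

lemma yword_cons (g : Idx n × Idx n) (w : List (Idx n × Idx n)) :
    yword (g :: w) = y g * yword w := by
  rw [yword, List.map_cons, List.prod_cons, yword]

/-- The parity exponent of a generator. -/
def gpar (g : Idx n × Idx n) : ℕ := par g.1 + par g.2

/-- The parity exponent of a word. -/
def wpar (w : List (Idx n × Idx n)) : ℕ := (w.map gpar).sum

lemma sigma_y (g : Idx n × Idx n) : sigma n (y g) = (-1 : Cq) ^ gpar g • y g := by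
  rw [y, map_smul, map_sub, sigma_t, smul_comm ((-1 : Cq) ^ gpar g),
    smul_sub ((-1 : Cq) ^ gpar g)]
  refine congrArg _ (congrArg _ ?_)
  split_ifs with h
  · rw [map_one, gpar, h, ← two_mul, pow_mul]
    simp
  · rw [map_zero, smul_zero]

lemma sigma_yword (w : List (Idx n × Idx n)) :
    sigma n (yword w) = (-1 : Cq) ^ wpar w • yword w := by
  induction w with
  | nil => simp [yword_nil, wpar]
  | cons g w ih =>
    rw [yword_cons, map_mul, sigma_y, ih, smul_mul_smul_comm, ← pow_add]
    rfl

/-- The lattice spanned by the words in the normalized generators. -/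
def lattice (n : ℕ) : AddSubgroup (Uqp n) :=
  AddSubgroup.closure {x | ∃ (c : Cq) (w : List (Idx n × Idx n)), val c ≤ 1 ∧ x = c • yword w}

/-- The part of the lattice spanned by the words of length `< m` modulo the maximal ideal. -/
def filt (n m : ℕ) : AddSubgroup (Uqp n) :=
  AddSubgroup.closure {x | ∃ (c : Cq) (w : List (Idx n × Idx n)),
    (val c ≤ 1 ∧ w.length < m ∨ val c < 1) ∧ x = c • yword w}

lemma closure_map_mem {A : Type*} [AddCommGroup A] {s : Set A} {H : AddSubgroup A} (f : A →+ A)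
    (h : ∀ x ∈ s, f x ∈ H) {x : A} (hx : x ∈ AddSubgroup.closure s) : f x ∈ H :=
  (AddSubgroup.closure_le (H.comap f)).mpr h hx

lemma smul_yword_mem_lattice {c : Cq} (hc : val c ≤ 1) (w : List (Idx n × Idx n)) :
    c • yword w ∈ lattice n := AddSubgroup.subset_closure ⟨c, w, hc, rfl⟩

lemma yword_mem_lattice (w : List (Idx n × Idx n)) : yword w ∈ lattice n := by
  simpa using smul_yword_mem_lattice (c := 1) (by simp) w

lemma smul_yword_mem_filt {c : Cq} {m : ℕ} (hc : val c ≤ 1) {w : List (Idx n × Idx n)}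
    (hw : w.length < m) : c • yword w ∈ filt n m :=
  AddSubgroup.subset_closure ⟨c, w, Or.inl ⟨hc, hw⟩, rfl⟩

lemma filt_le_lattice (m : ℕ) : filt n m ≤ lattice n := by
  rw [filt, AddSubgroup.closure_le]
  rintro x ⟨c, w, hc, rfl⟩
  exact smul_yword_mem_lattice (hc.elim (fun h => h.1) fun h => h.le) w

lemma filt_mono {m m' : ℕ} (h : m ≤ m') : filt n m ≤ filt n m' := by
  apply AddSubgroup.closure_mono
  rintro x ⟨c, w, hc, rfl⟩
  exact ⟨c, w, hc.imp_left fun h' => ⟨h'.1, h'.2.trans_le h⟩, rfl⟩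

lemma smul_mem_lattice {c : Cq} (hc : val c ≤ 1) {x : Uqp n} (hx : x ∈ lattice n) :
    c • x ∈ lattice n := by
  refine closure_map_mem (DistribSMul.toAddMonoidHom (Uqp n) c) ?_ hx
  rintro _ ⟨d, w, hd, rfl⟩
  rw [DistribSMul.toAddMonoidHom_apply, smul_smul]
  exact smul_yword_mem_lattice (val_mul_le hc hd) w

lemma smul_mem_filt {m : ℕ} {c : Cq} (hc : val c ≤ 1) {x : Uqp n} (hx : x ∈ filt n m) :
    c • x ∈ filt n m := by
  refine closure_map_mem (DistribSMul.toAddMonoidHom (Uqp n) c) ?_ hx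
  rintro _ ⟨d, w, hd, rfl⟩
  rw [DistribSMul.toAddMonoidHom_apply, smul_smul]
  exact AddSubgroup.subset_closure ⟨c * d, w, hd.imp (fun h => ⟨val_mul_le hc h.1, h.2⟩)
    fun h => val_mul_lt' hc h, rfl⟩

lemma smul_mem_filt_of_lt {c : Cq} (hc : val c < 1) {x : Uqp n} (hx : x ∈ lattice n) (m : ℕ) :
    c • x ∈ filt n m := by
  refine closure_map_mem (DistribSMul.toAddMonoidHom (Uqp n) c) ?_ hx
  rintro _ ⟨d, w, hd, rfl⟩
  rw [DistribSMul.toAddMonoidHom_apply, smul_smul]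
  exact AddSubgroup.subset_closure ⟨c * d, w, Or.inr (val_mul_lt hc hd), rfl⟩

lemma y_mul_mem_lattice (g : Idx n × Idx n) {x : Uqp n} (hx : x ∈ lattice n) :
    y g * x ∈ lattice n := by
  refine closure_map_mem (AddMonoidHom.mulLeft (y g)) ?_ hx
  rintro _ ⟨d, w, hd, rfl⟩
  rw [AddMonoidHom.coe_mulLeft, mul_smul_comm, ← yword_cons]
  exact smul_yword_mem_lattice hd _

/-- At m = 0 the truncated m - 1 is harmless: both filtration steps are then the part with
coefficients in the maximal ideal, which multiplication by a letter preserves. -/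
lemma y_mul_mem_filt (g : Idx n × Idx n) {m : ℕ} {x : Uqp n} (hx : x ∈ filt n (m - 1)) :
    y g * x ∈ filt n m := by
  refine closure_map_mem (AddMonoidHom.mulLeft (y g)) ?_ hx
  rintro _ ⟨d, w, hd, rfl⟩
  rw [AddMonoidHom.coe_mulLeft, mul_smul_comm, ← yword_cons]
  refine AddSubgroup.subset_closure ⟨d, _, hd.imp_left fun h => ⟨h.1, ?_⟩, rfl⟩
  rw [List.length_cons]
  omega

lemma sigma_mem_lattice {x : Uqp n} (hx : x ∈ lattice n) : sigma n x ∈ lattice n := by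
  refine closure_map_mem (sigma n : Uqp n →+ Uqp n) ?_ hx
  rintro _ ⟨d, w, hd, rfl⟩
  rw [AddMonoidHom.coe_coe, map_smul, sigma_yword, smul_smul]
  exact smul_yword_mem_lattice (by rwa [mul_comm, val_neg_one_pow_mul]) _

lemma sigma_mem_filt {m : ℕ} {x : Uqp n} (hx : x ∈ filt n m) : sigma n x ∈ filt n m := by
  refine closure_map_mem (sigma n : Uqp n →+ Uqp n) ?_ hx
  rintro _ ⟨d, w, hd, rfl⟩
  rw [AddMonoidHom.coe_coe, map_smul, sigma_yword, smul_smul]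
  exact AddSubgroup.subset_closure ⟨_, w, by rwa [mul_comm d, val_neg_one_pow_mul], rfl⟩

lemma sigma_pow_mem {H : AddSubgroup (Uqp n)} (h : ∀ x ∈ H, sigma n x ∈ H) (m : ℕ) {x : Uqp n}
    (hx : x ∈ H) : ((sigma n).toLinearMap ^ m) x ∈ H := by
  induction m with
  | zero => simpa using hx
  | succ m ih =>
    rw [pow_succ', Module.End.mul_apply]
    exact h _ ih

lemma sigma_pow_yword (m : ℕ) (w : List (Idx n × Idx n)) :
    ((sigma n).toLinearMap ^ m) (yword w) = (-1 : Cq) ^ (m * wpar w) • yword w := by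
  induction m with
  | zero => simp
  | succ m ih =>
    rw [pow_succ', Module.End.mul_apply, ih, map_smul, AlgHom.toLinearMap_apply, sigma_yword,
      smul_smul, ← pow_add]
    congr 2
    ring

/-- The action of `comul n (y g)`, to first order. -/
lemma comul_y (g : Idx n × Idx n) (r c : Idx n) (x : Uqp n) :
    comul n (y g) r c x = (if r = c then y g * x else 0) +
      sOne n r c g.1 g.2 • ((sigma n).toLinearMap ^ gpar g) x +
      hbar • ∑ a, sOne n r c g.1 a • (y (a, g.2) * ((sigma n).toLinearMap ^ (par a + par g.1)) x)
      := by
  obtain ⟨i, j⟩ := g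
  have hs : ∀ m, ((sigma n).toLinearMap ^ (m + m)) = 1 := by
    intro m
    rw [involution_pow_congr (b := 0) (LinearMap.ext fun x => sigma_sigma x), pow_zero]
    push_cast
    exact CharTwo.add_self_eq_zero _
  -- Both factors are expanded, S as 1 + (q - 1) `sOne` and t as δ + (q - 1) y. The product of the
  -- two corrections is the only term with a further factor q - 1.
  have h1 : ∀ a, S n r c i a • (t a j * ((sigma n).toLinearMap ^ (par a + par i)) x) =
      (if a = i then if r = c then t i j * x else 0 else 0) +
      ((if a = j then hbar • sOne n r c i j • ((sigma n).toLinearMap ^ (par i + par j)) x else 0) +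
      hbar • hbar • sOne n r c i a • (y (a, j) * ((sigma n).toLinearMap ^ (par a + par i)) x)) := by
    intro a
    have h2 : (if r = c ∧ i = a then (1 : Cq) else 0) •
        (t a j * ((sigma n).toLinearMap ^ (par a + par i)) x) =
        if a = i then if r = c then t i j * x else 0 else 0 := by
      by_cases ha : a = i
      · subst ha
        rw [hs]
        by_cases hr : r = c <;> simp [hr]
      · rw [if_neg (fun h => ha h.2.symm), if_neg ha, zero_smul]
    have h3 : (hbar * sOne n r c i a) • (t a j * ((sigma n).toLinearMap ^ (par a + par i)) x) =
        (if a = j then hbar • sOne n r c i j • ((sigma n).toLinearMap ^ (par i + par j)) x else 0) +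
        hbar • hbar • sOne n r c i a •
          (y (a, j) * ((sigma n).toLinearMap ^ (par a + par i)) x) := by
      rw [t_eq a j, add_mul, smul_add]
      refine congrArg₂ _ ?_ ?_
      · by_cases ha : a = j
        · subst ha
          rw [if_pos rfl, if_pos rfl, one_mul, add_comm (par a), smul_smul]
        · rw [if_neg ha, if_neg ha, zero_mul, smul_zero]
      · rw [smul_mul_assoc, smul_smul, smul_smul, smul_smul]
        refine congrArg (fun k : Cq => k • _) ?_
        ring
    rw [S_eq, add_smul, h2, h3]
  have h4 : comul n (y (i, j)) r c x = hbar⁻¹ • (∑ a, S n r c i a •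
      (t a j * ((sigma n).toLinearMap ^ (par a + par i)) x) -
      if i = j then if r = c then x else 0 else 0) := by
    have h5 : comul n (y (i, j)) = hbar⁻¹ • (comulMatrix (fun i j => Algebra.lmul Cq (Uqp n) (t i j))
        (sigma n).toLinearMap i j - if i = j then 1 else 0) := by
      rw [y, map_smul, map_sub, comul_t]
      refine congrArg _ (congrArg _ ?_)
      split_ifs <;> simp
    rw [h5, Matrix.smul_apply, Matrix.sub_apply, comulMatrix_apply, LinearMap.smul_apply,
      LinearMap.sub_apply, LinearMap.sum_apply]
    refine congrArg _ (congrArg₂ _ rfl ?_)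
    by_cases hij : i = j
    · rw [if_pos hij, if_pos hij, Matrix.one_apply]
      split_ifs <;> rfl
    · rw [if_neg hij, if_neg hij]
      rfl
  rw [h4]
  simp only [h1, Finset.sum_add_distrib, Finset.sum_ite_eq', Finset.mem_univ, if_true]
  rw [← Finset.smul_sum, ← Finset.smul_sum, add_sub_right_comm, smul_add, smul_add,
    inv_smul_smul₀ hbar_ne_zero, inv_smul_smul₀ hbar_ne_zero, add_assoc]
  refine congrArg₂ _ ?_ rfl
  by_cases hr : r = c
  · simp only [if_pos hr, y, smul_mul_assoc, sub_mul]
    split_ifs <;> simp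
  · simp [hr]

end FirstOrder

end QuantumP
end

noncomputable section
namespace QuantumP

/-! ### Matrix coefficients of the coproduct of a word. -/

section Expansion

variable {n : ℕ}

/-- The matrix entries of the coproduct. -/
def theta (r s : Idx n) : Uqp n →ₗ[Cq] Uqp n where
  toFun u := comul n u r s 1
  map_add' u u' := by rw [map_add, Matrix.add_apply, LinearMap.add_apply]
  map_smul' c u := by rw [map_smul, Matrix.smul_apply, LinearMap.smul_apply, RingHom.id_apply]

lemma theta_one (r s : Idx n) : theta r s 1 = if r = s then 1 else 0 := by
  change comul n 1 r s 1 = _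
  have h : comul n 1 = 1 := map_one _
  rw [h, Matrix.one_apply]
  split_ifs <;> rfl

lemma theta_y_mul (g : Idx n × Idx n) (u : Uqp n) (r s : Idx n) :
    theta r s (y g * u) = y g * theta r s u +
      ∑ c, sOne n r c g.1 g.2 • ((sigma n).toLinearMap ^ gpar g) (theta c s u) +
      hbar • ∑ c, ∑ a, sOne n r c g.1 a •
        (y (a, g.2) * ((sigma n).toLinearMap ^ (par a + par g.1)) (theta c s u)) := by
  change comul n (y g * u) r s 1 = _
  have h : ∀ c, comul n u c s 1 = theta c s u := fun _ => rfl
  rw [map_mul, Matrix.mul_apply, LinearMap.sum_apply]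
  simp only [Module.End.mul_apply, h, comul_y, Finset.sum_add_distrib, Finset.smul_sum]
  simp

/-- The first order part of the coproduct of a word. -/
def deriv : List (Idx n × Idx n) → Idx n → Idx n → Uqp n
  | [], _, _ => 0
  | g :: w, r, s => y g * deriv w r s + ((-1 : Cq) ^ (gpar g * wpar w) * sOne n r s g.1 g.2) • yword w

lemma deriv_mem_filt (w : List (Idx n × Idx n)) (r s : Idx n) : deriv w r s ∈ filt n w.length := by
  induction w with
  | nil => exact zero_mem _
  | cons g w ih =>
    refine add_mem (y_mul_mem_filt g ih) (smul_yword_mem_filt ?_ ?_)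
    · rw [val_neg_one_pow_mul]
      exact val_sOne _ _ _ _
    · rw [List.length_cons]
      omega

/-- Modulo the maximal ideal each letter is primitive. Hence a coefficient of the product is the
word itself, plus `deriv`, in which one letter is replaced by a scalar, plus terms that have lost at
least two letters. -/
lemma theta_yword (w : List (Idx n × Idx n)) (r s : Idx n) :
    theta r s (yword w) - ((if r = s then yword w else 0) + deriv w r s) ∈
      filt n (w.length - 1) := by
  induction w generalizing r with
  | nil =>
    rw [yword_nil, theta_one, deriv, add_zero, sub_self]
    exact zero_mem _
  | cons g w ih =>
    rw [yword_cons, theta_y_mul, deriv]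
    have hl : ∀ c, theta c s (yword w) ∈ lattice n := by
      intro c
      have h1 := add_mem (filt_le_lattice _ (ih c)) (add_mem (S := AddSubgroup (Uqp n))
        (s := lattice n) (a := if c = s then yword w else 0) ?_
        (filt_le_lattice _ (deriv_mem_filt w c s)))
      · rwa [sub_add_cancel] at h1
      · split_ifs
        · exact yword_mem_lattice w
        · exact zero_mem _
    have h1 : hbar • ∑ c, ∑ a, sOne n r c g.1 a • (y (a, g.2) *
        ((sigma n).toLinearMap ^ (par a + par g.1)) (theta c s (yword w))) ∈ filt n w.length := by
      refine smul_mem_filt_of_lt val_hbar_lt (sum_mem fun c _ => sum_mem fun a _ =>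
        smul_mem_lattice (val_sOne _ _ _ _) (y_mul_mem_lattice _ ?_)) _
      exact sigma_pow_mem (fun x hx => sigma_mem_lattice hx) _ (hl c)
    have h2 : y g * (theta r s (yword w) - ((if r = s then yword w else 0) + deriv w r s)) ∈
        filt n w.length := y_mul_mem_filt g (ih r)
    have h3 : ∑ c, sOne n r c g.1 g.2 • ((sigma n).toLinearMap ^ gpar g)
        (theta c s (yword w) - if c = s then yword w else 0) ∈ filt n w.length := by
      refine sum_mem fun c _ => smul_mem_filt (val_sOne _ _ _ _)
        (sigma_pow_mem (fun x hx => sigma_mem_filt hx) _ ?_)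
      have h4 := add_mem (filt_mono (Nat.sub_le _ _) (ih c)) (deriv_mem_filt w c s)
      rwa [sub_add_eq_sub_sub, sub_add_cancel] at h4
    have h4 : ∑ c, sOne n r c g.1 g.2 • ((sigma n).toLinearMap ^ gpar g)
        (theta c s (yword w) - if c = s then yword w else 0) =
        (∑ c, sOne n r c g.1 g.2 • ((sigma n).toLinearMap ^ gpar g) (theta c s (yword w))) -
          ((-1 : Cq) ^ (gpar g * wpar w) * sOne n r s g.1 g.2) • yword w := by
      simp only [map_sub, smul_sub, Finset.sum_sub_distrib]
      refine congrArg _ ?_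
      rw [Finset.sum_eq_single s]
      · rw [if_pos rfl, sigma_pow_yword, smul_smul, mul_comm]
      · intro c _ hc
        rw [if_neg hc, map_zero, smul_zero]
      · simp
    rw [h4] at h3
    have h5 := add_mem (add_mem h2 h3) h1
    rw [List.length_cons, Nat.add_sub_cancel]
    convert h5 using 1
    rw [mul_sub, mul_add]
    split_ifs
    · abel
    · rw [mul_zero]
      abel

end Expansion

/-! ### Functionals detecting a single reduced word. -/

section Functionals

variable {n : ℕ}

/-- The bilinear pairing detecting the generator `k` to first order. -/
def detect (k : PBWGen n) (r s : Idx n) : Cq :=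
  if k.1.1 = k.1.2 then
    (if r = k.1.1 ∧ s = k.1.1 then 1 else 0) - (if r = -k.1.1 ∧ s = -k.1.1 then 1 else 0)
  else if r = k.1.2 ∧ s = k.1.1 then 1 else 0

lemma sum_detect (k : PBWGen n) {M : Type*} [AddCommGroup M] [Module Cq M] (f : Idx n → Idx n → M) :
    ∑ r, ∑ s, detect k r s • f r s =
      if k.1.1 = k.1.2 then f k.1.1 k.1.1 - f (-k.1.1) (-k.1.1) else f k.1.2 k.1.1 := by
  simp only [detect]
  split_ifs with h
  · simp only [sub_smul, Finset.sum_sub_distrib, ite_and, ite_smul, one_smul, zero_smul,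
      Finset.sum_ite_irrel, Finset.sum_ite_eq', Finset.mem_univ, if_true, Finset.sum_const_zero]
  · simp only [ite_and, ite_smul, one_smul, zero_smul,
      Finset.sum_ite_irrel, Finset.sum_ite_eq', Finset.mem_univ, if_true, Finset.sum_const_zero]

lemma val_detect (k : PBWGen n) (r s : Idx n) : val (detect k r s) ≤ 1 := by
  rw [detect]
  split_ifs with h <;> simp_all

lemma PBWGen.key_lt {k : PBWGen n} (h : k.1.1 ≠ k.1.2) : key k.1.1 < key k.1.2 := by
  rcases k.2 with h1 | ⟨h1, h2⟩
  · exact key_lt_of_abs_lt h1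
  · rcases abs_eq_abs_iff.mp h1 with h3 | h3
    · exact absurd h3 h
    · have h4 := key_cases k.1.1
      have h5 := key_cases k.1.2
      rw [Subtype.ext_iff, neg_val] at h3
      omega

lemma PBWGen.pos_of_diag {k : PBWGen n} (h : k.1.1 = k.1.2) : 0 < k.1.1.1 := by
  rcases k.2 with h1 | ⟨h1, h2⟩
  · rw [h] at h1
    exact absurd h1 (lt_irrefl _)
  · exact h2

lemma PBWGen.abs_le (k : PBWGen n) : |k.1.1.1| ≤ |k.1.2.1| := k.2.elim (fun h => h.le) fun h => h.1.le

/-- For off-diagonal k only the permutation part of S can reach the chosen entry; the contraction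
part would contradict |i| ≤ |j|. For diagonal k the difference of the entries at ±i sees q against
q⁻¹, hence z/(q - 1). -/
lemma sum_detect_sOne (k : PBWGen n) :
    ∃ ε : Cq, val ε = 1 ∧ ∀ g : PBWGen n,
      ∑ r, ∑ s, detect k r s • sOne n r s g.1.1 g.1.2 = if g = k then ε else 0 := by
  by_cases hk : k.1.1 = k.1.2
  · refine ⟨hbar⁻¹ * z, val_hbar_inv_mul_z, fun g => ?_⟩
    rw [sum_detect, if_pos hk]
    have hkp := PBWGen.pos_of_diag hk
    have h1 : ∀ r : Idx n, sOne n r r g.1.1 g.1.2 =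
        if g.1.1 = g.1.2 then hbar⁻¹ * (diagCoeff r g.1.1 - 1) else 0 := by
      intro r
      rw [sOne_apply, if_neg (c := g.1.1 = r ∧ _), if_neg (c := r = -g.1.1 ∧ _), add_zero, add_zero]
      · simp
      · rintro ⟨h1, h2, h3⟩
        rw [neg_injective (h1.symm.trans h2)] at h3
        exact lt_irrefl _ h3
      · rintro ⟨h1, h2, h3⟩
        rw [h1, h2] at h3
        exact lt_irrefl _ h3
    rw [h1, h1]
    by_cases hg : g.1.1 = g.1.2
    · rw [if_pos hg, if_pos hg]
      have hgp := PBWGen.pos_of_diag hg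
      have h2 : g = k ↔ |k.1.1.1| = |g.1.1.1| := by
        rw [abs_of_pos hkp, abs_of_pos hgp]
        constructor
        · rintro rfl
          rfl
        · intro h
          have h3 := Subtype.ext h
          exact Subtype.ext (Prod.ext h3.symm (by rw [← hg, ← hk, h3]))
      rw [diagCoeff, diagCoeff, neg_val, abs_neg]
      by_cases h3 : g = k
      · rw [if_pos (h2.mp h3), if_pos (h2.mp h3), if_pos hkp, if_neg (by simpa using hkp.le),
          if_pos h3, z]
        ring
      · rw [if_neg (fun h => h3 (h2.mpr h)), if_neg (fun h => h3 (h2.mpr h)), if_neg h3]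
        ring
    · rw [if_neg hg, if_neg hg, if_neg, sub_zero]
      rintro rfl
      exact hg hk
  · refine ⟨(-1) ^ par k.1.1 * (hbar⁻¹ * z), ?_, fun g => ?_⟩
    · rw [val_neg_one_pow_mul, val_hbar_inv_mul_z]
    · rw [sum_detect, if_neg hk, sOne_apply, if_neg (fun h => hk h.1.symm),
        if_neg (c := k.1.2 = -g.1.1 ∧ _), zero_add, add_zero]
      · by_cases h : g = k
        · subst h
          rw [if_pos ⟨rfl, rfl, PBWGen.key_lt hk⟩, if_pos rfl]
        · rw [if_neg (fun hh => h (Subtype.ext (Prod.ext hh.1 hh.2.1))), if_neg h]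
      · rintro ⟨h1, h2, h3⟩
        have h4 := PBWGen.abs_le k
        rw [h1, h2, neg_val, neg_val, abs_neg, abs_neg] at h4
        exact h4.not_gt h3

/-- The word underlying a list of PBW generators. -/
def letters (w : List (PBWGen n)) : List (Idx n × Idx n) := w.map Subtype.val

lemma letters_cons (g : PBWGen n) (w : List (PBWGen n)) : letters (g :: w) = g.1 :: letters w := rfl

lemma abs_cases (i : Idx n) : (0 < i.1 ∧ |i.1| = i.1) ∨ (i.1 < 0 ∧ |i.1| = -i.1) :=
  (key_cases i).imp (fun h => ⟨h.1, h.2.1⟩) fun h => ⟨h.1, h.2.1⟩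

lemma PBWGen.Prec.irrefl (g : PBWGen n) : ¬ g.Prec g := by
  have h1 := abs_cases g.1.1
  have h2 := abs_cases g.1.2
  unfold PBWGen.Prec
  omega

/-- The order is the decreasing lexicographic order on (|i|, |j|, i, j); transitivity is immediate
in this form. -/
lemma PBWGen.prec_iff {g h : PBWGen n} : g.Prec h ↔
    |h.1.1.1| < |g.1.1.1| ∨ |h.1.1.1| = |g.1.1.1| ∧ (|h.1.2.1| < |g.1.2.1| ∨
      |h.1.2.1| = |g.1.2.1| ∧ (h.1.1.1 < g.1.1.1 ∨ h.1.1.1 = g.1.1.1 ∧ h.1.2.1 < g.1.2.1)) := by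
  have a1 := abs_cases g.1.1
  have a2 := abs_cases g.1.2
  have a3 := abs_cases h.1.1
  have a4 := abs_cases h.1.2
  unfold PBWGen.Prec
  omega

lemma PBWGen.Prec.trans {g h k : PBWGen n} (h1 : g.Prec h) (h2 : h.Prec k) : g.Prec k := by
  rw [PBWGen.prec_iff] at *
  rcases h1 with h1 | ⟨h1, h3 | ⟨h3, h4 | ⟨h4, h5⟩⟩⟩ <;>
  rcases h2 with h2 | ⟨h2, h6 | ⟨h6, h7 | ⟨h7, h8⟩⟩⟩ <;>
  omega

lemma PBWGen.Prec.total {g h : PBWGen n} (hgh : g ≠ h) : g.Prec h ∨ h.Prec g := by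
  have a1 := abs_cases g.1.1
  have a2 := abs_cases g.1.2
  have a3 := abs_cases h.1.1
  have a4 := abs_cases h.1.2
  have a5 : ¬ (g.1.1.1 = h.1.1.1 ∧ g.1.2.1 = h.1.2.1) := fun hh =>
    hgh (Subtype.ext (Prod.ext (Subtype.ext hh.1) (Subtype.ext hh.2)))
  unfold PBWGen.Prec
  omega

/-- The weak version of the order on the PBW generators for which only even generators may be
repeated. -/
def PBWGen.Step (g h : PBWGen n) : Prop := g.Prec h ∨ (g = h ∧ ¬ g.IsOdd)

lemma PBWGen.Step.antisymm {g h : PBWGen n} (h1 : g.Step h) (h2 : h.Step g) : g = h := by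
  rcases h1 with h1 | h1
  · rcases h2 with h2 | h2
    · exact absurd (h1.trans h2) (PBWGen.Prec.irrefl g)
    · exact h2.1.symm
  · exact h1.1

lemma eq_of_perm_of_step {w w' : List (PBWGen n)} (h : w.Perm w') (hw : w.Pairwise PBWGen.Step)
    (hw' : w'.Pairwise PBWGen.Step) : w = w' :=
  h.eq_of_pairwise (fun _ _ _ _ => PBWGen.Step.antisymm) hw hw'

lemma cons_erase_of_step {k : PBWGen n} {w : List (PBWGen n)}
    (h : (k :: w).Pairwise PBWGen.Step) (hk : k ∈ w) : k :: w.erase k = w := by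
  have h1 := List.pairwise_cons.mp h
  refine eq_of_perm_of_step (List.perm_cons_erase hk).symm ?_ h1.2
  exact List.pairwise_cons.mpr
    ⟨fun x hx => h1.1 x (List.mem_of_mem_erase hx), h1.2.sublist List.erase_sublist⟩

lemma not_isOdd_of_mem {k : PBWGen n} {w : List (PBWGen n)}
    (h : (k :: w).Pairwise PBWGen.Step) (hk : k ∈ w) : ¬ k.IsOdd :=
  (((List.pairwise_cons.mp h).1 k hk).resolve_left (PBWGen.Prec.irrefl k)).2

/-- The contraction of the first order part of the coproduct of a word. -/
def contract (k : PBWGen n) (w : List (Idx n × Idx n)) : Uqp n :=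
  ∑ r, ∑ s, detect k r s • deriv w r s

lemma contract_mem_filt (k : PBWGen n) (w : List (Idx n × Idx n)) :
    contract k w ∈ filt n w.length :=
  sum_mem fun _ _ => sum_mem fun _ _ => smul_mem_filt (val_detect _ _ _) (deriv_mem_filt _ _ _)

lemma contract_cons (k : PBWGen n) (g : Idx n × Idx n) (w : List (Idx n × Idx n)) :
    contract k (g :: w) = y g * contract k w +
      ((-1 : Cq) ^ (gpar g * wpar w) * ∑ r, ∑ s, detect k r s • sOne n r s g.1 g.2) • yword w := by
  simp only [contract, deriv, smul_add, Finset.sum_add_distrib, Finset.mul_sum, Finset.sum_smul,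
    mul_smul_comm, smul_smul, smul_eq_mul, mul_left_comm]

/-- Contraction behaves like the partial derivative by the generator k. Copies of k in a reduced
word are adjacent, so deleting any of them gives the same word; N counts them. For even k there are
no signs, so the contributions cannot cancel, while an odd k occurs at most once. -/
lemma contract_letters (k : PBWGen n) {ε : Cq} (hε : ∀ g : PBWGen n,
      ∑ r, ∑ s, detect k r s • sOne n r s g.1.1 g.1.2 = if g = k then ε else 0)
    {w : List (PBWGen n)} (hw : w.Pairwise PBWGen.Step) :
    ∃ N m : ℕ, contract k (letters w) =
      ((N : Cq) * ((-1) ^ m * ε)) • yword (letters (w.erase k)) ∧ (k ∈ w ↔ N ≠ 0) ∧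
        (¬ k.IsOdd → m = 0) := by
  induction w with
  | nil => exact ⟨0, 0, by simp [contract, letters, deriv], by simp, fun _ => rfl⟩
  | cons g w ih =>
    obtain ⟨N, m, h1, h2, h3⟩ := ih (List.pairwise_cons.mp hw).2
    rw [letters_cons, contract_cons, hε, h1]
    by_cases hg : g = k
    · subst hg
      rw [List.erase_cons_head, if_pos rfl]
      by_cases hk : g ∈ w
      · have h4 := not_isOdd_of_mem hw hk
        have h5 : (-1 : Cq) ^ (gpar g.1 * wpar (letters w)) = 1 := by
          have h5 : Even (gpar g.1) := Nat.not_odd_iff_even.mp h4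
          rw [pow_mul, h5.neg_one_pow, one_pow]
        refine ⟨N + 1, 0, ?_, by simp, fun _ => rfl⟩
        rw [mul_smul_comm, ← yword_cons, ← letters_cons, cons_erase_of_step hw hk, h3 h4, h5,
          ← add_smul]
        push_cast
        ring_nf
      · have h4 : N = 0 := by
          by_contra h
          exact hk (h2.mpr h)
        subst h4
        rw [Nat.cast_zero, zero_mul, zero_smul, mul_zero, zero_add]
        by_cases ho : g.IsOdd
        · exact ⟨1, gpar g.1 * wpar (letters w), by simp, by simp, fun h => absurd ho h⟩
        · refine ⟨1, 0, ?_, by simp, fun _ => rfl⟩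
          have h5 : Even (gpar g.1) := Nat.not_odd_iff_even.mp ho
          rw [pow_mul, h5.neg_one_pow, one_pow]
          simp
    · refine ⟨N, m, ?_, ?_, h3⟩
      · rw [if_neg hg, mul_zero, zero_smul, add_zero, mul_smul_comm, ← yword_cons, ← letters_cons,
          List.erase_cons_tail (by rw [beq_iff_eq]; exact hg)]
      · rw [List.mem_cons, or_iff_right (fun h => hg h.symm), h2]

lemma sum_detect_theta (k : PBWGen n) (w : List (Idx n × Idx n)) :
    (∑ r, ∑ s, detect k r s • theta r s (yword w)) - contract k w ∈ filt n (w.length - 1) := by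
  -- The zeroth-order term is a scalar matrix, which the pairing annihilates: it takes a difference
  -- of diagonal entries or an off-diagonal entry.
  have h1 : (∑ r, ∑ s, detect k r s • if r = s then yword w else 0) = 0 := by
    rw [sum_detect k fun r s => if r = s then yword w else 0]
    split_ifs with h h' <;> simp_all
  have h2 : (∑ r, ∑ s, detect k r s • theta r s (yword w)) - contract k w =
      ∑ r, ∑ s, detect k r s •
        (theta r s (yword w) - ((if r = s then yword w else 0) + deriv w r s)) := by
    simp only [smul_sub, smul_add, Finset.sum_sub_distrib, Finset.sum_add_distrib, h1, zero_add]
    rfl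
  rw [h2]
  exact sum_mem fun r _ => sum_mem fun s _ => smul_mem_filt (val_detect _ _ _) (theta_yword w r s)

lemma val_lattice_le {f : Uqp n →ₗ[Cq] Cq} (hf : ∀ w, val (f (yword w)) ≤ 1) {x : Uqp n}
    (hx : x ∈ lattice n) : val (f x) ≤ 1 := by
  induction hx using AddSubgroup.closure_induction with
  | mem x h =>
    obtain ⟨c, w, hc, rfl⟩ := h
    rw [map_smul, smul_eq_mul]
    exact val_mul_le hc (hf w)
  | zero => simp
  | add x y _ _ hx hy =>
    rw [map_add]
    exact val_add_le hx hy
  | neg x _ hx =>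
    rwa [map_neg, Valuation.map_neg]

lemma val_filt_lt {f : Uqp n →ₗ[Cq] Cq} {m : ℕ} (hf : ∀ w, val (f (yword w)) ≤ 1)
    (hf' : ∀ w, w.length < m → val (f (yword w)) < 1) {x : Uqp n} (hx : x ∈ filt n m) :
    val (f x) < 1 := by
  induction hx using AddSubgroup.closure_induction with
  | mem x h =>
    obtain ⟨c, w, hc, rfl⟩ := h
    rw [map_smul, smul_eq_mul]
    rcases hc with hc | hc
    · exact val_mul_lt' hc.1 (hf' w hc.2)
    · exact val_mul_lt hc (hf w)
  | zero => simp
  | add x y _ _ hx hy =>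
    rw [map_add]
    exact val.map_add_lt hx hy
  | neg x _ hx =>
    rwa [map_neg, Valuation.map_neg]

lemma isRTT_counit : IsRTT (n := n) (fun i j => if i = j then (1 : Cq) else 0) fun _ => 1 where
  diag i := by simp
  anti i hi := by simp [neg_ne_self]
  tri i j hij := by
    rw [if_neg]
    rintro rfl
    exact lt_irrefl _ hij
  mul_inv i := by simp
  inv_mul i := by simp
  rtt i b k d := by
    simp only [mul_ite, mul_one, mul_zero, smul_ite, smul_zero, Finset.sum_ite_eq,
      Finset.mem_univ, if_true]
    rw [Even.neg_one_pow (by rw [← two_mul, mul_assoc]; exact even_two_mul _),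
      Finset.sum_eq_single b (fun x _ hx => by simp [hx]) (by simp),
      Finset.sum_eq_single d (fun x _ hx => by simp [hx]) (by simp), if_pos rfl, if_pos rfl, Even.neg_one_pow (by rw [← two_mul (par b), mul_left_comm]; exact even_two_mul _)]

lemma exists_counit : ∃ f : Uqp n →ₐ[Cq] Cq, ∀ g, f (y g) = 0 := by
  refine ⟨isRTT_counit.lift, fun g => ?_⟩
  rw [y, map_smul, map_sub, isRTT_counit.lift_t]
  split_ifs <;> simp

/-- For every reduced word there is a functional that detects it modulo shorter words and modulo
the maximal ideal of the place `q = 1`. -/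
theorem exists_functional {h : List (PBWGen n)} (hh : h.Pairwise PBWGen.Step) :
    ∃ f : Uqp n →ₗ[Cq] Cq, (∀ w, val (f (yword w)) ≤ 1) ∧
      (∀ w, w.length < h.length → val (f (yword w)) < 1) ∧
      (∀ w : List (PBWGen n), w.Pairwise PBWGen.Step → w.length = h.length → w ≠ h →
        val (f (yword (letters w))) < 1) ∧
      val (f (yword (letters h))) = 1 := by
  induction h with
  | nil =>
    obtain ⟨f, hf⟩ := exists_counit (n := n)
    refine ⟨f.toLinearMap, fun w => ?_, fun w hw => absurd hw (Nat.not_lt_zero _),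
      fun w _ hw hne => absurd (List.length_eq_zero_iff.mp hw) hne, ?_⟩
    · cases w with
      | nil => simp [yword_nil]
      | cons g w => simp [yword_cons, hf]
    · simp [letters, yword_nil]
  | cons k h ih =>
    obtain ⟨f, f1, f2, f3, f4⟩ := ih (List.pairwise_cons.mp hh).2
    obtain ⟨ε, hε, hε'⟩ := sum_detect_sOne k
    -- The first letter k is differentiated away and the functional for the tail is applied. The
    -- remainder lies in shorter words or the maximal ideal, where that functional is small.
    let F : Uqp n →ₗ[Cq] Cq := f ∘ₗ ∑ r, ∑ s, detect k r s • theta r s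
    have hF : ∀ w, F (yword w) = f (contract k w) +
        f ((∑ r, ∑ s, detect k r s • theta r s (yword w)) - contract k w) := by
      intro w
      rw [← map_add, add_sub_cancel]
      simp only [F, LinearMap.comp_apply, LinearMap.sum_apply, LinearMap.smul_apply]
    have hrem : ∀ w : List (Idx n × Idx n), w.length ≤ h.length + 1 →
        val (f ((∑ r, ∑ s, detect k r s • theta r s (yword w)) - contract k w)) < 1 := by
      intro w hw
      exact val_filt_lt f1 f2 (filt_mono (by omega) (sum_detect_theta k w))
    have hmain : ∀ w : List (PBWGen n), w.Pairwise PBWGen.Step → w.length = h.length + 1 →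
        val (f (contract k (letters w))) < 1 ∧ w ≠ k :: h ∨
        val (f (contract k (letters w))) = 1 ∧ w = k :: h := by
      intro w hw hl
      obtain ⟨N, m, h1, h2, h3⟩ := contract_letters k hε' hw
      have h4 : f (contract k (letters w)) =
          (N : Cq) * ((-1) ^ m * ε) * f (yword (letters (w.erase k))) := by
        rw [h1, map_smul, smul_eq_mul]
      by_cases hk : k ∈ w
      · have hN : val ((N : Cq) * ((-1) ^ m * ε)) = 1 := by
          rw [map_mul, val_neg_one_pow_mul, hε, val_natCast (h2.mp hk), one_mul]
        have h5 : (w.erase k).Pairwise PBWGen.Step := hw.sublist List.erase_sublist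
        rw [h4, map_mul, hN, one_mul]
        -- If deleting k leaves h, then w is a permutation of k :: h, and two reduced words that are
        -- permutations of each other coincide.
        by_cases h6 : w.erase k = h
        · right
          rw [h6]
          refine ⟨f4, eq_of_perm_of_step ?_ hw hh⟩
          rw [← h6]
          exact List.perm_cons_erase hk
        · left
          refine ⟨f3 _ h5 (by rw [List.length_erase_of_mem hk]; omega) h6, ?_⟩
          rintro rfl
          exact h6 (List.erase_cons_head _ _)
      · left
        have hN : N = 0 := by
          by_contra hN
          exact hk (h2.mpr hN)
        rw [h4, hN]
        refine ⟨by simp, ?_⟩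
        rintro rfl
        exact hk List.mem_cons_self
    refine ⟨F, fun w => ?_, fun w hw => ?_, fun w hw hl hne => ?_, ?_⟩
    · rw [hF]
      exact val_add_le (val_lattice_le f1 (filt_le_lattice _ (contract_mem_filt k w)))
        (val_lattice_le f1 (filt_le_lattice _ (sum_detect_theta k w)))
    · rw [List.length_cons] at hw
      rw [hF]
      exact val.map_add_lt (val_filt_lt f1 f2 (filt_mono (by omega) (contract_mem_filt k w)))
        (hrem w (by omega))
    · rw [hF]
      refine val.map_add_lt ?_ (hrem _ (by rw [letters, List.length_map]; exact hl.le))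
      rcases hmain w hw hl with h1 | h1
      · exact h1.1
      · exact absurd h1.2 hne
    · rw [hF]
      rcases hmain (k :: h) hh rfl with h1 | h1
      · exact absurd rfl h1.2
      · rw [← h1.1]
        refine Valuation.map_add_eq_of_lt_left val ?_
        rw [h1.1]
        exact hrem _ (by rw [letters, List.length_map, List.length_cons])

end Functionals

end QuantumP
end

noncomputable section
namespace QuantumP

/-! ### Linear independence of the reduced words. -/

section Independence

variable {n : ℕ}

/-- The words in the PBW generators that are weakly increasing, with odd generators not repeated. -/
abbrev ReducedWord (n : ℕ) : Type := {w : List (PBWGen n) // w.Pairwise PBWGen.Step}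

/-- The product of the generators `t_{ij}` along a word. -/
def tword (w : List (Idx n × Idx n)) : Uqp n := (w.map fun g => t g.1 g.2).prod

lemma tword_cons (g : Idx n × Idx n) (w : List (Idx n × Idx n)) :
    tword (g :: w) = t g.1 g.2 * tword w := by
  rw [tword, List.map_cons, List.prod_cons, tword]

/-- In a nontrivial relation, take the coefficients of largest valuation and among them a longest
word. After dividing by its coefficient, the functional of that word takes a unit value on it and a
value in the maximal ideal on the rest, so the sum cannot vanish. -/
lemma linearIndependent_yword :
    LinearIndependent Cq fun w : ReducedWord n => yword (letters w.1) := by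
  classical
  rw [linearIndependent_iff']
  intro s c hc
  by_contra! hne
  obtain ⟨w₁, hw₁, hc₁⟩ := hne
  obtain ⟨w₂, hw₂, hmax⟩ := s.exists_max_image (fun w => val (c w)) ⟨w₁, hw₁⟩
  have hv₂ : val (c w₂) ≠ 0 := by
    refine ne_of_gt (lt_of_lt_of_le ?_ (hmax w₁ hw₁))
    exact zero_lt_iff.mpr ((Valuation.ne_zero_iff _).mpr hc₁)
  have hc₂ : c w₂ ≠ 0 := (Valuation.ne_zero_iff _).mp hv₂
  obtain ⟨w₃, hw₃, hlen⟩ := (s.filter fun w => val (c w) = val (c w₂)).exists_max_image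
    (fun w => w.1.length) ⟨w₂, by simp [hw₂]⟩
  rw [Finset.mem_filter] at hw₃
  have hv₃ : val (c w₃) ≠ 0 := hw₃.2 ▸ hv₂
  have hc₃ : c w₃ ≠ 0 := (Valuation.ne_zero_iff _).mp hv₃
  have hle : ∀ w ∈ s, val ((c w₃)⁻¹ * c w) ≤ 1 := by
    intro w hw
    rw [map_mul, map_inv₀, hw₃.2, inv_mul_le_one₀ (zero_lt_iff.mpr hv₂)]
    exact hmax w hw
  obtain ⟨f, f1, f2, f3, f4⟩ := exists_functional w₃.2
  have h1 := congrArg (fun x => (c w₃)⁻¹ * f x) hc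
  simp only [map_sum, map_smul, map_zero, mul_zero, Finset.mul_sum, smul_eq_mul, ← mul_assoc] at h1
  rw [← Finset.add_sum_erase s _ hw₃.1, inv_mul_cancel₀ hc₃, one_mul] at h1
  have h2 : val (∑ w ∈ s.erase w₃, (c w₃)⁻¹ * c w * f (yword (letters w.1))) < 1 := by
    refine val_sum_lt _ _ fun w hw => ?_
    rw [Finset.mem_erase] at hw
    rcases lt_trichotomy w.1.length w₃.1.length with hl | hl | hl
    · exact val_mul_lt' (hle w hw.2) (f2 _ (by rwa [letters, List.length_map]))
    · exact val_mul_lt' (hle w hw.2) (f3 _ w.2 hl fun h => hw.1 (Subtype.ext h))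
    -- A longer word is not controlled by the functional, but the choice of a longest word makes its
    -- normalized coefficient small.
    · refine val_mul_lt ((hle w hw.2).lt_of_ne fun h => ?_) (f1 _)
      refine hl.not_ge (hlen w (Finset.mem_filter.mpr ⟨hw.2, ?_⟩))
      rw [map_mul, map_inv₀, hw₃.2, inv_mul_eq_one₀ hv₂] at h
      exact h.symm
  rw [eq_neg_of_add_eq_zero_right h1, Valuation.map_neg, f4] at h2
  exact lt_irrefl _ h2

lemma yword_mem_span (w : List (PBWGen n)) :
    yword (letters w) ∈ Submodule.span Cq ((fun u => tword (letters u)) '' {u | u.Sublist w}) := by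
  induction w with
  | nil => exact Submodule.subset_span ⟨[], List.Sublist.refl _, rfl⟩
  | cons g w ih =>
    rw [letters_cons, yword_cons, y, smul_mul_assoc, sub_mul]
    refine Submodule.smul_mem _ _ (sub_mem ?_ ?_)
    · have h1 := Submodule.mem_map_of_mem (f := LinearMap.mulLeft Cq (t g.1.1 g.1.2)) ih
      rw [Submodule.map_span] at h1
      refine Submodule.span_mono ?_ h1
      rintro x ⟨x, ⟨u, hu, rfl⟩, rfl⟩
      exact ⟨g :: u, List.Sublist.cons_cons _ hu, tword_cons g.1 (letters u)⟩
    · have h1 := Submodule.span_mono (R := Cq)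
        (Set.image_mono (f := fun u : List (PBWGen n) => tword (letters u))
        fun u (hu : u.Sublist w) => hu.trans (List.sublist_cons_self g w)) ih
      split_ifs
      · rwa [one_mul]
      · rw [zero_mul]
        exact zero_mem _

/-- The reduced words of length at most m are finitely many and closed under subwords. The span of
their t-products contains the equally many independent y-products, so the t-products are independent
too. -/
theorem linearIndependent_tword :
    LinearIndependent Cq fun w : ReducedWord n => tword (letters w.1) := by
  classical
  rw [linearIndependent_iff_finset_linearIndependent]
  intro s
  obtain ⟨m, hm⟩ : ∃ m, ∀ w ∈ s, w.1.length ≤ m :=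
    ⟨s.sup fun w => w.1.length, fun w hw => Finset.le_sup (f := fun w => w.1.length) hw⟩
  let B : Type := {w : ReducedWord n // w.1.length ≤ m}
  have hfin : Finite B := by
    have h1 : Finite {w : List (PBWGen n) // w.length ≤ m} := List.finite_length_le _ m
    exact Finite.of_injective (β := {w : List (PBWGen n) // w.length ≤ m}) (fun w => ⟨w.1.1, w.2⟩)
      fun w w' h => by
        have h2 : w.1.1 = w'.1.1 := congrArg (fun x : {w : List (PBWGen n) // w.length ≤ m} => x.1) h
        exact Subtype.ext (Subtype.ext h2)
  have := Fintype.ofFinite B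
  have hy : LinearIndependent Cq fun w : B => yword (letters w.1.1) :=
    linearIndependent_yword.comp (fun w : B => w.1) Subtype.val_injective
  have ht : LinearIndependent Cq fun w : B => tword (letters w.1.1) := by
    rw [linearIndependent_iff_card_le_finrank_span]
    rw [linearIndependent_iff_card_eq_finrank_span] at hy
    rw [hy]
    have : Module.Finite Cq (Submodule.span Cq (Set.range fun w : B => tword (letters w.1.1))) :=
      FiniteDimensional.span_of_finite _ (Set.finite_range _)
    refine Submodule.finrank_mono ?_
    rw [Submodule.span_le]
    rintro x ⟨w, rfl⟩
    refine Submodule.span_mono ?_ (yword_mem_span w.1.1)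
    rintro x ⟨u, hu, rfl⟩
    exact ⟨⟨⟨u, w.1.2.sublist hu⟩, hu.length_le.trans w.2⟩, rfl⟩
  exact ht.comp (fun w : s => ⟨w.1, hm w.1 w.2⟩) fun w w' h => by
    have h2 : w.1 = w'.1 := congrArg (fun x : B => x.1) h
    exact Subtype.ext h2

end Independence

end QuantumP

end

noncomputable section
namespace QuantumP

/-! ### Reduction of words in the t_{ij} to reduced words. -/

section Spanning

variable {n : ℕ}

lemma tword_append (u w : List (Idx n × Idx n)) : tword (u ++ w) = tword u * tword w := by
  rw [tword, List.map_append, List.prod_append, tword, tword]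

/-- Modulo the maximal ideal of the place `q = 1` the generators supercommute. -/
lemma t_mul_t (g h : Idx n × Idx n) :
    t h.1 h.2 * t g.1 g.2 = (-1 : Cq) ^ (gpar g * gpar h) • (t g.1 g.2 * t h.1 h.2) +
      ((∑ j, ∑ l, (hbar * ((-1) ^ ((par h.1 + par l) * (par g.1 + par g.2)) *
        sOne n j g.2 l h.2)) • (t g.1 j * t h.1 l)) -
      ∑ j, ∑ l, (hbar * ((-1) ^ ((par h.1 + par l) * (par j + par g.2)) *
        sOne n g.1 j h.1 l)) • (t l h.2 * t j g.2)) := by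
  have h1 := isRTT_t.rtt g.1 g.2 h.1 h.2
  have h2 : ∀ (ε : Cq) (a b c d : Idx n), ε * S n a b c d =
      (if a = b ∧ c = d then ε else 0) + hbar * (ε * sOne n a b c d) := by
    intro ε a b c d
    rw [S_eq, mul_add, mul_ite, mul_one, mul_zero, mul_left_comm]
  simp only [h2, add_smul, Finset.sum_add_distrib] at h1
  have h3 : ∑ j, ∑ l, (if j = g.2 ∧ l = h.2 then
      (-1 : Cq) ^ ((par h.1 + par l) * (par g.1 + par g.2)) else 0) • (t g.1 j * t h.1 l) =
      (-1 : Cq) ^ (gpar g * gpar h) • (t g.1 g.2 * t h.1 h.2) := by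
    rw [Finset.sum_eq_single g.2 (fun x _ hx => Finset.sum_eq_zero fun y _ => by simp [hx])
      (by simp), Finset.sum_eq_single h.2 (fun x _ hx => by simp [hx]) (by simp),
      if_pos ⟨rfl, rfl⟩, mul_comm, gpar, gpar]
  have h4 : ∑ j, ∑ l, (if g.1 = j ∧ h.1 = l then
      (-1 : Cq) ^ ((par h.1 + par l) * (par j + par g.2)) else 0) • (t l h.2 * t j g.2) =
      t h.1 h.2 * t g.1 g.2 := by
    rw [Finset.sum_eq_single g.1 (fun x _ hx => Finset.sum_eq_zero fun y _ => by simp [hx.symm])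
      (by simp), Finset.sum_eq_single h.1 (fun x _ hx => by simp [hx.symm]) (by simp),
      if_pos ⟨rfl, rfl⟩, Even.neg_one_pow (by rw [← two_mul, mul_assoc]; exact even_two_mul _),
      one_smul]
  rw [h3, h4] at h1
  rw [← add_sub_assoc, eq_sub_iff_add_eq, h1]

/-- A letter is either zero or a PBW generator. -/
lemma exists_pbwGen (g : Idx n × Idx n) : t g.1 g.2 = 0 ∨ ∃ k : PBWGen n, t g.1 g.2 = t k.1.1 k.1.2 := by
  rcases lt_trichotomy |g.1.1| |g.2.1| with h | h | h
  · exact Or.inr ⟨⟨g, Or.inl h⟩, rfl⟩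
  · rcases pos_or_neg g.1 with hp | hp
    · exact Or.inr ⟨⟨g, Or.inr ⟨h, hp⟩⟩, rfl⟩
    · rcases abs_eq_abs_iff.mp h with h' | h'
      · refine Or.inr ⟨⟨(-g.1, -g.1), Or.inr ⟨rfl, ?_⟩⟩, ?_⟩
        · change 0 < (-g.1).1
          rw [neg_val]
          omega
        · rw [← h']
          exact isRTT_t.diag g.1
      · left
        rw [h']
        refine isRTT_t.anti g.2 ?_
        have := congrArg Subtype.val h'
        rw [neg_val] at this
        omega
  · exact Or.inl (isRTT_t.tri _ _ h)

lemma exists_letters (w : List (Idx n × Idx n)) :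
    tword w = 0 ∨ ∃ u : List (PBWGen n), u.length = w.length ∧ tword w = tword (letters u) := by
  induction w with
  | nil => exact Or.inr ⟨[], rfl, rfl⟩
  | cons g w ih =>
    rw [tword_cons]
    rcases exists_pbwGen g with hg | ⟨k, hk⟩
    · exact Or.inl (by rw [hg, zero_mul])
    · rcases ih with hw | ⟨u, hu, hw⟩
      · exact Or.inl (by rw [hw, mul_zero])
      · exact Or.inr ⟨k :: u, by rw [List.length_cons, hu, List.length_cons],
          by rw [hw, hk, letters_cons, tword_cons]⟩

variable {f : Uqp n →ₗ[Cq] Cq} {d : ℕ}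

/-- All terms of the relation are quadratic, so the corrections to a swap are q - 1 times words of
the same length d, on which f is bounded by 1. -/
lemma val_swap (hf : ∀ w : List (Idx n × Idx n), w.length = d → val (f (tword w)) ≤ 1)
    (u w : List (Idx n × Idx n)) (g h : Idx n × Idx n) (hl : (u ++ g :: h :: w).length = d) :
    val (f (tword (u ++ h :: g :: w)) -
      (-1) ^ (gpar g * gpar h) * f (tword (u ++ g :: h :: w))) < 1 := by
  have hl' : ∀ a b, (u ++ a :: b :: w).length = d := by
    intro a b
    simpa using hl
  have he : ∀ a b : Idx n × Idx n,
      tword (u ++ a :: b :: w) = tword u * (t a.1 a.2 * t b.1 b.2) * tword w := by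
    intro a b
    rw [tword_append, tword_cons, tword_cons]
    simp only [mul_assoc]
  have hs : ∀ (c : Idx n → Idx n → Cq) (a b : Idx n → Idx n → Idx n × Idx n),
      (∀ j l, val (c j l) ≤ 1) →
      val (f (tword u * (∑ j, ∑ l, (hbar * c j l) •
        (t (a j l).1 (a j l).2 * t (b j l).1 (b j l).2)) * tword w)) < 1 := by
    intro c a b hc
    simp only [Finset.mul_sum, Finset.sum_mul, mul_smul_comm, smul_mul_assoc, map_sum, map_smul,
      ← he, smul_eq_mul]
    exact val_sum_lt _ _ fun j _ => val_sum_lt _ _ fun l _ =>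
      val_mul_lt (val_mul_lt val_hbar_lt (hc j l)) (hf _ (hl' _ _))
  rw [he, t_mul_t, mul_add, add_mul, map_add, mul_smul_comm, smul_mul_assoc, map_smul, ← he,
    smul_eq_mul, add_sub_cancel_left, mul_sub, sub_mul, map_sub]
  refine val.map_sub_lt
    (hs (fun j l => _) (fun j _ => (g.1, j)) (fun _ l => (h.1, l)) fun j l => ?_)
    (hs (fun j l => _) (fun _ l => (l, h.2)) (fun j _ => (j, g.2)) fun j l => ?_)
  · rw [val_neg_one_pow_mul]
    exact val_sOne _ _ _ _
  · rw [val_neg_one_pow_mul]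
    exact val_sOne _ _ _ _

lemma val_perm (hf : ∀ w : List (Idx n × Idx n), w.length = d → val (f (tword w)) ≤ 1)
    {w w' : List (Idx n × Idx n)} (h : w.Perm w') (u : List (Idx n × Idx n))
    (hl : (u ++ w').length = d) (h' : val (f (tword (u ++ w'))) < 1) :
    val (f (tword (u ++ w))) < 1 := by
  induction h generalizing u with
  | nil => exact h'
  | @cons g w w' hp ih =>
    rw [List.append_cons] at *
    exact ih _ hl h'
  | swap g h w =>
    have h1 := val_swap hf u w g h hl
    rw [← sub_add_cancel (f (tword (u ++ h :: g :: w)))]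
    refine val.map_add_lt h1 ?_
    rwa [val_neg_one_pow_mul]
  | @trans w w' w'' hp hp' ih ih' =>
    refine ih u ?_ (ih' u hl h')
    rw [← hl, List.length_append, List.length_append, hp'.length_eq]

/-- Swapping an odd letter with itself changes the sign, so twice the value is small; 2 is a unit at
q = 1. -/
lemma val_square (hf : ∀ w : List (Idx n × Idx n), w.length = d → val (f (tword w)) ≤ 1)
    (u w : List (Idx n × Idx n)) {g : Idx n × Idx n} (hg : Odd (gpar g))
    (hl : (u ++ g :: g :: w).length = d) : val (f (tword (u ++ g :: g :: w))) < 1 := by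
  have h1 := val_swap hf u w g g hl
  rw [(hg.mul hg).neg_one_pow, neg_one_mul, sub_neg_eq_add, ← two_mul, map_mul] at h1
  have h2 : val (2 : Cq) = 1 := by
    have h3 := val_natCast (N := 2) two_ne_zero
    rwa [Nat.cast_ofNat] at h3
  rwa [h2, one_mul] at h1

/-- The weak order on the PBW generators. -/
def PBWGen.Le (g h : PBWGen n) : Prop := g.Prec h ∨ g = h

instance : Std.Total (PBWGen.Le (n := n)) where
  total g h := by
    by_cases hgh : g = h
    · exact Or.inl (Or.inr hgh)
    · exact (PBWGen.Prec.total hgh).imp Or.inl Or.inl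

instance : IsTrans (PBWGen n) PBWGen.Le where
  trans g h k h1 h2 := by
    rcases h1 with h1 | rfl
    · rcases h2 with h2 | rfl
      · exact Or.inl (h1.trans h2)
      · exact Or.inl h1
    · exact h2

lemma pairwise_step_or_square {w : List (PBWGen n)} (hw : w.Pairwise PBWGen.Le) :
    w.Pairwise PBWGen.Step ∨ ∃ u v g, PBWGen.IsOdd g ∧ w = u ++ g :: g :: v := by
  induction w with
  | nil => exact Or.inl List.Pairwise.nil
  | cons g w ih =>
    rw [List.pairwise_cons] at hw
    rcases ih hw.2 with h1 | ⟨u, v, k, hk, rfl⟩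
    · by_cases hg : g ∈ w ∧ g.IsOdd
      · right
        obtain ⟨hgw, ho⟩ := hg
        cases w with
        | nil => simp at hgw
        | cons k w =>
          have h2 : g = k := by
            rcases hw.1 k List.mem_cons_self with h3 | h3
            · rcases List.mem_cons.mp hgw with h4 | h4
              · exact h4
              · rcases (List.pairwise_cons.mp hw.2).1 g h4 with h5 | h5
                · exact absurd (h3.trans h5) (PBWGen.Prec.irrefl g)
                · exact h5.symm
            · exact h3
          exact ⟨[], w, g, ho, by rw [h2]; rfl⟩
      · left
        refine List.pairwise_cons.mpr ⟨fun k hk => ?_, h1⟩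
        rcases hw.1 k hk with h2 | rfl
        · exact Or.inl h2
        · exact Or.inr ⟨rfl, fun ho => hg ⟨hk, ho⟩⟩
    · exact Or.inr ⟨g :: u, v, k, hk, rfl⟩

/-- A functional that vanishes on the reduced words of length `d` vanishes on all words of
length `d`. -/
lemma eq_zero_of_reduced
    (hf : ∀ w : ReducedWord n, w.1.length = d → f (tword (letters w.1)) = 0)
    (w : List (Idx n × Idx n)) (hw : w.length = d) : f (tword w) = 0 := by
  classical
  have hfin : Finite {w : List (Idx n × Idx n) // w.length = d} := List.finite_length_eq _ d
  have hne : Nonempty {w : List (Idx n × Idx n) // w.length = d} := ⟨⟨w, hw⟩⟩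
  -- There are finitely many words of length d, so a word of maximal valuation exists. Scaling its
  -- value to 1 bounds all the others, and sorting it then shows that 1 is small.
  obtain ⟨v, hv⟩ := Finite.exists_max
    fun w : {w : List (Idx n × Idx n) // w.length = d} => val (f (tword w.1))
  by_contra hfw
  have hvv : val (f (tword v.1)) ≠ 0 := fun h =>
    hfw ((Valuation.zero_iff _).mp (le_zero_iff.mp (h ▸ hv ⟨w, hw⟩)))
  set c := f (tword v.1) with hc
  have hF : ∀ w : List (Idx n × Idx n), w.length = d → val ((c⁻¹ • f) (tword w)) ≤ 1 := by
    intro w hw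
    rw [LinearMap.smul_apply, smul_eq_mul, map_mul, map_inv₀,
      inv_mul_le_one₀ (zero_lt_iff.mpr hvv)]
    exact hv ⟨w, hw⟩
  have hv1 : (c⁻¹ • f) (tword v.1) = 1 := by
    rw [LinearMap.smul_apply, smul_eq_mul, ← hc,
      inv_mul_cancel₀ ((Valuation.ne_zero_iff _).mp hvv)]
  suffices h : val ((c⁻¹ • f) (tword v.1)) < 1 by
    rw [hv1, map_one] at h
    exact lt_irrefl _ h
  rcases exists_letters v.1 with h0 | ⟨u, hu, h0⟩
  · rw [h0, map_zero, map_zero]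
    exact zero_lt_one
  rw [h0]
  have hp := List.perm_insertionSort PBWGen.Le u
  have hlen : (letters (u.insertionSort PBWGen.Le)).length = d := by
    rw [letters, List.length_map, hp.length_eq, hu, v.2]
  refine val_perm hF (hp.symm.map Subtype.val) [] hlen ?_
  rw [List.nil_append]
  rcases pairwise_step_or_square (List.pairwise_insertionSort PBWGen.Le u) with h1 | ⟨u', v', g, hg, h1⟩
  · have h2 := hf ⟨_, h1⟩ (by rw [hp.length_eq, hu, v.2])
    change val ((c⁻¹ • f) (tword (letters (u.insertionSort PBWGen.Le)))) < 1
    rw [LinearMap.smul_apply, h2, smul_zero, map_zero]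
    exact zero_lt_one
  · change val ((c⁻¹ • f) (tword (letters (u.insertionSort PBWGen.Le)))) < 1
    have h2 : letters (u.insertionSort PBWGen.Le) = letters u' ++ g.1 :: g.1 :: letters v' := by
      rw [h1, letters, List.map_append]
      rfl
    rw [h2] at hlen ⊢
    exact val_square hF _ _ hg hlen

/-- A functional separating the word from the span would contradict `eq_zero_of_reduced`. -/
theorem tword_mem_span (w : List (Idx n × Idx n)) :
    tword w ∈ Submodule.span Cq (Set.range fun w : ReducedWord n => tword (letters w.1)) := by
  by_contra h
  obtain ⟨f, hf, hf'⟩ := Submodule.exists_le_ker_of_notMem h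
  exact hf (eq_zero_of_reduced (fun w _ => hf' (Submodule.subset_span ⟨w, rfl⟩)) w rfl)

end Spanning

end QuantumP

end

noncomputable section
namespace QuantumP

/-! ### Diagonal generators commute with the others up to scalars. -/

section Diagonal

variable {n : ℕ}

lemma sum_sum_ite {M : Type*} [AddCommMonoid M] (a b : Idx n) (F : Idx n → Idx n → M) :
    ∑ j, ∑ l, (if j = a ∧ l = b then F j l else 0) = F a b := by
  rw [Finset.sum_eq_single a (fun x _ hx => Finset.sum_eq_zero fun y _ => by simp [hx]) (by simp),
    Finset.sum_eq_single b (fun x _ hx => by simp [hx]) (by simp), if_pos ⟨rfl, rfl⟩]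

lemma eq_sub_smul {M : Type*} [AddCommGroup M] [Module Cq M] {b c : Cq} {x y : M}
    (h : x + c • y = b • y) : x = (b - c) • y := by
  rw [sub_smul, ← h, add_sub_cancel_right]

/-- This is the defining relation with first pair (i, i). Each contraction term contains a generator
whose first index exceeds the second in absolute value, hence vanishes. -/
lemma t_diag_relation {i : Idx n} (hi : 0 < i.1) (k d : Idx n) :
    diagCoeff i d • (t i i * t k d) + (if key i < key d then z else 0) • (t i d * t k i) =
      diagCoeff i k • (t k d * t i i) + (if key k < key i then z else 0) • (t i d * t k i) := by
  have h1 := isRTT_t.rtt i i k d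
  have hpi : par i = 0 := par_of_pos hi
  have h2 : ∀ j l, ((-1 : Cq) ^ ((par k + par l) * (par i + par i)) * S n j i l d) •
      (t i j * t k l) =
      (if j = i ∧ l = d then diagCoeff j l • (t i j * t k l) else 0) +
      if j = d ∧ l = i then (if key l < key d then z else 0) • (t i j * t k l) else 0 := by
    intro j l
    rw [hpi, add_zero, mul_zero, pow_zero, one_mul, S_apply, add_smul, add_smul, ite_smul, zero_smul]
    have h3 : (if j = -l ∧ i = -d ∧ |l.1| < |d.1| then
        -(z * (-1) ^ (par l + par d * (par l + 1))) else 0) • (t i j * t k l) = (0 : Uqp n) := by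
      split_ifs with h
      · rw [isRTT_t.tri i j, zero_mul, smul_zero]
        rw [h.1, h.2.1, neg_val, neg_val, abs_neg, abs_neg]
        exact h.2.2
      · exact zero_smul _ _
    rw [h3, add_zero]
    refine congrArg _ ?_
    by_cases h : j = d ∧ l = i
    · obtain ⟨rfl, rfl⟩ := h
      simp [hpi]
    · rw [if_neg h, if_neg (fun hh => h ⟨hh.2.1.symm, hh.1⟩), zero_smul]
  have h4 : ∀ j l, ((-1 : Cq) ^ ((par k + par l) * (par j + par i)) * S n i j k l) •
      (t l d * t j i) =
      (if j = i ∧ l = k then diagCoeff j l • (t l d * t j i) else 0) +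
      if j = k ∧ l = i then (if key j < key l then z else 0) • (t l d * t j i) else 0 := by
    intro j l
    rw [S_apply, mul_add, mul_add, add_smul, add_smul]
    have h3 : ((-1 : Cq) ^ ((par k + par l) * (par j + par i)) *
        if i = -k ∧ j = -l ∧ |k.1| < |l.1| then
        -(z * (-1) ^ (par k + par l * (par k + 1))) else 0) • (t l d * t j i) = (0 : Uqp n) := by
      split_ifs with h
      · rw [isRTT_t.tri j i, mul_zero, smul_zero]
        rw [h.1, h.2.1, neg_val, neg_val, abs_neg, abs_neg]
        exact h.2.2
      · rw [mul_zero, zero_smul]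
    rw [h3, add_zero]
    refine congrArg₂ _ ?_ ?_
    · by_cases h : j = i ∧ l = k
      · obtain ⟨rfl, rfl⟩ := h
        rw [if_pos ⟨rfl, rfl⟩, if_pos ⟨rfl, rfl⟩,
          Even.neg_one_pow (by rw [← two_mul, mul_assoc]; exact even_two_mul _), one_mul]
      · rw [if_neg h, if_neg (fun hh => h ⟨hh.1.symm, hh.2.symm⟩), mul_zero, zero_smul]
    · by_cases h : j = k ∧ l = i
      · obtain ⟨rfl, rfl⟩ := h
        rw [if_pos (⟨rfl, rfl⟩ : j = j ∧ l = l), hpi, add_zero]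
        by_cases hk : key j < key l
        · rw [if_pos ⟨rfl, rfl, hk⟩, if_pos hk, mul_left_comm, ← pow_add,
            Even.neg_one_pow (by rw [← Nat.mul_succ]; exact Nat.even_mul_succ_self _), mul_one]
        · rw [if_neg (fun hh => hk hh.2.2), if_neg hk, mul_zero]
      · rw [if_neg h, if_neg (fun hh => h ⟨hh.1.symm, hh.2.1⟩), mul_zero, zero_smul]
  simp only [h2, h4, Finset.sum_add_distrib, sum_sum_ite] at h1
  exact h1

/-- The extra product t_{id} t_{ki} either vanishes, cancels between the two sides, or, when k = i
or d = i, is one of the two main products. In the last case a coefficient becomes q - z = q⁻¹, still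
nonzero. -/
lemma t_diag_comm_of_pos {i : Idx n} (hi : 0 < i.1) (k d : Idx n) :
    ∃ χ : Cq, χ ≠ 0 ∧ t i i * t k d = χ • (t k d * t i i) := by
  have h1 := t_diag_relation hi k d
  have hd := diagCoeff_ne_zero i d
  have hk := diagCoeff_ne_zero i k
  have ki := key_cases i
  have hq : diagCoeff i i - z ≠ 0 := by
    rw [diagCoeff, if_pos rfl, if_pos hi, z, sub_sub_cancel]
    exact inv_ne_zero q_ne_zero
  have hfin : ∀ {a b : Cq}, a ≠ 0 → b ≠ 0 → a • (t i i * t k d) = b • (t k d * t i i) →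
      ∃ χ : Cq, χ ≠ 0 ∧ t i i * t k d = χ • (t k d * t i i) := by
    intro a b ha hb hab
    exact ⟨a⁻¹ * b, mul_ne_zero (inv_ne_zero ha) hb, by rw [mul_smul, ← hab, inv_smul_smul₀ ha]⟩
  have h0 : t i d * t k i = 0 → ∃ χ : Cq, χ ≠ 0 ∧ t i i * t k d = χ • (t k d * t i i) := by
    intro h
    rw [h, smul_zero, smul_zero, add_zero, add_zero] at h1
    exact hfin hd hk h1
  rcases lt_trichotomy |i.1| |d.1| with h | h | h
  · have hid := key_lt_of_abs_lt h
    rcases lt_trichotomy |k.1| |i.1| with h' | h' | h'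
    · rw [if_pos hid, if_pos (key_lt_of_abs_lt h')] at h1
      exact hfin hd hk (add_right_cancel h1)
    · rcases abs_eq_abs_iff.mp h' with rfl | rfl
      · rw [if_pos hid, if_neg (lt_irrefl _), zero_smul, add_zero] at h1
        refine hfin hd (b := diagCoeff k k - z) hq ?_
        exact eq_sub_smul h1
      · exact h0 (by rw [isRTT_t.anti i hi, mul_zero])
    · exact h0 (by rw [isRTT_t.tri k i h', mul_zero])
  · rcases abs_eq_abs_iff.mp h with rfl | h'
    · rcases lt_trichotomy |k.1| |i.1| with h' | h' | h'
      · rw [if_neg (lt_irrefl _), zero_smul, add_zero, if_pos (key_lt_of_abs_lt h')] at h1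
        refine hfin (a := diagCoeff i i - z) hq hk ?_
        exact (eq_sub_smul h1.symm).symm
      · rcases abs_eq_abs_iff.mp h' with rfl | rfl
        · exact ⟨1, one_ne_zero, (one_smul _ _).symm⟩
        · exact h0 (by rw [isRTT_t.anti i hi, mul_zero])
      · exact h0 (by rw [isRTT_t.tri k i h', mul_zero])
    · have hid : key i < key d := by
        have kd := key_cases d
        have := congrArg Subtype.val h'
        rw [neg_val] at this
        omega
      rcases lt_trichotomy |k.1| |i.1| with h'' | h'' | h''
      · rw [if_pos hid, if_pos (key_lt_of_abs_lt h'')] at h1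
        exact hfin hd hk (add_right_cancel h1)
      · rcases abs_eq_abs_iff.mp h'' with rfl | rfl
        · rw [if_pos hid, if_neg (lt_irrefl _), zero_smul, add_zero] at h1
          refine hfin hd (b := diagCoeff k k - z) hq ?_
          exact eq_sub_smul h1
        · exact h0 (by rw [isRTT_t.anti i hi, mul_zero])
      · exact h0 (by rw [isRTT_t.tri k i h'', mul_zero])
  · exact h0 (by rw [isRTT_t.tri i d h, zero_mul])

/-- The elements that commute with `t_{ii}` up to a nonzero scalar. -/
def QuasiCommutes (i : Idx n) (x : Uqp n) : Prop := ∃ χ : Cq, χ ≠ 0 ∧ t i i * x = χ • (x * t i i)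

lemma quasiCommutes_t (i k d : Idx n) : QuasiCommutes i (t k d) := by
  rcases pos_or_neg i with h | h
  · exact t_diag_comm_of_pos h k d
  · have h1 : t i i = t (-i) (-i) := isRTT_t.diag i
    rw [QuasiCommutes, h1]
    refine t_diag_comm_of_pos ?_ k d
    rw [neg_val]
    omega

lemma QuasiCommutes.one (i : Idx n) : QuasiCommutes i 1 :=
  ⟨1, one_ne_zero, by rw [one_smul, mul_one, one_mul]⟩

lemma QuasiCommutes.mul {i : Idx n} {x y : Uqp n} (hx : QuasiCommutes i x)
    (hy : QuasiCommutes i y) : QuasiCommutes i (x * y) := by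
  obtain ⟨a, ha, h1⟩ := hx
  obtain ⟨b, hb, h2⟩ := hy
  refine ⟨a * b, mul_ne_zero ha hb, ?_⟩
  rw [← mul_assoc, h1, smul_mul_assoc, mul_assoc, h2, mul_smul_comm, smul_smul, mul_assoc]

lemma QuasiCommutes.pow {i : Idx n} {x : Uqp n} (hx : QuasiCommutes i x) (m : ℕ) :
    QuasiCommutes i (x ^ m) := by
  induction m with
  | zero =>
    rw [pow_zero]
    exact QuasiCommutes.one i
  | succ m ih =>
    rw [pow_succ]
    exact ih.mul hx

lemma QuasiCommutes.inv {i : Idx n} {u : (Uqp n)ˣ} (hu : QuasiCommutes i u) :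
    QuasiCommutes i ↑u⁻¹ := by
  obtain ⟨a, ha, h⟩ := hu
  refine ⟨a⁻¹, inv_ne_zero ha, ?_⟩
  rw [eq_inv_smul_iff₀ ha, ← u.mul_right_inj, mul_smul_comm, ← mul_assoc, ← smul_mul_assoc, ← h,
    mul_assoc, u.mul_inv, mul_one, u.mul_inv_cancel_left]

lemma QuasiCommutes.pbwPow (i : Idx n) (g : PBWGen n) (k : ℤ) : QuasiCommutes i (g.pow k) := by
  rw [PBWGen.pow]
  split_ifs
  · have h1 : QuasiCommutes i (tdiag g.1.1 : Uqp n) := quasiCommutes_t i _ _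
    cases k with
    | ofNat m =>
      rw [Int.ofNat_eq_natCast, zpow_natCast, Units.val_pow_eq_pow_val]
      exact h1.pow m
    | negSucc m =>
      rw [zpow_negSucc]
      refine QuasiCommutes.inv ?_
      rw [Units.val_pow_eq_pow_val]
      exact h1.pow _
  · exact (quasiCommutes_t i _ _).pow _

end Diagonal

end QuantumP

end

noncomputable section
namespace QuantumP

/-! ### Ordered monomials with integer exponents. -/

section Exponents

variable {n : ℕ}

open Classical in
/-- The list of all PBW generators in increasing order. -/
def gens (n : ℕ) : List (PBWGen n) :=
  (Finset.univ : Finset (PBWGen n)).toList.insertionSort PBWGen.Le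

lemma mem_gens (g : PBWGen n) : g ∈ gens n := by
  classical
  exact (List.perm_insertionSort PBWGen.Le _).mem_iff.mpr (by simp)

lemma gens_nodup : (gens n).Nodup := by
  classical
  exact (List.perm_insertionSort PBWGen.Le _).nodup_iff.mpr (Finset.nodup_toList _)

lemma gens_pairwise : (gens n).Pairwise PBWGen.Prec := by
  classical
  exact ((List.pairwise_insertionSort PBWGen.Le _).and gens_nodup).imp fun h => h.1.resolve_right h.2

/-- The admissible exponents of reduced monomials. -/
def IsExponent (e : PBWGen n → ℤ) : Prop :=
  (∀ g : PBWGen n, ¬ g.IsDiag → 0 ≤ e g) ∧ ∀ g : PBWGen n, g.IsOdd → e g ≤ 1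

/-- The ordered monomial with given exponents. -/
def mon (e : PBWGen n → ℤ) : Uqp n := ((gens n).map fun g => g.pow (e g)).prod

lemma PBWGen.IsDiag.not_isOdd {g : PBWGen n} (hg : g.IsDiag) : ¬ g.IsOdd := by
  rw [PBWGen.IsOdd, hg, ← two_mul]
  exact Nat.not_odd_iff_even.mpr (even_two_mul _)

lemma PBWGen.pow_zero (g : PBWGen n) : g.pow 0 = 1 := by
  rw [PBWGen.pow]
  split_ifs <;> simp

lemma PBWGen.pow_natCast (g : PBWGen n) (m : ℕ) : g.pow m = t g.1.1 g.1.2 ^ m := by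
  rw [PBWGen.pow]
  split_ifs with h
  · rw [zpow_natCast, Units.val_pow_eq_pow_val, ← show g.1.1 = g.1.2 from h]
    rfl
  · rw [Int.toNat_natCast]

lemma PBWGen.IsDiag.mul_pow {g : PBWGen n} (hg : g.IsDiag) (k : ℤ) :
    t g.1.1 g.1.1 * g.pow k = g.pow (k + 1) := by
  rw [PBWGen.pow, PBWGen.pow, if_pos hg, if_pos hg, add_comm, zpow_one_add, Units.val_mul]
  rfl

/-- The diagonal factor moves right, collecting nonzero scalars, until it meets its own power. -/
lemma t_diag_mul_prod {g : PBWGen n} (hg : g.IsDiag) (e : PBWGen n → ℤ) {L : List (PBWGen n)}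
    (hL : L.Nodup) (hgL : g ∈ L) :
    ∃ c : Cq, c ≠ 0 ∧ t g.1.1 g.1.1 * (L.map fun h => h.pow (e h)).prod =
      c • (L.map fun h => h.pow ((e + Pi.single g 1 : PBWGen n → ℤ) h)).prod := by
  induction L with
  | nil => simp at hgL
  | cons k L ih =>
    rw [List.nodup_cons] at hL
    rw [List.map_cons, List.map_cons, List.prod_cons, List.prod_cons]
    by_cases hk : g = k
    · subst hk
      refine ⟨1, one_ne_zero, ?_⟩
      rw [one_smul, ← mul_assoc, hg.mul_pow, Pi.add_apply, Pi.single_eq_same]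
      refine congrArg _ (congrArg _ (List.map_congr_left fun h hh => ?_))
      rw [Pi.add_apply, Pi.single_eq_of_ne, add_zero]
      rintro rfl
      exact hL.1 hh
    · obtain ⟨c, hc, h1⟩ := ih hL.2 ((List.mem_cons.mp hgL).resolve_left hk)
      obtain ⟨χ, hχ, h2⟩ := QuasiCommutes.pbwPow g.1.1 k (e k)
      refine ⟨χ * c, mul_ne_zero hχ hc, ?_⟩
      rw [← mul_assoc, h2, smul_mul_assoc, mul_assoc, h1, mul_smul_comm, smul_smul, Pi.add_apply,
        Pi.single_eq_of_ne (fun h => hk h.symm), add_zero]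

lemma t_diag_mul_mon {g : PBWGen n} (hg : g.IsDiag) (e : PBWGen n → ℤ) :
    ∃ c : Cq, c ≠ 0 ∧ t g.1.1 g.1.1 * mon e = c • mon (e + Pi.single g 1) :=
  t_diag_mul_prod hg e gens_nodup (mem_gens g)

lemma tword_mul_mon {l : List (PBWGen n)} (hl : ∀ g ∈ l, g.IsDiag) (e : PBWGen n → ℤ) :
    ∃ c : Cq, c ≠ 0 ∧ tword (letters l) * mon e = c • mon (fun g => e g + l.count g) := by
  induction l with
  | nil => exact ⟨1, one_ne_zero, by simp [tword, letters]⟩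
  | cons g l ih =>
    obtain ⟨c, hc, h1⟩ := ih fun h hh => hl h (List.mem_cons_of_mem _ hh)
    have hg : g.IsDiag := hl g List.mem_cons_self
    obtain ⟨c', hc', h2⟩ := t_diag_mul_mon hg fun g => e g + l.count g
    refine ⟨c * c', mul_ne_zero hc hc', ?_⟩
    rw [letters_cons, tword_cons, mul_assoc, h1, mul_smul_comm, ← show g.1.1 = g.1.2 from hg, h2,
      smul_smul]
    refine congrArg _ (congrArg mon (funext fun k => ?_))
    rw [Pi.add_apply, List.count_cons, Pi.single_apply]
    by_cases h : k = g
    · subst h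
      simp [add_assoc]
    · rw [if_neg h, if_neg (by rw [beq_iff_eq]; exact fun h' => h h'.symm)]
      simp

/-- The reduced word with given nonnegative exponents. -/
def expWord (L : List (PBWGen n)) (m : PBWGen n → ℕ) : List (PBWGen n) :=
  L.flatMap fun g => List.replicate (m g) g

lemma tword_expWord (L : List (PBWGen n)) (m : PBWGen n → ℕ) :
    tword (letters (expWord L m)) = (L.map fun g => g.pow (m g)).prod := by
  induction L with
  | nil => rfl
  | cons g L ih =>
    rw [expWord, List.flatMap_cons, letters, List.map_append, tword_append, List.map_cons,
      List.prod_cons, ← ih, PBWGen.pow_natCast]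
    refine congrArg₂ _ ?_ rfl
    rw [tword, List.map_map, List.map_replicate, List.prod_replicate]
    rfl

lemma count_expWord {L : List (PBWGen n)} (hL : L.Nodup) (m : PBWGen n → ℕ) (g : PBWGen n) :
    (expWord L m).count g = if g ∈ L then m g else 0 := by
  induction L with
  | nil => simp [expWord]
  | cons k L ih =>
    rw [List.nodup_cons] at hL
    rw [expWord, List.flatMap_cons, List.count_append, List.count_replicate]
    have h1 := ih hL.2
    rw [expWord] at h1
    rw [h1]
    by_cases hk : k = g
    · subst hk
      simp [hL.1]
    · rw [if_neg (by rw [beq_iff_eq]; exact hk), zero_add]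
      exact if_congr (by rw [List.mem_cons, or_iff_right fun h => hk h.symm]) rfl rfl

lemma expWord_pairwise {m : PBWGen n → ℕ} (hm : ∀ g : PBWGen n, g.IsOdd → m g ≤ 1) :
    (expWord (gens n) m).Pairwise PBWGen.Step := by
  rw [expWord, List.pairwise_flatMap]
  refine ⟨fun g _ => ?_, gens_pairwise.imp fun h x hx y hy => ?_⟩
  · rw [List.pairwise_replicate]
    by_cases hg : g.IsOdd
    · exact Or.inl (hm g hg)
    · exact Or.inr (Or.inr ⟨rfl, hg⟩)
  · rw [List.eq_of_mem_replicate hx, List.eq_of_mem_replicate hy]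
    exact Or.inl h

lemma count_le_one {w : List (PBWGen n)} (hw : w.Pairwise PBWGen.Step) {g : PBWGen n}
    (hg : g.IsOdd) : w.count g ≤ 1 := by
  induction w with
  | nil => simp
  | cons k w ih =>
    rw [List.count_cons]
    split_ifs with h
    · rw [beq_iff_eq] at h
      subst h
      rw [List.count_eq_zero.mpr fun h => not_isOdd_of_mem hw h hg]
    · exact ih (List.pairwise_cons.mp hw).2

lemma expWord_count {w : List (PBWGen n)} (hw : w.Pairwise PBWGen.Step) :
    expWord (gens n) (fun g => w.count g) = w := by
  refine eq_of_perm_of_step ?_ (expWord_pairwise fun g hg => count_le_one hw hg) hw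
  rw [List.perm_iff_count]
  intro g
  rw [count_expWord gens_nodup, if_pos (mem_gens g)]

lemma mon_natCast (m : PBWGen n → ℕ) :
    mon (fun g => (m g : ℤ)) = tword (letters (expWord (gens n) m)) := (tword_expWord _ _).symm

/-- Finitely many exponents become nonnegative after adding suitable diagonal exponents. -/
lemma exists_shift (s : Finset (PBWGen n → ℤ)) (hs : ∀ e ∈ s, IsExponent e) :
    ∃ l : List (PBWGen n), (∀ g ∈ l, g.IsDiag) ∧ ∀ e ∈ s, ∀ g, 0 ≤ e g + l.count g := by
  classical
  let N : ℕ := s.sup fun e => Finset.univ.sup fun g => (-(e g)).toNat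
  refine ⟨expWord ((gens n).filter fun g => g.IsDiag) fun _ => N, fun g hg => ?_, fun e he g => ?_⟩
  · rw [expWord, List.mem_flatMap] at hg
    obtain ⟨k, hk, hg⟩ := hg
    rw [List.eq_of_mem_replicate hg]
    simpa using (List.mem_filter.mp hk).2
  · rw [count_expWord (gens_nodup.filter _)]
    by_cases hg : g.IsDiag
    · rw [if_pos (List.mem_filter.mpr ⟨mem_gens g, by simpa using hg⟩)]
      have h1 : (-(e g)).toNat ≤ N :=
        (Finset.le_sup (f := fun g => (-(e g)).toNat) (Finset.mem_univ g)).trans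
          (Finset.le_sup (f := fun e : PBWGen n → ℤ => Finset.univ.sup fun g => (-(e g)).toNat) he)
      omega
    · have := (hs e he).1 g hg
      positivity

/-- Left multiplication by a product of diagonal generators makes the finitely many exponents
nonnegative. It carries the monomials to nonzero multiples of distinct reduced words, whose
independence is known. -/
theorem linearIndependent_mon :
    LinearIndependent Cq fun e : {e : PBWGen n → ℤ // IsExponent e} => mon e.1 := by
  classical
  rw [linearIndependent_iff_finset_linearIndependent]
  intro s
  obtain ⟨l, hl, hs⟩ := exists_shift (s.image Subtype.val) fun e he => by
    obtain ⟨e, _, rfl⟩ := Finset.mem_image.mp he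
    exact e.2
  have hs' : ∀ (e : s) g, 0 ≤ e.1.1 g + l.count g := fun e g =>
    hs _ (Finset.mem_image_of_mem _ e.2) g
  choose c hc h1 using fun e : s => tword_mul_mon hl e.1.1
  let m : s → PBWGen n → ℕ := fun e g => (e.1.1 g + l.count g).toNat
  have hm : ∀ e g, (m e g : ℤ) = e.1.1 g + l.count g := fun e g => Int.toNat_of_nonneg (hs' e g)
  have hodd : ∀ (e : s) (g : PBWGen n), g.IsOdd → m e g ≤ 1 := by
    intro e g hg
    have h2 : l.count g = 0 := List.count_eq_zero.mpr fun h => (hl g h).not_isOdd hg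
    have h3 := e.1.2.2 g hg
    have h4 := hm e g
    omega
  let φ : s → ReducedWord n := fun e => ⟨expWord (gens n) (m e), expWord_pairwise (hodd e)⟩
  have hφ : Function.Injective φ := by
    intro e e' h
    refine Subtype.ext (Subtype.ext (funext fun g => ?_))
    have h2 : expWord (gens n) (m e) = expWord (gens n) (m e') := Subtype.ext_iff.mp h
    have h3 := congrArg (List.count g) h2
    rw [count_expWord gens_nodup, count_expWord gens_nodup, if_pos (mem_gens g),
      if_pos (mem_gens g)] at h3
    have h4 := hm e g
    have h5 := hm e' g
    omega
  have h2 := (linearIndependent_tword.comp φ hφ).units_smul fun e => Units.mk0 (c e) (hc e)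
  refine LinearIndependent.of_comp (LinearMap.mulLeft Cq (tword (letters l))) ?_
  have h3 : (⇑(LinearMap.mulLeft Cq (tword (letters l))) ∘ fun e : s => mon e.1.1) =
      (fun e => Units.mk0 (c e) (hc e)) • ((fun w : ReducedWord n => tword (letters w.1)) ∘ φ) := by
    funext e
    change tword (letters l) * mon e.1.1 = c e • tword (letters (expWord (gens n) (m e)))
    rw [h1, ← mon_natCast]
    refine congrArg _ (congrArg mon (funext fun g => ?_))
    exact (hm e g).symm
  exact h3 ▸ h2

end Exponents

end QuantumP

end

noncomputable section
namespace QuantumP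

/-! ### Spanning by monomials and the bijection with reduced monomials. -/

section Basis

variable {n : ℕ}

/-- The span of the ordered monomials with admissible exponents. -/
def monSpan (n : ℕ) : Submodule Cq (Uqp n) :=
  Submodule.span Cq (Set.range fun e : {e : PBWGen n → ℤ // IsExponent e} => mon e.1)

lemma mon_mem_monSpan {e : PBWGen n → ℤ} (he : IsExponent e) : mon e ∈ monSpan n :=
  Submodule.subset_span ⟨⟨e, he⟩, rfl⟩

lemma tword_mem_monSpan (w : List (Idx n × Idx n)) : tword w ∈ monSpan n := by
  refine Submodule.span_le.mpr ?_ (tword_mem_span w)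
  rintro x ⟨w, rfl⟩
  have h1 : mon (fun g => (w.1.count g : ℤ)) = tword (letters w.1) := by
    rw [mon_natCast, expWord_count w.2]
  change tword (letters w.1) ∈ monSpan n
  rw [← h1]
  exact mon_mem_monSpan ⟨fun g _ => Int.natCast_nonneg _, fun g hg =>
    Int.ofNat_le.mpr (count_le_one w.2 hg)⟩

lemma mul_mem_monSpan {a : Uqp n} (h : ∀ e : PBWGen n → ℤ, IsExponent e → a * mon e ∈ monSpan n)
    {x : Uqp n} (hx : x ∈ monSpan n) : a * x ∈ monSpan n := by
  have h1 : monSpan n ≤ (monSpan n).comap (LinearMap.mulLeft Cq a) := by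
    refine Submodule.span_le.mpr ?_
    rintro x ⟨e, rfl⟩
    exact h e.1 e.2
  exact h1 hx

lemma tinv_mul_mem_monSpan_of_isDiag {g : PBWGen n} (hg : g.IsDiag) {x : Uqp n}
    (hx : x ∈ monSpan n) : tinv g.1.1 * x ∈ monSpan n := by
  refine mul_mem_monSpan (fun e he => ?_) hx
  obtain ⟨c, hc, h1⟩ := t_diag_mul_mon hg (e - Pi.single g 1)
  rw [sub_add_cancel] at h1
  have h2 : tinv g.1.1 * mon e = c⁻¹ • mon (e - Pi.single g 1) := by
    rw [eq_inv_smul_iff₀ hc, ← mul_smul_comm, ← h1, ← mul_assoc, isRTT_t.inv_mul, one_mul]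
  rw [h2]
  refine Submodule.smul_mem _ _ (mon_mem_monSpan ⟨fun k hk => ?_, fun k hk => ?_⟩)
  · have h3 : k ≠ g := by
      rintro rfl
      exact hk hg
    rw [Pi.sub_apply, Pi.single_eq_of_ne h3, sub_zero]
    exact he.1 k hk
  · have h3 : k ≠ g := by
      rintro rfl
      exact hg.not_isOdd hk
    rw [Pi.sub_apply, Pi.single_eq_of_ne h3, sub_zero]
    exact he.2 k hk

lemma tinv_neg (i : Idx n) : tinv (-i) = tinv i := by
  have h1 : tdiag (-i) = tdiag i := Units.ext (isRTT_t.diag i).symm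
  exact congrArg (fun u : (Uqp n)ˣ => (↑u⁻¹ : Uqp n)) h1

lemma tinv_mul_mem_monSpan (i : Idx n) {x : Uqp n} (hx : x ∈ monSpan n) :
    tinv i * x ∈ monSpan n := by
  rcases pos_or_neg i with hi | hi
  · exact tinv_mul_mem_monSpan_of_isDiag (g := ⟨(i, i), Or.inr ⟨rfl, hi⟩⟩) rfl hx
  · rw [← tinv_neg]
    refine tinv_mul_mem_monSpan_of_isDiag (g := ⟨(-i, -i), Or.inr ⟨rfl, ?_⟩⟩) rfl hx
    change 0 < (-i).1
    rw [neg_val]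
    omega

/-- The span is stable under the inverses of diagonal generators, which strip off the factors one by
one. -/
lemma mem_monSpan_of_tword_mul_mem {l : List (PBWGen n)} (hl : ∀ g ∈ l, g.IsDiag) {x : Uqp n}
    (hx : tword (letters l) * x ∈ monSpan n) : x ∈ monSpan n := by
  induction l with
  | nil => rwa [tword, letters, List.map_nil, List.map_nil, List.prod_nil, one_mul] at hx
  | cons g l ih =>
    have hg : g.1.1 = g.1.2 := hl g List.mem_cons_self
    refine ih (fun h hh => hl h (List.mem_cons_of_mem _ hh)) ?_
    have h1 := tinv_mul_mem_monSpan g.1.1 hx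
    rwa [letters_cons, tword_cons, ← hg, ← mul_assoc, ← mul_assoc, isRTT_t.inv_mul, one_mul] at h1

lemma tword_mul_t {l : List (PBWGen n)} (hl : ∀ g ∈ l, g.IsDiag) (i j : Idx n) :
    ∃ c : Cq, tword (letters l) * t i j = c • (t i j * tword (letters l)) := by
  induction l with
  | nil => exact ⟨1, by simp [tword, letters]⟩
  | cons g l ih =>
    have hg : g.1.1 = g.1.2 := hl g List.mem_cons_self
    obtain ⟨c, h1⟩ := ih fun h hh => hl h (List.mem_cons_of_mem _ hh)
    obtain ⟨χ, _, h2⟩ := quasiCommutes_t g.1.1 i j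
    refine ⟨c * χ, ?_⟩
    rw [letters_cons, tword_cons, ← hg, mul_assoc, h1, mul_smul_comm, ← mul_assoc, h2,
      smul_mul_assoc, smul_smul, mul_assoc]

/-- Denominators are cleared: diagonal factors placed on the left pass t_{ij} up to a scalar and
turn the monomial into a word. The product then lies in the span, and the factors are stripped off
again. -/
lemma t_mul_mem_monSpan (i j : Idx n) {x : Uqp n} (hx : x ∈ monSpan n) :
    t i j * x ∈ monSpan n := by
  refine mul_mem_monSpan (fun e he => ?_) hx
  obtain ⟨l, hl, hs⟩ := exists_shift {e} (by simpa using he)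
  obtain ⟨c, _, h1⟩ := tword_mul_mon hl e
  obtain ⟨χ, h2⟩ := tword_mul_t hl i j
  refine mem_monSpan_of_tword_mul_mem hl ?_
  have h3 : (fun g => e g + (l.count g : ℤ)) = fun g => ((e g + l.count g).toNat : ℤ) :=
    funext fun g => (Int.toNat_of_nonneg (hs e (Finset.mem_singleton_self e) g)).symm
  rw [← mul_assoc, h2, smul_mul_assoc, mul_assoc, h1, mul_smul_comm, h3, mon_natCast]
  refine Submodule.smul_mem _ _ (Submodule.smul_mem _ _ ?_)
  exact tword_mem_monSpan ((i, j) :: letters _)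

/-- The span contains 1 and is stable under left multiplication by all generators. -/
theorem monSpan_eq_top : monSpan n = ⊤ := by
  rw [Submodule.eq_top_iff']
  intro x
  obtain ⟨a, rfl⟩ := RingQuot.mkAlgHom_surjective Cq (Rel n) x
  have h1 : ∀ y ∈ monSpan n, RingQuot.mkAlgHom Cq (Rel n) a * y ∈ monSpan n := by
    induction a using FreeAlgebra.induction with
    | grade0 c =>
      intro y hy
      rw [AlgHom.commutes, ← Algebra.smul_def]
      exact Submodule.smul_mem _ _ hy
    | grade1 g =>
      intro y hy
      cases g with
      | t i j => exact t_mul_mem_monSpan i j hy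
      | tinv i => exact tinv_mul_mem_monSpan i hy
    | mul a b ha hb =>
      intro y hy
      rw [map_mul, mul_assoc]
      exact ha _ (hb _ hy)
    | add a b ha hb =>
      intro y hy
      rw [map_add, add_mul]
      exact add_mem (ha y hy) (hb y hy)
  have h2 := h1 1 (tword_mem_monSpan [])
  rwa [mul_one] at h2

lemma ReducedMonomial.ext' {m m' : ReducedMonomial n} (h : m.word = m'.word) : m = m' := by
  cases m
  cases m'
  cases h
  rfl

open Classical in
/-- The reduced monomial with given exponents. -/
def ofExponent (e : {e : PBWGen n → ℤ // IsExponent e}) : ReducedMonomial n where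
  word := ((gens n).filter fun g => e.1 g ≠ 0).map fun g => (g, e.1 g)
  sorted := by
    rw [List.pairwise_map]
    exact gens_pairwise.sublist List.filter_sublist
  ne_zero a ha := by
    obtain ⟨g, hg, rfl⟩ := List.mem_map.mp ha
    simpa using (List.mem_filter.mp hg).2
  pos a ha hd := by
    obtain ⟨g, hg, rfl⟩ := List.mem_map.mp ha
    have h1 : e.1 g ≠ 0 := by simpa using (List.mem_filter.mp hg).2
    exact lt_of_le_of_ne (e.2.1 g hd) h1.symm
  odd a ha ho := by
    obtain ⟨g, hg, rfl⟩ := List.mem_map.mp ha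
    have h1 : e.1 g ≠ 0 := by simpa using (List.mem_filter.mp hg).2
    have h2 := e.2.1 g fun hd => PBWGen.IsDiag.not_isOdd hd ho
    have h3 := e.2.2 g ho
    change e.1 g = 1
    omega

lemma mem_ofExponent {e : {e : PBWGen n → ℤ // IsExponent e}} {a : PBWGen n × ℤ} :
    a ∈ (ofExponent e).word ↔ a.2 ≠ 0 ∧ e.1 a.1 = a.2 := by
  rw [ofExponent, List.mem_map]
  constructor
  · rintro ⟨g, hg, rfl⟩
    exact ⟨by simpa using (List.mem_filter.mp hg).2, rfl⟩
  · rintro ⟨h1, h2⟩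
    refine ⟨a.1, List.mem_filter.mpr ⟨mem_gens _, by simpa [h2] using h1⟩, Prod.ext rfl h2⟩

lemma eval_ofExponent (e : {e : PBWGen n → ℤ // IsExponent e}) :
    (ofExponent e).eval = mon e.1 := by
  classical
  rw [ReducedMonomial.eval, ofExponent, mon, List.map_map]
  induction gens n with
  | nil => rfl
  | cons g L ih =>
    rw [List.filter_cons]
    by_cases h : e.1 g = 0
    · rw [if_neg (by simpa using h), ih, List.map_cons, List.prod_cons, h, PBWGen.pow_zero, one_mul]
    · rw [if_pos (by simpa using h), List.map_cons, List.prod_cons, ih, List.map_cons,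
        List.prod_cons]
      rfl

lemma eq_of_mem_of_pairwise {l : List (PBWGen n × ℤ)} (hl : l.Pairwise fun a b => a.1.Prec b.1)
    {g : PBWGen n} {k k' : ℤ} (h : (g, k) ∈ l) (h' : (g, k') ∈ l) : k = k' := by
  induction l with
  | nil => simp at h
  | cons a l ih =>
    rw [List.pairwise_cons] at hl
    rcases List.mem_cons.mp h with rfl | h1
    · rcases List.mem_cons.mp h' with h1 | h1
      · exact (congrArg Prod.snd h1).symm
      · have h2 : g.Prec g := hl.1 (g, k') h1
        exact absurd h2 (PBWGen.Prec.irrefl g)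
    · rcases List.mem_cons.mp h' with rfl | h2
      · have h3 : g.Prec g := hl.1 (g, k) h1
        exact absurd h3 (PBWGen.Prec.irrefl g)
      · exact ih hl.2 h1 h2

/-- A strictly sorted word is determined by its set of letters with exponents, and absent letters
correspond to exponent 0. -/
lemma ofExponent_bijective : Function.Bijective (ofExponent (n := n)) := by
  classical
  constructor
  · intro e e' h
    refine Subtype.ext (funext fun g => ?_)
    have h1 : ∀ k : ℤ, k ≠ 0 → (e.1 g = k ↔ e'.1 g = k) := by
      intro k hk
      have h2 := (mem_ofExponent (e := e) (a := (g, k)))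
      rw [h, mem_ofExponent] at h2
      simpa [hk] using h2.symm
    by_cases h2 : e.1 g = 0
    · by_contra h3
      exact h3 ((h1 _ fun h4 => h3 (h2.trans h4.symm)).mpr rfl)
    · exact ((h1 _ h2).mp rfl).symm
  · intro m
    let e : PBWGen n → ℤ := fun g => if h : ∃ k, (g, k) ∈ m.word then h.choose else 0
    have he : ∀ {g k}, (g, k) ∈ m.word → e g = k := by
      intro g k h
      have h1 : ∃ k, (g, k) ∈ m.word := ⟨k, h⟩
      simp only [e, dif_pos h1]
      exact eq_of_mem_of_pairwise m.sorted h1.choose_spec h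
    have he' : ∀ g, e g ≠ 0 → (g, e g) ∈ m.word := by
      intro g h
      by_cases h1 : ∃ k, (g, k) ∈ m.word
      · obtain ⟨k, hk⟩ := h1
        rwa [he hk]
      · exact absurd (dif_neg h1) h
    have hexp : IsExponent e := by
      constructor
      · intro g hg
        by_cases h : e g = 0
        · exact h.ge
        · exact (m.pos _ (he' g h) hg).le
      · intro g hg
        by_cases h : e g = 0
        · rw [h]
          exact zero_le_one
        · exact (m.odd _ (he' g h) hg).le
    refine ⟨⟨e, hexp⟩, ReducedMonomial.ext' ?_⟩
    have hnd : ∀ m : ReducedMonomial n, m.word.Nodup := fun m => m.sorted.imp fun h hh => by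
      rw [hh] at h
      exact PBWGen.Prec.irrefl _ h
    refine List.Perm.eq_of_pairwise (fun a b _ _ h1 h2 => absurd (h1.trans h2) (PBWGen.Prec.irrefl _))
      (ofExponent _).sorted m.sorted ?_
    rw [List.perm_ext_iff_of_nodup (hnd _) (hnd _)]
    rintro ⟨g, k⟩
    rw [mem_ofExponent]
    constructor
    · rintro ⟨h1, h2⟩
      change e g = k at h2
      rw [← h2] at h1 ⊢
      exact he' g h1
    · intro h
      exact ⟨m.ne_zero _ h, he h⟩

end Basis

end QuantumP

end

theorem theorem4p2 (n : ℕ) :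
    ∃ b : Module.Basis (QuantumP.ReducedMonomial n) QuantumP.Cq (QuantumP.Uqp n),
      ∀ m : QuantumP.ReducedMonomial n, b m = m.eval := by
  let φ := Equiv.ofBijective _ (QuantumP.ofExponent_bijective (n := n))
  have h : ⊤ ≤ Submodule.span QuantumP.Cq (Set.range fun e :
      {e : QuantumP.PBWGen n → ℤ // QuantumP.IsExponent e} => QuantumP.mon e.1) :=
    QuantumP.monSpan_eq_top.ge
  refine ⟨(Module.Basis.mk QuantumP.linearIndependent_mon h).reindex φ, fun m => ?_⟩
  rw [Module.Basis.reindex_apply, Module.Basis.mk_apply, ← QuantumP.eval_ofExponent]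
  exact congrArg _ (φ.apply_symm_apply m)
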